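/- **Definitions.** A symmetric real $n\times n$ matrix $C=(c_{ij})$ is a *Demidenko matrix* if $c_{ji}+c_{kl}\le c_{jl}+c_{ki}$ for all $1\le i<j<k<l\le n$. A permutation $\varphi$ of $\{1,\dots,n\}$ is a *Demidenko permutation* for $C$ if $C^{\varphi}=(c_{\varphi(i)\varphi(j)})$ is a Demidenko matrix, and $C$ is a *permuted Demidenko matrix* if it has one. A symmetric matrix $A=(a_{ij})$ is an *Anti-Robinson matrix* if $a_{ik}\ge\max\{a_{ij},a_{jk}\}$ for all $i<j<k$; *Anti-Robinson permutations* and *permuted Anti-Robinson matrices* are defined likewise. **The subroutine.** ALG is any subroutine that, given a symmetric $m\times m$ matrix $A$, returns FALSE if $A$ is not a permuted Anti-Robinson matrix, and otherwise returns TRUE together with some Anti-Robinson permutation for $A$. (Which one is not prescribed. An $O(m^2)$ algorithm of this kind was given by Préa and Fortin.) **Procedure CheckCandidateDP**$(C,n,r,\pi)$, where $\pi(1),\dots,\pi(r)$ and $\pi(n)$ are fixed. Let $I'=\{1,\dots,n\}\setminus\{\pi(1),\dots,\pi(r),\pi(n)\}$. If $I'=\emptyset$, return (TRUE, $\pi$).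 Otherwise let $K=\{s_1<\dots<s_{k}\}$ be the set of all $i\in I'$ at which $\sum_{x=1}^{r}c_{i\pi(x)}-r\,c_{i\pi(n)}$ attains its minimum over $I'$. 1. If $k=1$, set $\pi(r+1)=s_1$ and return the result of the recursive call with $r+1$ fixed entries. 2. Otherwise, if $k=n-r-1$, call ALG on $C[K]$. If it returns FALSE, return FALSE; if it returns (TRUE, $\psi$), set $\pi(r+i)=s_{\psi(i)}$ for $1\le i\le k$ and return (TRUE, $\pi$). 3. Otherwise let $M=2\sum_{i,j}|c_{ij}|$, and call ALG on the symmetric $(k+1)\times(k+1)$ matrix $D$ with $d_{ij}=c_{s_is_j}$ for $i,j\le k$, $d_{i,k+1}=d_{k+1,i}=M+\sum_{l\in I'\setminus K}c_{s_il}$ for $i\le k$, and $d_{k+1,k+1}=M$. If it returns FALSE, return FALSE. If it returns (TRUE, $\psi$), reverse $\psi$ in case $\psi(k+1)\ne k+1$, set $\pi(r+i)=s_{\psi(i)}$ for $1\le i\le k$, and return the result of the recursive call with $r+k$ fixed entries. **Algorithm RecognPD**$(C,n)$. For $p=1,\dots,n$ and for $q=1,\dots,n$ with $q\ne p$: let $c'_{ij}=c_{ij}-c_{pj}-c_{ip}$,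 set $\pi(1)=p$, $\pi(n)=q$, and call CheckCandidateDP$(C',n,1,\pi)$. If it returns (TRUE, $\pi$), and the matrix $A=(C')^{\pi}$ satisfies $\max_{i<j}(a_{ji}-a_{j+1,i})\le\min_{l>j+1}(a_{jl}-a_{j+1,l})$ for $2\le j\le n-2$, output that $C$ is a permuted Demidenko matrix, together with $\pi$, and stop. If no pair $(p,q)$ succeeds, output that $C$ is not a permuted Demidenko matrix. **Theorem.** (a) For every such ALG, every $n\ge2$ and every symmetric real $n\times n$ matrix $C$, the algorithm RecognPD correctly decides whether $C$ is a permuted Demidenko matrix, and in the positive case it outputs a Demidenko permutation for $C$. (b) RecognPD can be implemented to run in $O(n^4)$ time when ALG takes $O(m^2)$ time. Precisely: there is one program for a unit-cost real random access machine (integer and real memory; addition, subtraction, comparison, array access, and calls of ALG) such that for every constant $a$ there is a constant $c$ with the following property. For every ALG as above whose call on any symmetric $m\times m$ matrix takes at most $a\,m^2$ steps, every $n\ge2$ and every symmetric real $n\times n$ matrix $C$, the program halts on input $(n,C)$ after at most $c\,n^4$ steps, including the steps of the calls of ALG, with the output of RecognPD. -/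

import Mathlib

open scoped BigOperators

namespace Demidenko

noncomputable section

/-! Matrix classes. Rows and columns are indexed by `Fin n`, so indices start at `0`. -/

/-- A symmetric matrix with `c_{ji} + c_{kl} ≤ c_{jl} + c_{ki}` for all `i < j < k < l`. -/
def IsDemidenko {n : ℕ} (C : Matrix (Fin n) (Fin n) ℝ) : Prop :=
  C.IsSymm ∧ ∀ i j k l : Fin n, i < j → j < k → k < l → C j i + C k l ≤ C j l + C k i

/-- `φ` is a Demidenko permutation for `C`: the matrix `(c_{φ(i)φ(j)})` is a Demidenko matrix. -/
def IsDemidenkoPerm {n : ℕ} (C : Matrix (Fin n) (Fin n) ℝ) (φ : Equiv.Perm (Fin n)) : Prop :=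
  IsDemidenko (C.submatrix φ φ)

def IsPermutedDemidenko {n : ℕ} (C : Matrix (Fin n) (Fin n) ℝ) : Prop :=
  ∃ φ : Equiv.Perm (Fin n), IsDemidenkoPerm C φ

/-- A symmetric matrix with `a_{ik} ≥ max {a_{ij}, a_{jk}}` for all `i < j < k`. -/
def IsAntiRobinson {m : ℕ} (A : Matrix (Fin m) (Fin m) ℝ) : Prop :=
  A.IsSymm ∧ ∀ i j k : Fin m, i < j → j < k → max (A i j) (A j k) ≤ A i k

def IsAntiRobinsonPerm {m : ℕ} (A : Matrix (Fin m) (Fin m) ℝ) (φ : Equiv.Perm (Fin m)) : Prop :=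
  IsAntiRobinson (A.submatrix φ φ)

def IsPermutedAntiRobinson {m : ℕ} (A : Matrix (Fin m) (Fin m) ℝ) : Prop :=
  ∃ φ : Equiv.Perm (Fin m), IsAntiRobinsonPerm A φ

/-- The subroutine ALG. On an `m × m` matrix it outputs `none` (FALSE) or `some ψ` (TRUE together
with a permutation `ψ`), and the call takes `time m A` elementary steps. -/
structure Oracle where
  answer : (m : ℕ) → Matrix (Fin m) (Fin m) ℝ → Option (Equiv.Perm (Fin m))
  time : (m : ℕ) → Matrix (Fin m) (Fin m) ℝ → ℕ

/-- On symmetric matrices the subroutine solves the recognition problem for permuted Anti-Robinson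
matrices. Nothing is prescribed about which Anti-Robinson permutation it outputs. -/
def Oracle.Correct (O : Oracle) : Prop :=
  ∀ (m : ℕ) (A : Matrix (Fin m) (Fin m) ℝ), A.IsSymm →
    (O.answer m A = none → ¬ IsPermutedAntiRobinson A) ∧
    ∀ ψ, O.answer m A = some ψ → IsAntiRobinsonPerm A ψ

/-- A call on an `m × m` symmetric matrix takes at most `a * m ^ 2` steps. -/
def Oracle.QuadraticTime (O : Oracle) (a : ℕ) : Prop :=
  ∀ (m : ℕ) (A : Matrix (Fin m) (Fin m) ℝ), A.IsSymm → O.time m A ≤ a * m ^ 2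

/-! The algorithm. A partial permutation whose entries `π(1), …, π(r)` and `π(n) = q` are fixed is
represented by the list `P = [π(1), …, π(r)]` and the index `q`; thus `r = P.length`. -/

section Algorithm

variable {n : ℕ}

/-- The set `I'` of the indices that are not yet values of the partial permutation. -/
def remaining (P : List (Fin n)) (q : Fin n) : Finset (Fin n) :=
  Finset.univ.filter fun i => i ∉ P ∧ i ≠ q

/-- `∑_{x=1}^r c_{i π(x)} - r c_{i π(n)}`. -/
def score (C : Matrix (Fin n) (Fin n) ℝ) (P : List (Fin n)) (q i : Fin n) : ℝ :=
  (P.map fun x => C i x).sum - (P.length : ℝ) * C i q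

open Classical in
/-- The set `K` of the indices in `I'` at which the score attains its minimum over `I'`. -/
def minSet (C : Matrix (Fin n) (Fin n) ℝ) (P : List (Fin n)) (q : Fin n) : Finset (Fin n) :=
  (remaining P q).filter fun i => ∀ j ∈ remaining P q, score C P q i ≤ score C P q j

/-- The increasing enumeration `s_1 < s_2 < ⋯` of `K`. -/
def enum (K : Finset (Fin n)) : Fin K.card ↪o Fin n := K.orderEmbOfFin rfl

/-- The number `M = 2 ∑_{i,j} |c_{ij}|`. -/
def bigM (C : Matrix (Fin n) (Fin n) ℝ) : ℝ := 2 * ∑ i, ∑ j, |C i j|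

/-- The matrix `D`: the matrix `C[K]` with one more row and column appended, whose entries are
`M + ∑_{l ∈ I' \ K} c_{s_i l}`, and `M` on the diagonal. -/
def matrixD (C : Matrix (Fin n) (Fin n) ℝ) (I K : Finset (Fin n)) :
    Matrix (Fin (K.card + 1)) (Fin (K.card + 1)) ℝ :=
  let border : Fin K.card → ℝ := fun i => bigM C + ∑ l ∈ I \ K, C (enum K i) l
  fun i j => Fin.lastCases (motive := fun _ => ℝ)
    (Fin.lastCases (motive := fun _ => ℝ) (bigM C) border j)
    (fun i' => Fin.lastCases (motive := fun _ => ℝ) (border i')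
      (fun j' => C (enum K i') (enum K j')) j) i

/-- The reverse of an Anti-Robinson permutation is one too. Of these two, choose the one that keeps
the appended index last. -/
def orient {k : ℕ} (ψ : Equiv.Perm (Fin (k + 1))) : Equiv.Perm (Fin (k + 1)) :=
  if ψ (Fin.last k) = Fin.last k then ψ else Fin.revPerm.trans ψ

/-- The list of the `s_{ψ(i)}` after orienting `ψ` and discarding the appended index. -/
def blockOf (K : Finset (Fin n)) (ψ : Equiv.Perm (Fin (K.card + 1))) : List (Fin n) :=
  (List.finRange (K.card + 1)).filterMap fun i =>
    Fin.lastCases (motive := fun _ => Option (Fin n)) none (fun j => some (enum K j)) (orient ψ i)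

theorem minSet_nonempty (C : Matrix (Fin n) (Fin n) ℝ) (P : List (Fin n)) (q : Fin n)
    (h : remaining P q ≠ ∅) : (minSet C P q).Nonempty := by
  obtain ⟨i, hi, hm⟩ := Finset.exists_min_image (remaining P q) (score C P q)
    (Finset.nonempty_iff_ne_empty.mpr h)
  exact ⟨i, by simp only [minSet, Finset.mem_filter]; exact ⟨hi, hm⟩⟩

theorem mem_blockOf (K : Finset (Fin n)) (ψ : Equiv.Perm (Fin (K.card + 1))) {x : Fin n}
    (hx : x ∈ K) : x ∈ blockOf K ψ := by
  have hr : x ∈ Set.range (enum K) := by simpa [enum] using hx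
  obtain ⟨j, rfl⟩ := hr
  simp only [blockOf, List.mem_filterMap]
  exact ⟨(orient ψ).symm j.castSucc, List.mem_finRange _, by simp⟩

theorem remaining_append_lt (C : Matrix (Fin n) (Fin n) ℝ) (P B : List (Fin n)) (q : Fin n)
    (h : remaining P q ≠ ∅) (hB : ∀ x ∈ minSet C P q, x ∈ B) :
    (remaining (P ++ B) q).card < (remaining P q).card := by
  obtain ⟨x, hx⟩ := minSet_nonempty C P q h
  have hx' : x ∈ remaining P q := (Finset.mem_filter.mp hx).1
  refine Finset.card_lt_card (Finset.ssubset_iff_of_subset ?_ |>.mpr ⟨x, hx', ?_⟩)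
  · intro y hy
    simp only [remaining, Finset.mem_filter, List.mem_append, not_or] at hy ⊢
    tauto
  · simp [remaining, hB x hx]

/-- The recursive procedure CheckCandidateDP. The output `none` stands for FALSE, and `some L` for
TRUE together with the permutation `L = [π(1), …, π(n)]`. -/
def checkCandidateDP (O : Oracle) (C : Matrix (Fin n) (Fin n) ℝ) (q : Fin n)
    (P : List (Fin n)) : Option (List (Fin n)) :=
  let K := minSet C P q
  if _h : remaining P q = ∅ then some (P ++ [q])
  else if K.card = 1 then checkCandidateDP O C q (P ++ K.sort (· ≤ ·))
  else if K.card + P.length + 1 = n then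
    match O.answer K.card (C.submatrix (enum K) (enum K)) with
    | none => none
    | some ψ => some (P ++ List.ofFn (fun i => enum K (ψ i)) ++ [q])
  else
    match O.answer (K.card + 1) (matrixD C (remaining P q) K) with
    | none => none
    | some ψ => checkCandidateDP O C q (P ++ blockOf K ψ)
termination_by (remaining P q).card
decreasing_by
  · exact remaining_append_lt C P _ q _h (fun x hx => by simpa using hx)
  · exact remaining_append_lt C P _ q _h (fun x hx => mem_blockOf _ _ hx)

/-- `max_{i<j} (a_{ji} - a_{j+1,i}) ≤ min_{l>j+1} (a_{jl} - a_{j+1,l})` for all `j` for which both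
ranges are non-empty. -/
def AdjacentCondition (A : Matrix (Fin n) (Fin n) ℝ) : Prop :=
  ∀ i j k l : Fin n, i < j → (k : ℕ) = j + 1 → k < l → A j i - A k i ≤ A j l - A k l

/-- The matrix `c'_{ij} = c_{ij} - c_{pj} - c_{ip}`. -/
def shifted (C : Matrix (Fin n) (Fin n) ℝ) (p : Fin n) : Matrix (Fin n) (Fin n) ℝ :=
  fun i j => C i j - C p j - C i p

/-- The list `L = [π(1), …, π(n)]` has length `n`, and `A^π` fulfils the adjacent condition. -/
def PassesTest (A : Matrix (Fin n) (Fin n) ℝ) (L : List (Fin n)) : Prop :=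
  ∃ h : L.length = n, AdjacentCondition
    (A.submatrix (fun i => L.get (Fin.cast h.symm i)) (fun i => L.get (Fin.cast h.symm i)))

open Classical in
/-- The body of the double loop of RecognPD for a fixed pair `(p, q)`. -/
def tryPair (O : Oracle) (C : Matrix (Fin n) (Fin n) ℝ) (p q : Fin n) : Option (List (Fin n)) :=
  match checkCandidateDP O (shifted C p) q [p] with
  | none => none
  | some L => if PassesTest (shifted C p) L then some L else none

/-- The algorithm RecognPD: the pairs `(p, q)` with `p ≠ q` are tried in lexicographic order, up to
the first success. The output `none` stands for "`C` is not a permuted Demidenko matrix". -/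
def recognPD (O : Oracle) (C : Matrix (Fin n) (Fin n) ℝ) : Option (List (Fin n)) :=
  (List.finRange n).findSome? fun p =>
    (List.finRange n).findSome? fun q => if p = q then none else tryPair O C p q

end Algorithm

/-! The machine model: a real random access machine with unit costs, programmed in a small
imperative language. The memory consists of variables and one-dimensional arrays that hold natural
numbers, and of variables and two-dimensional arrays that hold real numbers; all names are natural
numbers. The operations are addition, subtraction, comparison, array access, and the call of the
subroutine ALG. -/

structure Store where
  natVar : ℕ → ℕ
  natArr : ℕ → ℕ → ℕ
  realVar : ℕ → ℝ
  realArr : ℕ → ℕ → ℕ → ℝ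

/-- Integer expressions; `arr x e` is the entry `x[e]`, and subtraction is truncated at `0`. -/
inductive NExpr
  | lit (k : ℕ)
  | var (x : ℕ)
  | arr (x : ℕ) (e : NExpr)
  | add (e f : NExpr)
  | sub (e f : NExpr)

/-- Real expressions; `arr x e f` is the entry `x[e, f]`. -/
inductive RExpr
  | zero
  | var (x : ℕ)
  | arr (x : ℕ) (e f : NExpr)
  | add (u v : RExpr)
  | sub (u v : RExpr)

inductive BExpr
  | natLt (e f : NExpr)
  | natEq (e f : NExpr)
  | realLe (u v : RExpr)
  | not (b : BExpr)
  | and (b d : BExpr)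

def NExpr.eval (σ : Store) : NExpr → ℕ
  | lit k => k
  | var x => σ.natVar x
  | arr x e => σ.natArr x (e.eval σ)
  | add e f => e.eval σ + f.eval σ
  | sub e f => e.eval σ - f.eval σ

def RExpr.eval (σ : Store) : RExpr → ℝ
  | zero => 0
  | var x => σ.realVar x
  | arr x e f => σ.realArr x (e.eval σ) (f.eval σ)
  | add u v => u.eval σ + v.eval σ
  | sub u v => u.eval σ - v.eval σ

def BExpr.Holds (σ : Store) : BExpr → Prop
  | natLt e f => e.eval σ < f.eval σ
  | natEq e f => e.eval σ = f.eval σ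
  | realLe u v => u.eval σ ≤ v.eval σ
  | not b => ¬ b.Holds σ
  | and b d => b.Holds σ ∧ d.Holds σ

/-- The cost of an evaluation: the number of operations in the expression. -/
def NExpr.cost : NExpr → ℕ
  | lit _ => 1
  | var _ => 1
  | arr _ e => e.cost + 1
  | add e f => e.cost + f.cost + 1
  | sub e f => e.cost + f.cost + 1

def RExpr.cost : RExpr → ℕ
  | zero => 1
  | var _ => 1
  | arr _ e f => e.cost + f.cost + 1
  | add u v => u.cost + v.cost + 1
  | sub u v => u.cost + v.cost + 1

def BExpr.cost : BExpr → ℕ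
  | natLt e f => e.cost + f.cost + 1
  | natEq e f => e.cost + f.cost + 1
  | realLe u v => u.cost + v.cost + 1
  | not b => b.cost + 1
  | and b d => b.cost + d.cost + 1

/-- Programs. `callAlg x e f y` calls ALG on the `m × m` matrix in the upper left corner of the real
array `x`, where `m` is the value of `e`; the logical output goes to the integer variable `f` and
the permutation to the integer array `y`. -/
inductive Program
  | skip
  | setNat (x : ℕ) (e : NExpr)
  | setNatArr (x : ℕ) (e f : NExpr)
  | setReal (x : ℕ) (u : RExpr)
  | setRealArr (x : ℕ) (e f : NExpr) (u : RExpr)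
  | seq (s t : Program)
  | ite (b : BExpr) (s t : Program)
  | loop (b : BExpr) (s : Program)
  | callAlg (x : ℕ) (e : NExpr) (f : ℕ) (y : ℕ)

def Store.writeNat (σ : Store) (x v : ℕ) : Store :=
  { σ with natVar := Function.update σ.natVar x v }

def Store.writeNatArr (σ : Store) (x i v : ℕ) : Store :=
  { σ with natArr := Function.update σ.natArr x (Function.update (σ.natArr x) i v) }

def Store.writeReal (σ : Store) (x : ℕ) (v : ℝ) : Store :=
  { σ with realVar := Function.update σ.realVar x v }

def Store.writeRealArr (σ : Store) (x i j : ℕ) (v : ℝ) : Store :=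
  { σ with
    realArr := Function.update σ.realArr x
      (Function.update (σ.realArr x) i (Function.update (σ.realArr x i) j v)) }

/-- The `m × m` matrix in the upper left corner of the real array `x`. -/
def Store.corner (σ : Store) (x m : ℕ) : Matrix (Fin m) (Fin m) ℝ :=
  fun i j => σ.realArr x i j

/-- Store the output of a call of ALG: the flag `0` for FALSE; the flag `1` for TRUE, in which case
the entries `0, …, m - 1` of the integer array `y` receive the values of the permutation. -/
def Store.writeAnswer (σ : Store) {m : ℕ} (f y : ℕ) : Option (Equiv.Perm (Fin m)) → Store
  | none => σ.writeNat f 0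
  | some ψ =>
    { (σ.writeNat f 1) with
      natArr := Function.update σ.natArr y
        fun i => if h : i < m then (ψ ⟨i, h⟩ : ℕ) else σ.natArr y i }

/-- `Exec O s σ t τ`: started in the store `σ`, the program `s` with the subroutine `O` halts after
exactly `t` steps in the store `τ`. -/
inductive Exec (O : Oracle) : Program → Store → ℕ → Store → Prop
  | skip (σ : Store) : Exec O .skip σ 1 σ
  | setNat (x : ℕ) (e : NExpr) (σ : Store) :
      Exec O (.setNat x e) σ (e.cost + 1) (σ.writeNat x (e.eval σ))
  | setNatArr (x : ℕ) (e f : NExpr) (σ : Store) :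
      Exec O (.setNatArr x e f) σ (e.cost + f.cost + 1)
        (σ.writeNatArr x (e.eval σ) (f.eval σ))
  | setReal (x : ℕ) (u : RExpr) (σ : Store) :
      Exec O (.setReal x u) σ (u.cost + 1) (σ.writeReal x (u.eval σ))
  | setRealArr (x : ℕ) (e f : NExpr) (u : RExpr) (σ : Store) :
      Exec O (.setRealArr x e f u) σ (e.cost + f.cost + u.cost + 1)
        (σ.writeRealArr x (e.eval σ) (f.eval σ) (u.eval σ))
  | seq {s s' : Program} {σ τ υ : Store} {t t' : ℕ} :
      Exec O s σ t τ → Exec O s' τ t' υ → Exec O (.seq s s') σ (t + t') υ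
  | iteTrue {b : BExpr} {s s' : Program} {σ τ : Store} {t : ℕ} :
      b.Holds σ → Exec O s σ t τ → Exec O (.ite b s s') σ (b.cost + t + 1) τ
  | iteFalse {b : BExpr} {s s' : Program} {σ τ : Store} {t : ℕ} :
      ¬ b.Holds σ → Exec O s' σ t τ → Exec O (.ite b s s') σ (b.cost + t + 1) τ
  | loopDone {b : BExpr} {s : Program} {σ : Store} :
      ¬ b.Holds σ → Exec O (.loop b s) σ (b.cost + 1) σ
  | loopStep {b : BExpr} {s : Program} {σ τ υ : Store} {t t' : ℕ} :
      b.Holds σ → Exec O s σ t τ → Exec O (.loop b s) τ t' υ →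
      Exec O (.loop b s) σ (b.cost + t + t' + 1) υ
  | callAlg (x : ℕ) (e : NExpr) (f y : ℕ) (σ : Store) :
      Exec O (.callAlg x e f y) σ
        (e.cost + O.time (e.eval σ) (σ.corner x (e.eval σ)) + 1)
        (σ.writeAnswer f y (O.answer (e.eval σ) (σ.corner x (e.eval σ))))

/-- The input: `n` in the integer variable `0`, the matrix in the real array `0`, and `0`
everywhere else. -/
def inputStore {n : ℕ} (C : Matrix (Fin n) (Fin n) ℝ) : Store where
  natVar x := if x = 0 then n else 0
  natArr _ _ := 0
  realVar _ := 0
  realArr x i j := if h : x = 0 ∧ i < n ∧ j < n then C ⟨i, h.2.1⟩ ⟨j, h.2.2⟩ else 0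

/-- The store shows the output: the integer variable `1` holds the logical value and, in the
positive case, the integer array `0` holds the permutation. -/
def ShowsOutput {n : ℕ} (τ : Store) : Option (List (Fin n)) → Prop
  | none => τ.natVar 1 = 0
  | some L => τ.natVar 1 = 1 ∧ ∀ (i : ℕ) (h : i < L.length), τ.natArr 0 i = (L[i] : ℕ)

end

end Demidenko

namespace Demidenko

noncomputable section

/-! ### Rounds of the procedure, and rearranging an interval of a Demidenko order. -/

section Combinatorics

variable {n : ℕ}

/-! Soundness owes nothing to ALG. Whatever list `checkCandidateDP` returns is a permutation, and
the final test decides the Demidenko property of that permutation, because the inequalities for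
consecutive rows telescope to those for arbitrary rows (`adjacentCondition_iff`). What has to be
shown is that the procedure succeeds when `p` and `q` are the ends of some Demidenko permutation.

Passing to `shifted C p` changes both sides of every Demidenko inequality by the same amount and
makes column `p` constant. Consider an order that completes the current partial permutation. The
inequality with `p` in first place says that columns descend: `C k l ≤ C j l` for unplaced `j`
before `k` before `l` (`Completes.descend`). The inequality with a placed `x` first and `q` last
says that `C j x - C j q` is weakly increasing in `j`. The score is the sum of these differences, so
it increases weakly along the completion. Its minimizers `K` therefore come next, and their rows
agree in every placed column and in column `q` (`Completes.row_eq`). It follows that the completion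
orders `K` in the Anti-Robinson way and that the row sums over `I' \ K` descend. In other words, the
appended index can stand last in an Anti-Robinson order of `D`, and ALG cannot answer FALSE.

ALG may return a different order of `K`; `Completes.append` shows that it does no harm. If two
elements of `K` are swapped relative to the known completion, that completion compares their rows
outside `K` termwise in one direction, while the new order compares the row sums in the other, so
the rows agree there. With this, `demidenko_rearrange` shows that the rearranged order is again
Demidenko. Thus the existence of a completion is invariant, although the completion itself changes
from round to round. The size of `M` forces the appended index to an end of the order, unless the
matrix is zero, and then the border condition is void.

For the running time, scores are maintained incrementally at cost O(n) per placed index. A round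
costs O(n |K|), including the call of ALG. The sets `K` of the successive rounds are disjoint, so
one pair `(p, q)` costs O(n²) (`roundsProg_spec`), as does the test, and there are at most n² pairs.
The bounds are derived in a logic of total correctness with time (`Spec`), whose frame rule is
`Exec.agree`. -/

theorem mem_remaining {P : List (Fin n)} {q i : Fin n} : i ∈ remaining P q ↔ i ∉ P ∧ i ≠ q := by
  simp [remaining]

theorem minSet_subset (C : Matrix (Fin n) (Fin n) ℝ) (P : List (Fin n)) (q : Fin n) :
    minSet C P q ⊆ remaining P q := Finset.filter_subset _ _

theorem mem_minSet {C : Matrix (Fin n) (Fin n) ℝ} {P : List (Fin n)} {q i : Fin n} :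
    i ∈ minSet C P q ↔ i ∈ remaining P q ∧ ∀ j ∈ remaining P q, score C P q i ≤ score C P q j := by
  simp [minSet]

theorem enum_mem (K : Finset (Fin n)) (i : Fin K.card) : enum K i ∈ K :=
  K.orderEmbOfFin_mem rfl i

theorem exists_enum {K : Finset (Fin n)} {x : Fin n} (hx : x ∈ K) : ∃ i, enum K i = x := by
  have : x ∈ Set.range (enum K) := by simpa [enum] using hx
  exact this

theorem length_append_remaining {P : List (Fin n)} {q : Fin n} (hP : P.Nodup) (hq : q ∉ P) :
    (remaining P q).card + P.length + 1 = n := by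
  have h1 : remaining P q = (insert q P.toFinset)ᶜ := by
    ext x; simp [mem_remaining]; tauto
  have h2 : (insert q P.toFinset).card = P.length + 1 := by
    rw [Finset.card_insert_of_notMem (by simpa using hq), List.toFinset_card_of_nodup hP]
  have h3 := Finset.card_add_card_compl (insert q P.toFinset)
  rw [h2, ← h1, Fintype.card_fin] at h3
  omega

theorem mem_blockOf_iff {K : Finset (Fin n)} {ψ : Equiv.Perm (Fin (K.card + 1))} {x : Fin n} :
    x ∈ blockOf K ψ ↔ x ∈ K := by
  refine ⟨fun h => ?_, mem_blockOf K ψ⟩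
  simp only [blockOf, List.mem_filterMap] at h
  obtain ⟨i, -, hi⟩ := h
  induction h : orient ψ i using Fin.lastCases with
  | last => simp [h] at hi
  | cast j =>
    simp [h] at hi
    exact hi ▸ enum_mem K j

/-- Filtering preserves order, so an index comparison inside the block can be turned into a
comparison of positions under the oriented permutation, where the Anti-Robinson property of `D`
applies. -/
theorem pairwise_blockOf {K : Finset (Fin n)} {ψ : Equiv.Perm (Fin (K.card + 1))} :
    (blockOf K ψ).Pairwise fun x y => ∃ i j : Fin K.card, x = enum K i ∧ y = enum K j ∧
      (orient ψ).symm i.castSucc < (orient ψ).symm j.castSucc := by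
  rw [blockOf, List.pairwise_filterMap]
  refine (List.pairwise_lt_finRange _).imp ?_
  intro a b hab x hx y hy
  induction ha : orient ψ a using Fin.lastCases with
  | last => simp [ha] at hx
  | cast i =>
    induction hb : orient ψ b using Fin.lastCases with
    | last => simp [hb] at hy
    | cast j =>
      simp [ha] at hx
      simp [hb] at hy
      refine ⟨i, j, hx.symm, hy.symm, ?_⟩
      rwa [← ha, ← hb, Equiv.symm_apply_apply, Equiv.symm_apply_apply]

theorem nodup_blockOf {K : Finset (Fin n)} {ψ : Equiv.Perm (Fin (K.card + 1))} :
    (blockOf K ψ).Nodup := by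
  refine pairwise_blockOf.imp ?_
  rintro x y ⟨i, j, rfl, rfl, h⟩ he
  rw [(enum K).injective he] at h
  exact lt_irrefl _ h

/-- The list that one round of the procedure appends to `P`, or `none` if the procedure fails. -/
def nextBlock (O : Oracle) (C : Matrix (Fin n) (Fin n) ℝ) (q : Fin n) (P : List (Fin n)) :
    Option (List (Fin n)) :=
  let K := minSet C P q
  if K.card = 1 then some (K.sort (· ≤ ·))
  else if K.card + P.length + 1 = n then
    (O.answer K.card (C.submatrix (enum K) (enum K))).map
      fun ψ => List.ofFn fun i => enum K (ψ i)
  else (O.answer (K.card + 1) (matrixD C (remaining P q) K)).map (blockOf K)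

theorem nextBlock_spec {O : Oracle} {C : Matrix (Fin n) (Fin n) ℝ} {q : Fin n}
    {P B : List (Fin n)} (h : nextBlock O C q P = some B) :
    B.Nodup ∧ ∀ x, x ∈ B ↔ x ∈ minSet C P q := by
  unfold nextBlock at h
  dsimp only at h
  split_ifs at h with h1 h2
  · obtain rfl := Option.some.inj h
    exact ⟨Finset.sort_nodup _ _, fun x => by simp⟩
  · obtain ⟨ψ, -, rfl⟩ := Option.map_eq_some_iff.mp h
    refine ⟨List.nodup_ofFn.mpr ((enum _).injective.comp ψ.injective), fun x => ?_⟩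
    rw [List.mem_ofFn]
    constructor
    · rintro ⟨i, rfl⟩; exact enum_mem _ _
    · intro hx
      obtain ⟨i, rfl⟩ := exists_enum hx
      exact ⟨ψ.symm i, by simp⟩
  · obtain ⟨ψ, -, rfl⟩ := Option.map_eq_some_iff.mp h
    exact ⟨nodup_blockOf, fun x => mem_blockOf_iff⟩

theorem nodup_append_nextBlock {O : Oracle} {C : Matrix (Fin n) (Fin n) ℝ} {q : Fin n}
    {P B : List (Fin n)} (hP : P.Nodup) (hq : q ∉ P) (h : nextBlock O C q P = some B) :
    (P ++ B).Nodup ∧ q ∉ P ++ B := by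
  obtain ⟨h1, h2⟩ := nextBlock_spec h
  have h3 : ∀ x ∈ B, x ∉ P ∧ x ≠ q := fun x hx =>
    mem_remaining.mp (minSet_subset _ _ _ ((h2 x).mp hx))
  refine ⟨List.nodup_append.mpr ⟨hP, h1, ?_⟩, ?_⟩
  · rintro a ha b hb rfl
    exact (h3 a hb).1 ha
  · rw [List.mem_append, not_or]
    exact ⟨hq, fun hb => (h3 q hb).2 rfl⟩

theorem length_nextBlock {O : Oracle} {C : Matrix (Fin n) (Fin n) ℝ} {q : Fin n}
    {P B : List (Fin n)} (h : nextBlock O C q P = some B) :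
    B.length = (minSet C P q).card := by
  obtain ⟨h1, h2⟩ := nextBlock_spec h
  rw [← List.toFinset_card_of_nodup h1]
  congr 1
  ext x
  simp [h2]

theorem minSet_eq_remaining {C : Matrix (Fin n) (Fin n) ℝ} {q : Fin n} {P : List (Fin n)}
    (hP : P.Nodup) (hq : q ∉ P) (h : (minSet C P q).card + P.length + 1 = n) :
    minSet C P q = remaining P q := by
  have h1 := length_append_remaining hP hq
  exact Finset.eq_of_subset_of_card_le (minSet_subset _ _ _) (by omega)

theorem checkCandidateDP_of_empty {O : Oracle} {C : Matrix (Fin n) (Fin n) ℝ} {q : Fin n}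
    {P : List (Fin n)} (h : remaining P q = ∅) : checkCandidateDP O C q P = some (P ++ [q]) := by
  rw [checkCandidateDP]
  simp [h]

/-- Gives the three branches one recursion. The branch that returns at once fits as well: its block
exhausts the remaining indices, so a further call would only append `q`. -/
theorem checkCandidateDP_step {O : Oracle} {C : Matrix (Fin n) (Fin n) ℝ} {q : Fin n}
    {P : List (Fin n)} (hP : P.Nodup) (hq : q ∉ P) (h : remaining P q ≠ ∅) :
    checkCandidateDP O C q P =
      (nextBlock O C q P).bind fun B => checkCandidateDP O C q (P ++ B) := by
  have key : (minSet C P q).card + P.length + 1 = n → ∀ B, nextBlock O C q P = some B →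
      checkCandidateDP O C q (P ++ B) = some (P ++ B ++ [q]) := by
    intro h2 B hB
    apply checkCandidateDP_of_empty
    have := (nextBlock_spec hB).2
    ext x
    have h4 := this x
    rw [minSet_eq_remaining hP hq h2, mem_remaining] at h4
    simp [mem_remaining, h4]
    tauto
  rw [checkCandidateDP, dif_neg h]
  unfold nextBlock at key ⊢
  dsimp only at key ⊢
  by_cases h1 : (minSet C P q).card = 1
  · simp [h1]
  by_cases h2 : (minSet C P q).card + P.length + 1 = n
  · simp only [h1, h2, if_false, if_true] at key ⊢
    cases hO : O.answer _ (C.submatrix (enum (minSet C P q)) (enum (minSet C P q))) with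
    | none => simp
    | some ψ => simpa using (key trivial _ (by rw [hO]; rfl)).symm
  · simp only [h1, h2, if_false]
    cases hO : O.answer _ (matrixD C (remaining P q) (minSet C P q)) with
    | none => simp
    | some ψ => simp

theorem length_append_nextBlock_lt {O : Oracle} {C : Matrix (Fin n) (Fin n) ℝ} {q : Fin n}
    {P B : List (Fin n)} (h : remaining P q ≠ ∅) (hB : nextBlock O C q P = some B) :
    (remaining (P ++ B) q).card < (remaining P q).card :=
  remaining_append_lt C P B q h fun x hx => ((nextBlock_spec hB).2 x).mpr hx

/-- Each block enumerates `minSet` without repetition whatever ALG answers, so correctness of ALG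
plays no role here. -/
theorem checkCandidateDP_sound {O : Oracle} {C : Matrix (Fin n) (Fin n) ℝ} {q : Fin n} :
    ∀ (m : ℕ) (P : List (Fin n)), (remaining P q).card = m → P.Nodup → q ∉ P →
    ∀ L, checkCandidateDP O C q P = some L → L.Nodup ∧ L.length = n := by
  intro m
  induction m using Nat.strong_induction_on with
  | _ m ih =>
    intro P hm hP hq L hL
    by_cases h : remaining P q = ∅
    · rw [checkCandidateDP_of_empty h] at hL
      obtain rfl := Option.some.inj hL
      have h1 := length_append_remaining hP hq
      rw [h] at h1
      refine ⟨List.nodup_append.mpr ⟨hP, by simp, ?_⟩, by simpa using h1⟩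
      rintro a ha b hb rfl
      exact hq (by simpa using (List.mem_singleton.mp hb) ▸ ha)
    · rw [checkCandidateDP_step hP hq h, Option.bind_eq_some_iff] at hL
      obtain ⟨B, hB, hL⟩ := hL
      obtain ⟨h1, h2⟩ := nodup_append_nextBlock hP hq hB
      exact ih _ (hm ▸ length_append_nextBlock_lt h hB) (P ++ B) rfl h1 h2 L hL

/-! Demidenko orders as lists. -/

def IsDemidenkoList (C : Matrix (Fin n) (Fin n) ℝ) (L : List (Fin n)) : Prop :=
  ∀ i j k l, L.idxOf i < L.idxOf j → L.idxOf j < L.idxOf k → L.idxOf k < L.idxOf l →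
    C j i + C k l ≤ C j l + C k i

/-- Rearranging an interval `K` of a Demidenko order, given by the positions `pos`, yields another
Demidenko order if rows in `K` agree before `K`, descend after `K`, and `K` is Anti-Robinson. -/
theorem demidenko_rearrange {C : Matrix (Fin n) (Fin n) ℝ} (hC : C.IsSymm) (K : Finset (Fin n))
    (pos pos' : Fin n → ℕ)
    (hinj : Function.Injective pos)
    (hout : ∀ x y, ¬ (x ∈ K ∧ y ∈ K) → (pos x < pos y ↔ pos' x < pos' y))
    (hconv : ∀ x ∈ K, ∀ z ∈ K, ∀ y, pos' x < pos' y → pos' y < pos' z → y ∈ K)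
    (hbefore : ∀ j ∈ K, ∀ k ∈ K, ∀ x ∉ K, pos' x < pos' j → C j x = C k x)
    (hafter : ∀ j ∈ K, ∀ k ∈ K, ∀ l ∉ K, pos' j < pos' k → pos' k < pos' l → C k l ≤ C j l)
    (hafter' : ∀ j ∈ K, ∀ k ∈ K, ∀ l ∉ K, pos j < pos k → pos k < pos l → C k l ≤ C j l)
    (hAR : ∀ i ∈ K, ∀ j ∈ K, ∀ k ∈ K, pos' i < pos' j → pos' j < pos' k →
      C i j ≤ C i k ∧ C j k ≤ C i k)
    (hD : ∀ i j k l, pos i < pos j → pos j < pos k → pos k < pos l →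
      C j i + C k l ≤ C j l + C k i)
    (i j k l : Fin n) (hij : pos' i < pos' j) (hjk : pos' j < pos' k) (hkl : pos' k < pos' l) :
    C j i + C k l ≤ C j l + C k i := by
  have hs : ∀ x y, C x y = C y x := fun x y => hC.apply y x
  -- By `hout`, neighbours in the new order can be inverted in the old one only if both lie in `K`.
  -- When the middle indices `j`, `k` both lie in `K`, or are not inverted together with an outer
  -- one, either the old inequality applies or the claim splits into `C j i ≤ C k i` and `C k l ≤ C
  -- j l`.
  by_cases hij' : pos i < pos j
  · by_cases hjk' : pos j < pos k
    · by_cases hkl' : pos k < pos l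
      · exact hD i j k l hij' hjk' hkl'
      · have hkK : k ∈ K ∧ l ∈ K := by
          by_contra h; exact hkl' ((hout k l h).mpr hkl)
        obtain ⟨hk, hl⟩ := hkK
        by_cases hj : j ∈ K
        · have h2 := hAR j hj k hk l hl hjk hkl
          have h1 : C j i ≤ C k i := by
            by_cases hi : i ∈ K
            · have := (hAR i hi j hj k hk hij hjk).1
              rwa [hs i j, hs i k] at this
            · exact (hbefore j hj k hk i hi hij).le
          linarith [h2.2]
        -- Only `k` and `l` lie in `K`: use the old inequality with the two exchanged. Their rows
        -- agree in the earlier columns `i` and `j`, which undoes the exchange.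
        · have hi : i ∉ K := fun hi => hj (hconv i hi k hk j hij hjk)
          have hlk : pos l < pos k := by
            rcases lt_trichotomy (pos l) (pos k) with h | h | h
            · exact h
            · rw [hinj h] at hkl; exact absurd hkl (lt_irrefl _)
            · exact absurd h hkl'
          have h1 := hD i j l k hij' ((hout j l (by tauto)).mpr (hjk.trans hkl)) hlk
          have h2 := hbefore k hk l hl i hi (hij.trans hjk)
          have h3 := hbefore k hk l hl j hj hjk
          rw [hs l k] at h1
          rw [hs l j, hs k j] at h3
          linarith
    · obtain ⟨hj, hk⟩ : j ∈ K ∧ k ∈ K := by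
        by_contra h; exact hjk' ((hout j k h).mpr hjk)
      have h1 : C j i ≤ C k i := by
        by_cases hi : i ∈ K
        · have := (hAR i hi j hj k hk hij hjk).1
          rwa [hs i j, hs i k] at this
        · exact (hbefore j hj k hk i hi hij).le
      have h2 : C k l ≤ C j l := by
        by_cases hl : l ∈ K
        · exact (hAR j hj k hk l hl hjk hkl).2
        · exact hafter j hj k hk l hl hjk hkl
      linarith
  · obtain ⟨hi, hj⟩ : i ∈ K ∧ j ∈ K := by
      by_contra h; exact hij' ((hout i j h).mpr hij)
    by_cases hk : k ∈ K
    · have h1 := (hAR i hi j hj k hk hij hjk).1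
      rw [hs i j, hs i k] at h1
      have h2 : C k l ≤ C j l := by
        by_cases hl : l ∈ K
        · exact (hAR j hj k hk l hl hjk hkl).2
        · exact hafter j hj k hk l hl hjk hkl
      linarith
    -- Only `i` and `j` lie in `K`, and they are inverted. The old and the new order bound their
    -- rows in columns `k` and `l` from both sides, so these entries agree and the old inequality
    -- for `j, i, k, l` is the one wanted.
    · have hl : l ∉ K := fun hl => hk (hconv j hj l hl k hjk hkl)
      have hji : pos j < pos i := by
        rcases lt_trichotomy (pos j) (pos i) with h | h | h
        · exact h
        · rw [hinj h] at hij; exact absurd hij (lt_irrefl _)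
        · exact absurd h hij'
      have hik := (hout i k (by tauto)).mpr (hij.trans hjk)
      have hkl' := (hout k l (by tauto)).mpr hkl
      have h1 := hD j i k l hji hik hkl'
      have h2 := hafter i hi j hj k hk hij hjk
      have h3 := hafter' j hj i hi k hk hji hik
      have h4 := hafter i hi j hj l hl hij (hjk.trans hkl)
      have h5 := hafter' j hj i hi l hl hji (hik.trans hkl')
      rw [hs i j, hs k j] at h1
      rw [hs k i]
      linarith

/-- `R` completes the partial permutation `(P, q)` to a Demidenko permutation. -/
structure Completes (C : Matrix (Fin n) (Fin n) ℝ) (P : List (Fin n)) (q : Fin n)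
    (R : List (Fin n)) : Prop where
  nodup : (P ++ (R ++ [q])).Nodup
  mem : ∀ x, x ∈ P ++ (R ++ [q])
  dem : IsDemidenkoList C (P ++ (R ++ [q]))

theorem idxOf_lt_of_append {A B : List (Fin n)} {x y : Fin n} (hx : x ∈ A) (hy : y ∉ A) :
    (A ++ B).idxOf x < (A ++ B).idxOf y := by
  rw [List.idxOf_append, List.idxOf_append, if_pos hx, if_neg hy]
  have := List.idxOf_lt_length_iff.mpr hx
  omega

theorem pairwise_of_idxOf_lt {L : List (Fin n)} {r : Fin n → Fin n → Prop} (h : L.Pairwise r)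
    {x y : Fin n} (hy : y ∈ L) (hxy : L.idxOf x < L.idxOf y) : r x y := by
  have hy' := List.idxOf_lt_length_iff.mpr hy
  have := List.pairwise_iff_getElem.mp h _ _ (hxy.trans hy') hy' hxy
  simpa using this

theorem pairwise_of_forall_idxOf {L : List (Fin n)} (hL : L.Nodup) {r : Fin n → Fin n → Prop}
    (h : ∀ x y, x ∈ L → y ∈ L → L.idxOf x < L.idxOf y → r x y) : L.Pairwise r := by
  rw [List.pairwise_iff_getElem]
  intro i j hi hj hij
  apply h _ _ (List.getElem_mem _) (List.getElem_mem _)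
  rwa [hL.idxOf_getElem, hL.idxOf_getElem]

/-- Splits the score into differences that are monotone one by one along a completion. -/
theorem score_eq_sum (C : Matrix (Fin n) (Fin n) ℝ) (P : List (Fin n)) (q i : Fin n) :
    score C P q i = (P.map fun x => C i x - C i q).sum := by
  unfold score
  induction P with
  | nil => simp
  | cons a P ih =>
    simp only [List.map_cons, List.sum_cons, List.length_cons, ← ih]
    push_cast
    ring

theorem notMem_dropWhile {p : Fin n → Bool} {R : List (Fin n)}
    (h : R.Pairwise fun x y => p y = true → p x = true) {x : Fin n} (hx : x ∈ R.dropWhile p) :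
    p x = false := by
  induction R with
  | nil => simp at hx
  | cons a R ih =>
    rw [List.pairwise_cons] at h
    rw [List.dropWhile_cons] at hx
    split_ifs at hx with ha
    · exact ih h.2 hx
    · rcases List.mem_cons.mp hx with rfl | hx
      · simpa using ha
      · by_contra hc
        exact ha (h.1 x hx (by simpa using hc))

theorem Completes.mem_iff {C : Matrix (Fin n) (Fin n) ℝ} {P R : List (Fin n)} {q : Fin n}
    (h : Completes C P q R) (x : Fin n) : x ∈ remaining P q ↔ x ∈ R := by
  have h1 := h.mem x
  have h2 := h.nodup
  rw [List.nodup_append, List.nodup_append] at h2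
  obtain ⟨-, ⟨-, -, h4⟩, h5⟩ := h2
  simp only [List.mem_append, List.mem_singleton] at h1 h4 h5
  rw [mem_remaining]
  constructor
  · tauto
  · intro hx
    exact ⟨fun hp => h5 x hp x (Or.inl hx) rfl, h4 x hx q rfl⟩

theorem Completes.notMem {C : Matrix (Fin n) (Fin n) ℝ} {P R : List (Fin n)} {q : Fin n}
    (h : Completes C P q R) : q ∉ P ∧ q ∉ R := by
  have h2 := h.nodup
  rw [List.nodup_append, List.nodup_append] at h2
  obtain ⟨-, ⟨-, -, h4⟩, h5⟩ := h2
  simp only [List.mem_append, List.mem_singleton] at h4 h5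
  exact ⟨fun hp => h5 q hp q (Or.inr rfl) rfl, fun hr => h4 q hr q rfl rfl⟩

end Combinatorics

/-! ### A round never loses the existence of a completion. -/

section Completeness

variable {n : ℕ} {C : Matrix (Fin n) (Fin n) ℝ} {P R : List (Fin n)} {p q : Fin n}

theorem Completes.idxOf_inj (h : Completes C P q R) :
    Function.Injective fun x => (P ++ (R ++ [q])).idxOf x :=
  fun x _ hxy => (List.idxOf_inj (h.mem x)).mp hxy

theorem Completes.notMem_of_mem (h : Completes C P q R) {x : Fin n} (hx : x ∈ R) :
    x ∉ P ∧ x ≠ q := mem_remaining.mp ((h.mem_iff x).mpr hx)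

theorem Completes.idxOf_lt_last (h : Completes C P q R) {x : Fin n} (hx : x ≠ q) :
    (P ++ (R ++ [q])).idxOf x < (P ++ (R ++ [q])).idxOf q := by
  rw [← List.append_assoc]
  have := h.mem x
  apply idxOf_lt_of_append
  · simp only [List.mem_append, List.mem_singleton] at this ⊢; tauto
  · simp [h.notMem.1, h.notMem.2]

/-- The Demidenko inequality for `p, j, k, l`, in which the two entries of the constant column `p`
cancel. -/
theorem Completes.descend (h : Completes C P q R) (hp : p ∈ P) (hc : ∀ i j, C i p = C j p)
    {j k l : Fin n} (hj : j ∉ P) (hjk : (P ++ (R ++ [q])).idxOf j < (P ++ (R ++ [q])).idxOf k)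
    (hkl : (P ++ (R ++ [q])).idxOf k < (P ++ (R ++ [q])).idxOf l) : C k l ≤ C j l := by
  have := h.dem p j k l (idxOf_lt_of_append hp hj) hjk hkl
  linarith [hc j k]

/-- The Demidenko inequality for `x, j, k, q`. -/
theorem Completes.score_term_le (h : Completes C P q R) {j k x : Fin n}
    (hj : j ∈ R) (hk : k ∈ R) (hx : x ∈ P)
    (hjk : (P ++ (R ++ [q])).idxOf j < (P ++ (R ++ [q])).idxOf k) :
    C j x - C j q ≤ C k x - C k q := by
  have := h.dem x j k q (idxOf_lt_of_append hx (h.notMem_of_mem hj).1) hjk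
    (h.idxOf_lt_last (h.notMem_of_mem hk).2)
  linarith

theorem Completes.score_le (h : Completes C P q R) {j k : Fin n} (hj : j ∈ R) (hk : k ∈ R)
    (hjk : (P ++ (R ++ [q])).idxOf j < (P ++ (R ++ [q])).idxOf k) :
    score C P q j ≤ score C P q k := by
  rw [score_eq_sum, score_eq_sum]
  exact List.sum_le_sum fun x hx => h.score_term_le hj hk hx hjk

theorem mem_minSet_of_score_le {j k : Fin n} (hj : j ∈ remaining P q) (hk : k ∈ minSet C P q)
    (h : score C P q j ≤ score C P q k) : j ∈ minSet C P q :=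
  mem_minSet.mpr ⟨hj, fun l hl => h.trans ((mem_minSet.mp hk).2 l hl)⟩

theorem score_eq_of_mem_minSet {j k : Fin n} (hj : j ∈ minSet C P q) (hk : k ∈ minSet C P q) :
    score C P q j = score C P q k :=
  le_antisymm ((mem_minSet.mp hj).2 k (mem_minSet.mp hk).1)
    ((mem_minSet.mp hk).2 j (mem_minSet.mp hj).1)

theorem Completes.mem_of_mem_minSet (h : Completes C P q R) {j : Fin n}
    (hj : j ∈ minSet C P q) : j ∈ R := (h.mem_iff j).mp (minSet_subset _ _ _ hj)

/-- The rows in `minSet` agree in the columns that are already placed. -/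
theorem Completes.row_eq (h : Completes C P q R) (hp : p ∈ P) (hc : ∀ i j, C i p = C j p)
    {j k : Fin n} (hj : j ∈ minSet C P q) (hk : k ∈ minSet C P q) :
    (∀ x ∈ P, C j x = C k x) ∧ C j q = C k q := by
  wlog hjk : (P ++ (R ++ [q])).idxOf j < (P ++ (R ++ [q])).idxOf k generalizing j k
  · rcases lt_trichotomy ((P ++ (R ++ [q])).idxOf j) ((P ++ (R ++ [q])).idxOf k) with h1 | h1 | h1
    · exact absurd h1 hjk
    · rw [h.idxOf_inj h1]; simp
    · obtain ⟨h2, h3⟩ := this hk hj h1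
      exact ⟨fun x hx => (h2 x hx).symm, h3.symm⟩
  have hjR := h.mem_of_mem_minSet hj
  have hkR := h.mem_of_mem_minSet hk
  have hs := score_eq_of_mem_minSet hj hk
  -- Equal sums of termwise ordered summands have equal summands. The summand at `p` then yields
  -- agreement in column `q`, because column `p` is constant.
  have key : ∀ x ∈ P, C j x - C j q = C k x - C k q := by
    intro x hx
    by_contra hne
    rw [score_eq_sum, score_eq_sum] at hs
    exact hs.not_lt (List.sum_lt_sum _ _ (fun y hy => h.score_term_le hjR hkR hy hjk)
      ⟨x, hx, lt_of_le_of_ne (h.score_term_le hjR hkR hx hjk) hne⟩)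
  have hq : C j q = C k q := by
    have := key p hp
    linarith [hc j k]
  exact ⟨fun x hx => by linarith [key x hx], hq⟩

/-- A completion lists the elements of `minSet` before the other remaining ones. -/
theorem Completes.lt_of_mem_minSet (h : Completes C P q R) {x y : Fin n}
    (hx : x ∈ minSet C P q) (hyP : y ∉ P) (hy : y ∉ minSet C P q) :
    (P ++ (R ++ [q])).idxOf x < (P ++ (R ++ [q])).idxOf y := by
  have hxR := h.mem_of_mem_minSet hx
  by_cases hyq : y = q
  · subst hyq; exact h.idxOf_lt_last (h.notMem_of_mem hxR).2
  have hyR : y ∈ remaining P q := mem_remaining.mpr ⟨hyP, hyq⟩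
  by_contra hle
  have hne : (P ++ (R ++ [q])).idxOf x ≠ (P ++ (R ++ [q])).idxOf y := by
    intro he
    have := h.idxOf_inj he
    subst this
    exact hy hx
  have := h.score_le ((h.mem_iff y).mp hyR) hxR (by omega)
  exact hy (mem_minSet_of_score_le hyR hx this)

/-- What a block `B` of the elements of `minSet` has to fulfil. -/
structure GoodBlock (C : Matrix (Fin n) (Fin n) ℝ) (P : List (Fin n)) (q : Fin n)
    (B : List (Fin n)) : Prop where
  nodup : B.Nodup
  mem : ∀ x, x ∈ B ↔ x ∈ minSet C P q
  ar : ∀ i ∈ B, ∀ j ∈ B, ∀ k ∈ B, B.idxOf i < B.idxOf j → B.idxOf j < B.idxOf k →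
    C i j ≤ C i k ∧ C j k ≤ C i k
  border : ∀ j ∈ B, ∀ k ∈ B, B.idxOf j < B.idxOf k →
    ∑ l ∈ remaining P q \ minSet C P q, C k l ≤ ∑ l ∈ remaining P q \ minSet C P q, C j l

/-- Scores increase weakly along `R`, so membership in `minSet` is inherited by predecessors and the
minimizers form a prefix. -/
theorem Completes.minSet_split (h : Completes C P q R) :
    ∃ B₀ R', R = B₀ ++ R' ∧ ∀ x, x ∈ B₀ ↔ x ∈ minSet C P q := by
  have hR : R.Nodup := (List.nodup_append.mp (List.nodup_append.mp h.nodup).2.1).1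
  have hpw : R.Pairwise fun x y =>
      decide (y ∈ minSet C P q) = true → decide (x ∈ minSet C P q) = true := by
    apply pairwise_of_forall_idxOf hR
    intro x y hx hy hxy hyK
    rw [decide_eq_true_iff] at hyK ⊢
    have h1 := h.notMem_of_mem hx
    have h2 := h.notMem_of_mem hy
    refine mem_minSet_of_score_le ((h.mem_iff x).mpr hx) hyK (h.score_le hx hy ?_)
    simp only [List.idxOf_append, if_neg h1.1, if_neg h2.1, if_pos hx, if_pos hy]
    omega
  refine ⟨R.takeWhile fun x => decide (x ∈ minSet C P q),
    R.dropWhile fun x => decide (x ∈ minSet C P q), (List.takeWhile_append_dropWhile).symm, ?_⟩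
  intro x
  constructor
  · intro hx
    simpa using List.mem_takeWhile_imp hx
  · intro hx
    have hxR := h.mem_of_mem_minSet hx
    rw [← List.takeWhile_append_dropWhile (p := fun x => decide (x ∈ minSet C P q)) (l := R),
      List.mem_append] at hxR
    rcases hxR with h1 | h1
    · exact h1
    · have := notMem_dropWhile hpw h1
      simp [hx] at this

/-- The exchange step: the prefix of the completion that consists of the minimizers may be replaced
by any good block, not merely by the order in which the completion happens to list them. -/
theorem Completes.append (hC : C.IsSymm) (h : Completes C P q R) (hp : p ∈ P)
    (hc : ∀ i j, C i p = C j p) {B : List (Fin n)} (hB : GoodBlock C P q B) :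
    ∃ R', Completes C (P ++ B) q R' := by
  obtain ⟨B₀, R', rfl, hB₀⟩ := h.minSet_split
  have hnd := h.nodup
  have hB₀nd : B₀.Nodup := by
    have := (List.nodup_append.mp (List.nodup_append.mp hnd).2.1).1
    exact (List.nodup_append.mp this).1
  have hperm : B₀.Perm B :=
    (List.perm_ext_iff_of_nodup hB₀nd hB.nodup).mpr fun x => (hB₀ x).trans (hB.mem x).symm
  have hperm' : (P ++ ((B₀ ++ R') ++ [q])).Perm ((P ++ B) ++ (R' ++ [q])) := by
    simp only [List.append_assoc]
    exact (hperm.append_right _).append_left _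
  have hlen := hperm.length_eq
  set K := minSet C P q with hK
  set pos : Fin n → ℕ := fun x => (P ++ ((B₀ ++ R') ++ [q])).idxOf x with hpos
  set pos' : Fin n → ℕ := fun x => ((P ++ B) ++ (R' ++ [q])).idxOf x with hpos'
  have hPK : ∀ x ∈ K, x ∉ P := fun x hx => (h.notMem_of_mem (h.mem_of_mem_minSet hx)).1
  -- Both position functions use the length of `B₀`, which equals that of `B`, so they coincide off
  -- `K` and comparisons involving an element outside `K` reduce to arithmetic.
  have hposdef : ∀ x, pos x = if x ∈ P then P.idxOf x else if x ∈ K then B₀.idxOf x + P.length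
      else (R' ++ [q]).idxOf x + B₀.length + P.length := by
    intro x
    simp only [hpos, List.append_assoc]
    rw [List.idxOf_append, List.idxOf_append]
    simp only [hB₀]
    split_ifs <;> omega
  have hposdef' : ∀ x, pos' x = if x ∈ P then P.idxOf x else if x ∈ K then B.idxOf x + P.length
      else (R' ++ [q]).idxOf x + B₀.length + P.length := by
    intro x
    simp only [hpos', List.append_assoc]
    rw [List.idxOf_append, List.idxOf_append]
    simp only [hB.mem]
    split_ifs <;> omega
  have ltP : ∀ x ∈ P, P.idxOf x < P.length := fun x hx => List.idxOf_lt_length_iff.mpr hx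
  have lt0 : ∀ x ∈ K, B₀.idxOf x < B₀.length :=
    fun x hx => List.idxOf_lt_length_iff.mpr ((hB₀ x).mpr hx)
  have lt1 : ∀ x ∈ K, B.idxOf x < B₀.length :=
    fun x hx => hlen ▸ List.idxOf_lt_length_iff.mpr ((hB.mem x).mpr hx)
  have hposK : ∀ x ∈ K, ∀ y ∈ K, pos' x < pos' y ↔ B.idxOf x < B.idxOf y := by
    intro x hx y hy
    rw [hposdef', hposdef', if_neg (hPK x hx), if_neg (hPK y hy), if_pos hx, if_pos hy]
    omega
  have hout : ∀ x y, ¬ (x ∈ K ∧ y ∈ K) → (pos x < pos y ↔ pos' x < pos' y) := by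
    intro x y hxy
    rw [hposdef, hposdef, hposdef', hposdef']
    have h1 := ltP x
    have h2 := ltP y
    have h3 := lt0 x
    have h4 := lt0 y
    have h5 := lt1 x
    have h6 := lt1 y
    by_cases hx : x ∈ K
    · have hy : y ∉ K := fun hy => hxy ⟨hx, hy⟩
      have := hPK x hx
      have := h3 hx
      have := h5 hx
      simp only [hx, hy, hPK x hx, if_true, if_false]
      split_ifs with hyP
      · have := h2 hyP; omega
      · omega
    · by_cases hy : y ∈ K
      · have := h4 hy
        have := h6 hy
        simp only [hx, hy, hPK y hy, if_true, if_false]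
        split_ifs with hxP
        · have := h1 hxP; omega
        · omega
      · simp only [hx, hy, if_false]
  have hconv : ∀ x ∈ K, ∀ z ∈ K, ∀ y, pos' x < pos' y → pos' y < pos' z → y ∈ K := by
    intro x hx z hz y hxy hyz
    rw [hposdef', hposdef'] at hxy hyz
    simp only [hx, hz, hPK x hx, hPK z hz, if_true, if_false] at hxy hyz
    have := lt1 z hz
    have h2 := ltP y
    by_contra hy
    simp only [hy, if_false] at hxy hyz
    split_ifs at hxy hyz with hyP
    · have := h2 hyP; omega
    · omega
  have hdesc : ∀ j ∈ K, ∀ k, ∀ l, pos j < pos k → pos k < pos l → C k l ≤ C j l :=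
    fun j hj k l hjk hkl => h.descend hp hc (hPK j hj) hjk hkl
  have hsumrow : ∀ j ∈ K, ∀ k ∈ K, ∀ l ∉ K, l ∉ P → pos' j < pos' k → C k l ≤ C j l := by
    intro j hj k hk l hl hlP hjk
    rcases lt_trichotomy (pos j) (pos k) with h1 | h1 | h1
    · exact hdesc j hj k l h1 (h.lt_of_mem_minSet hk hlP hl)
    · rw [h.idxOf_inj h1]
    · by_cases hlq : l = q
      · subst hlq; exact ((h.row_eq hp hc hk hj).2).le
      have hlI : l ∈ remaining P q \ K :=
        Finset.mem_sdiff.mpr ⟨mem_remaining.mpr ⟨hlP, hlq⟩, hl⟩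
      -- The old order has `k` before `j`, so row `j` is at most row `k` in every column of `I' \
      -- K`. A strict inequality at `l` would make the row sums contradict the border condition of
      -- the new block.
      by_contra hlt
      have h2 := hB.border j ((hB.mem j).mpr hj) k ((hB.mem k).mpr hk) ((hposK j hj k hk).mp hjk)
      refine absurd h2 (not_le.mpr (Finset.sum_lt_sum (fun m hm => ?_) ⟨l, hlI, not_le.mp hlt⟩))
      obtain ⟨hm1, hm2⟩ := Finset.mem_sdiff.mp hm
      exact hdesc k hk j m h1 (h.lt_of_mem_minSet hj (mem_remaining.mp hm1).1 hm2)
  have hnotP : ∀ k ∈ K, ∀ l, pos' k < pos' l → l ∉ P := by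
    intro k hk l hkl hlP
    rw [hposdef', hposdef', if_neg (hPK k hk), if_pos hk, if_pos hlP] at hkl
    have := ltP l hlP
    omega
  refine ⟨R', ⟨hperm'.nodup_iff.mp hnd, fun x => hperm'.mem_iff.mp (h.mem x), ?_⟩⟩
  refine demidenko_rearrange hC K pos pos' h.idxOf_inj hout hconv ?_ ?_ ?_ ?_ h.dem
  · intro j hj k hk x hx hxj
    have hxP : x ∈ P := by
      by_contra hxP
      have := (hout x j (by tauto)).mpr hxj
      exact absurd (h.lt_of_mem_minSet hj hxP hx) (by simpa [hpos] using this.le)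
    exact (h.row_eq hp hc hj hk).1 x hxP
  · intro j hj k hk l hl hjk hkl
    exact hsumrow j hj k hk l hl (hnotP k hk l hkl) hjk
  · intro j hj k hk l hl hjk hkl
    exact hdesc j hj k l hjk hkl
  · intro i hi j hj k hk hij hjk
    exact hB.ar i ((hB.mem i).mpr hi) j ((hB.mem j).mpr hj) k ((hB.mem k).mpr hk)
      ((hposK i hi j hj).mp hij) ((hposK j hj k hk).mp hjk)

/-- A matrix with an Anti-Robinson order, given by positions, is a permuted Anti-Robinson
matrix. -/
theorem isPermutedAntiRobinson_of_positions {m : ℕ} {A : Matrix (Fin m) (Fin m) ℝ}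
    (hA : A.IsSymm) (pos : Fin m → ℕ) (hinj : Function.Injective pos)
    (h : ∀ i j k, pos i < pos j → pos j < pos k → A i j ≤ A i k ∧ A j k ≤ A i k) :
    IsPermutedAntiRobinson A := by
  have hmono : StrictMono (pos ∘ Tuple.sort pos) :=
    (Tuple.monotone_sort pos).strictMono_of_injective (hinj.comp (Tuple.sort pos).injective)
  refine ⟨Tuple.sort pos, ?_, fun i j k hij hjk => ?_⟩
  · exact hA.submatrix _
  · have := h _ _ _ (hmono hij) (hmono hjk)
    exact max_le this.1 this.2

/-- One inequality is a descending column. The other is the Demidenko inequality for `i, j, k, q`,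
where the entries in column `q` cancel since rows of minimizers agree there. -/
theorem Completes.ar_minSet (hC : C.IsSymm) (h : Completes C P q R) (hp : p ∈ P)
    (hc : ∀ i j, C i p = C j p) {i j k : Fin n} (hi : i ∈ minSet C P q) (hj : j ∈ minSet C P q)
    (hk : k ∈ minSet C P q) (hij : (P ++ (R ++ [q])).idxOf i < (P ++ (R ++ [q])).idxOf j)
    (hjk : (P ++ (R ++ [q])).idxOf j < (P ++ (R ++ [q])).idxOf k) :
    C i j ≤ C i k ∧ C j k ≤ C i k := by
  have h1 := h.notMem_of_mem (h.mem_of_mem_minSet hi)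
  refine ⟨?_, h.descend hp hc h1.1 hij hjk⟩
  have h2 := h.dem i j k q hij hjk
    (h.idxOf_lt_last (h.notMem_of_mem (h.mem_of_mem_minSet hk)).2)
  have h3 := (h.row_eq hp hc hj hk).2
  rw [hC.apply i j, hC.apply i k] at h2
  linarith

theorem matrixD_castSucc (C : Matrix (Fin n) (Fin n) ℝ) (I K : Finset (Fin n))
    (i j : Fin K.card) : matrixD C I K i.castSucc j.castSucc = C (enum K i) (enum K j) := by
  simp [matrixD]

theorem matrixD_last (C : Matrix (Fin n) (Fin n) ℝ) (I K : Finset (Fin n))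
    (i : Fin K.card) : matrixD C I K i.castSucc (Fin.last _) =
      bigM C + ∑ l ∈ I \ K, C (enum K i) l := by
  simp [matrixD]

theorem matrixD_symm (hC : C.IsSymm) (I K : Finset (Fin n)) : (matrixD C I K).IsSymm := by
  ext i j
  rw [Matrix.transpose_apply]
  induction i using Fin.lastCases with
  | last =>
    induction j using Fin.lastCases with
    | last => rfl
    | cast j => simp [matrixD]
  | cast i =>
    induction j using Fin.lastCases with
    | last => simp [matrixD]
    | cast j => simpa [matrixD] using hC.apply _ _

theorem row_abs_sum_le (C : Matrix (Fin n) (Fin n) ℝ) (i : Fin n) :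
    2 * ∑ j, |C i j| ≤ bigM C := by
  unfold bigM
  have := Finset.single_le_sum (f := fun i => ∑ j, |C i j|)
    (fun i _ => Finset.sum_nonneg fun j _ => abs_nonneg _) (Finset.mem_univ i)
  beta_reduce at this
  linarith

theorem abs_add_border_le {K I : Finset (Fin n)} {x y : Fin n} (hy : y ∈ K) :
    |C x y| + |∑ l ∈ I \ K, C x l| ≤ ∑ j, |C x j| := by
  have h1 : |∑ l ∈ I \ K, C x l| ≤ ∑ l ∈ I \ K, |C x l| := Finset.abs_sum_le_sum_abs _ _
  have h2 : ∑ l ∈ insert y (I \ K), |C x l| ≤ ∑ j, |C x j| :=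
    Finset.sum_le_sum_of_subset_of_nonneg (Finset.subset_univ _) fun _ _ _ => abs_nonneg _
  rw [Finset.sum_insert (by simp [hy])] at h2
  linarith

/-- An entry inside `K` and the border sum use disjoint parts of one row, so together they amount to
at most the absolute row sum, which is at most half of `bigM`. -/
theorem le_matrixD_last {K I : Finset (Fin n)} (i j : Fin K.card) :
    C (enum K i) (enum K j) ≤ bigM C + ∑ l ∈ I \ K, C (enum K i) l := by
  have h1 := row_abs_sum_le C (enum K i)
  have h2 := abs_add_border_le (C := C) (I := I) (x := enum K i) (enum_mem K j)
  have h3 := neg_abs_le (∑ l ∈ I \ K, C (enum K i) l)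
  have h4 := le_abs_self (C (enum K i) (enum K j))
  have h5 : 0 ≤ ∑ j, |C (enum K i) j| := Finset.sum_nonneg fun _ _ => abs_nonneg _
  linarith

/-- The same estimate has a factor 2 to spare: it gives `bigM C ≤ bigM C / 2`, so `bigM C` is not
positive. This settles the degenerate case in which the appended index need not stand at an end. -/
theorem entries_zero_of_matrixD_last_le {K I : Finset (Fin n)} {i j : Fin K.card}
    (h : bigM C + ∑ l ∈ I \ K, C (enum K i) l ≤ C (enum K i) (enum K j)) :
    ∀ x y, C x y = 0 := by
  have h1 := row_abs_sum_le C (enum K i)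
  have h2 := abs_add_border_le (C := C) (I := I) (x := enum K i) (enum_mem K j)
  have h3 := neg_abs_le (∑ l ∈ I \ K, C (enum K i) l)
  have h4 := le_abs_self (C (enum K i) (enum K j))
  have h5 : bigM C ≤ 0 := by linarith
  intro x y
  have h6 := row_abs_sum_le C x
  have h7 := Finset.single_le_sum (f := fun j => |C x j|) (fun j _ => abs_nonneg _)
    (Finset.mem_univ y)
  beta_reduce at h7
  exact abs_nonpos_iff.mp (by linarith)

theorem orient_antiRobinson {k : ℕ} {A : Matrix (Fin (k + 1)) (Fin (k + 1)) ℝ}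
    {ψ : Equiv.Perm (Fin (k + 1))} (h : IsAntiRobinsonPerm A ψ) :
    IsAntiRobinsonPerm A (orient ψ) := by
  unfold orient
  split_ifs with h1
  · exact h
  · obtain ⟨hs, hr⟩ := h
    refine ⟨?_, fun i j l hij hjl => ?_⟩
    · ext a b
      simpa using hs.apply a.rev b.rev
    · have h2 := hr l.rev j.rev i.rev (Fin.rev_lt_rev.mpr hjl) (Fin.rev_lt_rev.mpr hij)
      have e1 := hs.apply l.rev i.rev
      have e2 := hs.apply l.rev j.rev
      have e3 := hs.apply j.rev i.rev
      simp only [Matrix.submatrix_apply, Equiv.trans_apply, Fin.revPerm_apply] at *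
      rw [e1, e2, e3, max_comm]
      exact h2

/-- After orientation the appended index is never first, even if ALG placed it in the interior. -/
theorem orient_zero_ne {k : ℕ} (hk : 0 < k) (ψ : Equiv.Perm (Fin (k + 1))) :
    orient ψ 0 ≠ Fin.last k := by
  unfold orient
  split_ifs with h1
  · intro h
    have := ψ.injective (h.trans h1.symm)
    simp [Fin.ext_iff] at this
    omega
  · simpa using h1

theorem goodBlock_blockOf
    (ψ : Equiv.Perm (Fin ((minSet C P q).card + 1)))
    (hψ : IsAntiRobinsonPerm (matrixD C (remaining P q) (minSet C P q)) ψ)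
    (hne : remaining P q ≠ ∅) :
    GoodBlock C P q (blockOf (minSet C P q) ψ) := by
  set φ := orient ψ with hφ
  have hAR : IsAntiRobinsonPerm (matrixD C (remaining P q) (minSet C P q)) φ := orient_antiRobinson hψ
  have hkpos : 0 < (minSet C P q).card := (minSet_nonempty C P q hne).card_pos
  have hAR' : ∀ a b c, φ.symm a < φ.symm b → φ.symm b < φ.symm c →
      matrixD C (remaining P q) (minSet C P q) a b ≤ matrixD C (remaining P q) (minSet C P q) a c ∧
      matrixD C (remaining P q) (minSet C P q) b c ≤ matrixD C (remaining P q) (minSet C P q) a c := by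
    intro a b c h1 h2
    have := hAR.2 _ _ _ h1 h2
    simp only [Matrix.submatrix_apply, Equiv.apply_symm_apply] at this
    exact ⟨(le_max_left _ _).trans this, (le_max_right _ _).trans this⟩
  have hlt : ∀ {a b : Fin (minSet C P q).card}, (blockOf (minSet C P q) ψ).idxOf (enum (minSet C P q) a) < (blockOf (minSet C P q) ψ).idxOf (enum (minSet C P q) b) →
      φ.symm a.castSucc < φ.symm b.castSucc := by
    intro a b hab
    obtain ⟨i, j, h1, h2, h3⟩ := pairwise_of_idxOf_lt pairwise_blockOf
      (mem_blockOf (minSet C P q) ψ (enum_mem (minSet C P q) b)) hab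
    rwa [← (enum (minSet C P q)).injective h1, ← (enum (minSet C P q)).injective h2] at h3
  refine ⟨nodup_blockOf, fun x => mem_blockOf_iff, ?_, ?_⟩
  · intro i hi j hj k hk hij hjk
    obtain ⟨a, rfl⟩ := exists_enum (mem_blockOf_iff.mp hi)
    obtain ⟨b, rfl⟩ := exists_enum (mem_blockOf_iff.mp hj)
    obtain ⟨c, rfl⟩ := exists_enum (mem_blockOf_iff.mp hk)
    simpa only [matrixD_castSucc] using hAR' _ _ _ (hlt hij) (hlt hjk)
  · intro j hj k hk hjk
    obtain ⟨a, rfl⟩ := exists_enum (mem_blockOf_iff.mp hj)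
    obtain ⟨b, rfl⟩ := exists_enum (mem_blockOf_iff.mp hk)
    have hab := hlt hjk
    -- If the appended index follows `b`, its column in `D` compares the two row sums directly, as
    -- `bigM` cancels.
    by_cases hlast : φ.symm b.castSucc < φ.symm (Fin.last _)
    · have := (hAR' _ _ _ hab hlast).2
      rw [matrixD_last, matrixD_last] at this
      linarith
    -- Otherwise it lies strictly between the first index, which belongs to `K`, and `b`. Then a
    -- border entry is bounded by an entry of `C`, and the matrix is zero.
    · have hb : φ.symm (Fin.last _) < φ.symm b.castSucc := by
        refine lt_of_le_of_ne (not_lt.mp hlast) fun he => ?_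
        exact (Fin.castSucc_lt_last b).ne' (φ.symm.injective he)
      have h0 : 0 < φ.symm (Fin.last _) := by
        refine lt_of_le_of_ne (Fin.zero_le _) fun he => ?_
        exact orient_zero_ne hkpos ψ ((Equiv.symm_apply_eq _).mp he.symm).symm
      obtain ⟨d, hd⟩ : ∃ d : Fin (minSet C P q).card, d.castSucc = φ 0 := by
        induction hφ0 : φ 0 using Fin.lastCases with
        | last => exact absurd hφ0 (orient_zero_ne hkpos ψ)
        | cast d => exact ⟨d, rfl⟩
      have h1 := (hAR' d.castSucc (Fin.last _) b.castSucc (by simpa [hd] using h0) hb).1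
      rw [matrixD_last, matrixD_castSucc] at h1
      have hz := entries_zero_of_matrixD_last_le h1
      simp [hz]

/-- Here `K` is everything that remains, so the border sums are empty and no appended index is
needed. -/
theorem goodBlock_ofFn (hP : P.Nodup) (hq : q ∉ P)
    (h2 : (minSet C P q).card + P.length + 1 = n)
    (ψ : Equiv.Perm (Fin (minSet C P q).card))
    (hψ : IsAntiRobinsonPerm (C.submatrix (enum (minSet C P q)) (enum (minSet C P q))) ψ) :
    GoodBlock C P q (List.ofFn fun i => enum (minSet C P q) (ψ i)) := by
  have hinj : Function.Injective fun i => enum (minSet C P q) (ψ i) := (enum (minSet C P q)).injective.comp ψ.injective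
  have hnd : (List.ofFn fun i => enum (minSet C P q) (ψ i)).Nodup := List.nodup_ofFn.mpr hinj
  have hidx : ∀ i : Fin (minSet C P q).card, (List.ofFn fun i => enum (minSet C P q) (ψ i)).idxOf (enum (minSet C P q) (ψ i)) = i := by
    intro i
    have := hnd.idxOf_getElem i (by simp)
    simpa using this
  refine ⟨hnd, fun x => ?_, ?_, ?_⟩
  · rw [List.mem_ofFn]
    constructor
    · rintro ⟨i, rfl⟩; exact enum_mem _ _
    · intro hx
      obtain ⟨i, rfl⟩ := exists_enum hx
      exact ⟨ψ.symm i, by simp⟩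
  · intro i hi j hj k hk hij hjk
    obtain ⟨a, rfl⟩ := List.mem_ofFn.mp hi
    obtain ⟨b, rfl⟩ := List.mem_ofFn.mp hj
    obtain ⟨c, rfl⟩ := List.mem_ofFn.mp hk
    rw [hidx, hidx] at hij hjk
    have := hψ.2 a b c hij hjk
    exact ⟨(le_max_left _ _).trans this, (le_max_right _ _).trans this⟩
  · intro j hj k hk hjk
    rw [← minSet_eq_remaining hP hq h2]
    simp

/-- The completion itself witnesses that the matrix passed to ALG is permuted Anti-Robinson, which
excludes the answer FALSE; the order that ALG returns need not be the one in the completion. -/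
theorem Completes.exists_nextBlock {O : Oracle} (hO : O.Correct) (hC : C.IsSymm)
    (h : Completes C P q R) (hp : p ∈ P) (hc : ∀ i j, C i p = C j p)
    (hne : remaining P q ≠ ∅) : ∃ B, nextBlock O C q P = some B ∧ GoodBlock C P q B := by
  have hP : P.Nodup := (List.nodup_append.mp h.nodup).1
  have hq := h.notMem.1
  have hinj := h.idxOf_inj
  unfold nextBlock
  dsimp only
  split_ifs with h1 h2
  · refine ⟨_, rfl, Finset.sort_nodup _ _, fun x => by simp, ?_, ?_⟩
    · intro i hi j hj k hk hij
      rw [Finset.mem_sort] at hi hj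
      rw [Finset.card_le_one.mp h1.le i hi j hj] at hij
      exact absurd hij (lt_irrefl _)
    · intro i hi j hj hij
      rw [Finset.mem_sort] at hi hj
      rw [Finset.card_le_one.mp h1.le i hi j hj] at hij
      exact absurd hij (lt_irrefl _)
  · have hA : (C.submatrix (enum (minSet C P q)) (enum (minSet C P q))).IsSymm := hC.submatrix _
    obtain ⟨hO1, hO2⟩ := hO _ _ hA
    cases hans : O.answer _ (C.submatrix (enum (minSet C P q)) (enum (minSet C P q))) with
    | none =>
      refine absurd (isPermutedAntiRobinson_of_positions hA
        (fun i => (P ++ (R ++ [q])).idxOf (enum _ i)) ?_ ?_) (hO1 hans)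
      · exact hinj.comp (enum _).injective
      · intro i j k hij hjk
        exact h.ar_minSet hC hp hc (enum_mem _ i) (enum_mem _ j) (enum_mem _ k) hij hjk
    | some ψ => exact ⟨_, rfl, goodBlock_ofFn hP hq h2 ψ (hO2 ψ hans)⟩
  · have hA := matrixD_symm hC (remaining P q) (minSet C P q)
    obtain ⟨hO1, hO2⟩ := hO _ _ hA
    cases hans : O.answer _ (matrixD C (remaining P q) (minSet C P q)) with
    | none =>
      -- The appended index receives a position beyond those of all genuine indices.
      refine absurd (isPermutedAntiRobinson_of_positions hA
        (Fin.lastCases ((P ++ (R ++ [q])).length + 1)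
          fun i => (P ++ (R ++ [q])).idxOf (enum _ i)) ?_ ?_) (hO1 hans)
      · intro a b hab
        induction a using Fin.lastCases with
        | last =>
          induction b using Fin.lastCases with
          | last => rfl
          | cast b =>
            simp only [Fin.lastCases_last, Fin.lastCases_castSucc] at hab
            have := List.idxOf_lt_length_iff.mpr (h.mem (enum _ b))
            omega
        | cast a =>
          induction b using Fin.lastCases with
          | last =>
            simp only [Fin.lastCases_last, Fin.lastCases_castSucc] at hab
            have := List.idxOf_lt_length_iff.mpr (h.mem (enum _ a))
            omega
          | cast b =>
            simp only [Fin.lastCases_castSucc] at hab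
            rw [(enum _).injective (hinj hab)]
      · intro a b c hab hbc
        have hmax : ∀ x : Fin (minSet C P q).card, (P ++ (R ++ [q])).idxOf (enum _ x) <
            (P ++ (R ++ [q])).length := fun x => List.idxOf_lt_length_iff.mpr (h.mem _)
        induction a using Fin.lastCases with
        | last =>
          induction b using Fin.lastCases with
          | last => exact absurd hab (lt_irrefl _)
          | cast b =>
            simp only [Fin.lastCases_last, Fin.lastCases_castSucc] at hab
            have := hmax b
            omega
        | cast a =>
          induction b using Fin.lastCases with
          | last =>
            induction c using Fin.lastCases with
            | last => exact absurd hbc (lt_irrefl _)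
            | cast c =>
              simp only [Fin.lastCases_last, Fin.lastCases_castSucc] at hbc
              have := hmax c
              omega
          | cast b =>
            simp only [Fin.lastCases_castSucc] at hab
            induction c using Fin.lastCases with
            | last =>
              rw [matrixD_castSucc, matrixD_last, matrixD_last]
              -- Against the last column, one inequality comes from the size of `bigM`; the other is
              -- the sum of descending columns, since elements of `I' \ K` follow `K` in the
              -- completion.
              refine ⟨le_matrixD_last a b, ?_⟩
              gcongr with l hl
              rw [Finset.mem_sdiff] at hl
              exact h.descend hp hc
                (h.notMem_of_mem (h.mem_of_mem_minSet (enum_mem _ a))).1 hab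
                (h.lt_of_mem_minSet (enum_mem _ b) (mem_remaining.mp hl.1).1 hl.2)
            | cast c =>
              simp only [Fin.lastCases_castSucc] at hbc
              simp only [matrixD_castSucc]
              exact h.ar_minSet hC hp hc (enum_mem _ a) (enum_mem _ b) (enum_mem _ c) hab hbc
    | some ψ => exact ⟨_, rfl, goodBlock_blockOf ψ (hO2 ψ hans) hne⟩

theorem checkCandidateDP_complete {O : Oracle} (hO : O.Correct) (hC : C.IsSymm)
    (hc : ∀ i j, C i p = C j p) :
    ∀ (m : ℕ) (P R : List (Fin n)), (remaining P q).card = m → p ∈ P → Completes C P q R →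
    ∃ L, checkCandidateDP O C q P = some L ∧ IsDemidenkoList C L := by
  intro m
  induction m using Nat.strong_induction_on with
  | _ m ih =>
    intro P R hm hp h
    by_cases hne : remaining P q = ∅
    · refine ⟨_, checkCandidateDP_of_empty hne, ?_⟩
      have hR : R = [] := List.eq_nil_iff_forall_not_mem.mpr fun x hx => by
        simpa [hne] using (h.mem_iff x).mpr hx
      have := h.dem
      rwa [hR] at this
    · obtain ⟨B, hB, hgood⟩ := h.exists_nextBlock hO hC hp hc hne
      obtain ⟨R', hR'⟩ := h.append hC hp hc hgood
      rw [checkCandidateDP_step (List.nodup_append.mp h.nodup).1 h.notMem.1 hne, hB]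
      exact ih _ (hm ▸ length_append_nextBlock_lt hne hB) (P ++ B) R' rfl
        (List.mem_append_left _ hp) hR'

end Completeness

/-! ### The final test and the correctness of the double loop. -/

section Recognition

variable {n : ℕ}

theorem shifted_isSymm {C : Matrix (Fin n) (Fin n) ℝ} (hC : C.IsSymm) (p : Fin n) :
    (shifted C p).IsSymm := by
  ext i j
  have := hC.apply i j
  have h2 := hC.apply p j
  have h3 := hC.apply p i
  simp only [Matrix.transpose_apply, shifted]
  linarith

theorem shifted_col {C : Matrix (Fin n) (Fin n) ℝ} (p i j : Fin n) :
    shifted C p i p = shifted C p j p := by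
  simp only [shifted]
  ring

/-- Each of the four indices occurs once on either side of the inequality, so the subtracted row and
column terms cancel. -/
theorem isDemidenkoPerm_shifted_iff {C : Matrix (Fin n) (Fin n) ℝ} (hC : C.IsSymm) (p : Fin n)
    (φ : Equiv.Perm (Fin n)) : IsDemidenkoPerm (shifted C p) φ ↔ IsDemidenkoPerm C φ := by
  unfold IsDemidenkoPerm IsDemidenko
  simp only [hC.submatrix, (shifted_isSymm hC p).submatrix, true_and, Matrix.submatrix_apply,
    shifted]
  refine forall_congr' fun i => forall_congr' fun j => forall_congr' fun k =>
    forall_congr' fun l => forall_congr' fun _ => forall_congr' fun _ => forall_congr' fun _ => ?_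
  constructor <;> intro h <;> linarith

/-- Telescoping over the rows from `j` to `k`: the columns `i` and `l` stay fixed and satisfy the
range conditions for every intermediate pair of rows. -/
theorem AdjacentCondition.demidenko {A : Matrix (Fin n) (Fin n) ℝ} (h : AdjacentCondition A)
    {i j l : Fin n} (hij : i < j) :
    ∀ (m : ℕ) (k : Fin n), (k : ℕ) = j + 1 + m → k < l → A j i + A k l ≤ A j l + A k i := by
  intro m
  induction m with
  | zero =>
    intro k hk hkl
    have := h i j k l hij hk hkl
    linarith
  | succ m ih =>
    intro k hk hkl
    have hkn := k.isLt
    have h1 := ih ⟨j + 1 + m, by omega⟩ rfl (by rw [Fin.lt_def] at *; simp only; omega)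
    have h2 := h i ⟨j + 1 + m, by omega⟩ k l (by rw [Fin.lt_def] at *; simp only; omega)
      (by simp only; omega) hkl
    linarith

theorem adjacentCondition_iff {C : Matrix (Fin n) (Fin n) ℝ} (hC : C.IsSymm)
    (φ : Equiv.Perm (Fin n)) : AdjacentCondition (C.submatrix φ φ) ↔ IsDemidenkoPerm C φ := by
  constructor
  · intro h
    refine ⟨hC.submatrix _, fun i j k l hij hjk hkl => ?_⟩
    rw [Fin.lt_def] at hjk
    exact h.demidenko hij (k - j - 1) k (by omega) hkl
  · intro h i j k l hij hjk hkl
    have := h.2 i j k l hij (by rw [Fin.lt_def]; omega) hkl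
    linarith

theorem exists_perm_of_nodup {L : List (Fin n)} (hL : L.Nodup) (hn : L.length = n) :
    ∃ φ : Equiv.Perm (Fin n), L = List.ofFn φ := by
  have hinj : Function.Injective fun i : Fin n => L.get (Fin.cast hn.symm i) := by
    intro i j hij
    have := hL.injective_get hij
    simpa using this
  refine ⟨Equiv.ofBijective _ (Finite.injective_iff_bijective.mp hinj), ?_⟩
  apply List.ext_getElem
  · simp [hn]
  · intro i h1 h2
    simp

theorem idxOf_ofFn_perm (φ : Equiv.Perm (Fin n)) (x : Fin n) :
    (List.ofFn φ).idxOf x = φ.symm x := by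
  have hnd : (List.ofFn φ).Nodup := List.nodup_ofFn.mpr φ.injective
  have := hnd.idxOf_getElem (φ.symm x) (by simp)
  simpa using this

theorem isDemidenkoList_ofFn_iff {C : Matrix (Fin n) (Fin n) ℝ} (hC : C.IsSymm)
    (φ : Equiv.Perm (Fin n)) : IsDemidenkoList C (List.ofFn φ) ↔ IsDemidenkoPerm C φ := by
  unfold IsDemidenkoList
  simp only [idxOf_ofFn_perm]
  constructor
  · intro h
    refine ⟨hC.submatrix _, fun i j k l hij hjk hkl => ?_⟩
    exact h (φ i) (φ j) (φ k) (φ l) (by simpa using hij) (by simpa using hjk) (by simpa using hkl)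
  · intro h i j k l hij hjk hkl
    have := h.2 (φ.symm i) (φ.symm j) (φ.symm k) (φ.symm l) hij hjk hkl
    simpa using this

theorem passesTest_ofFn_iff {A : Matrix (Fin n) (Fin n) ℝ} (hA : A.IsSymm)
    (φ : Equiv.Perm (Fin n)) : PassesTest A (List.ofFn φ) ↔ IsDemidenkoPerm A φ := by
  rw [← adjacentCondition_iff hA]
  unfold PassesTest
  simp

theorem recognPD_eq_some {O : Oracle} {C : Matrix (Fin n) (Fin n) ℝ} {L : List (Fin n)}
    (h : recognPD O C = some L) : ∃ p q, p ≠ q ∧ tryPair O C p q = some L := by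
  obtain ⟨p, -, h⟩ := List.exists_of_findSome?_eq_some h
  obtain ⟨q, -, h⟩ := List.exists_of_findSome?_eq_some h
  split_ifs at h with hpq
  exact ⟨p, q, hpq, h⟩

theorem recognPD_eq_none_iff {O : Oracle} {C : Matrix (Fin n) (Fin n) ℝ} :
    recognPD O C = none ↔ ∀ p q, p ≠ q → tryPair O C p q = none := by
  simp [recognPD, List.findSome?_eq_none_iff]

theorem tryPair_eq_some {O : Oracle} {C : Matrix (Fin n) (Fin n) ℝ} {p q : Fin n}
    {L : List (Fin n)} : tryPair O C p q = some L ↔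
      checkCandidateDP O (shifted C p) q [p] = some L ∧ PassesTest (shifted C p) L := by
  unfold tryPair
  cases h : checkCandidateDP O (shifted C p) q [p] with
  | none => simp
  | some L' =>
    simp only [Option.ite_none_right_eq_some, Option.some.injEq]
    constructor
    · rintro ⟨h1, rfl⟩; exact ⟨rfl, h1⟩
    · rintro ⟨rfl, h1⟩; exact ⟨h1, rfl⟩

theorem tryPair_sound {O : Oracle} {C : Matrix (Fin n) (Fin n) ℝ} (hC : C.IsSymm) {p q : Fin n}
    (hpq : p ≠ q) {L : List (Fin n)} (h : tryPair O C p q = some L) :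
    ∃ φ : Equiv.Perm (Fin n), L = List.ofFn φ ∧ IsDemidenkoPerm C φ := by
  obtain ⟨h1, h2⟩ := tryPair_eq_some.mp h
  obtain ⟨h3, h4⟩ := checkCandidateDP_sound _ [p] rfl (by simp) (by simpa using hpq.symm) L h1
  obtain ⟨φ, rfl⟩ := exists_perm_of_nodup h3 h4
  exact ⟨φ, rfl, (isDemidenkoPerm_shifted_iff hC p φ).mp
    ((passesTest_ofFn_iff (shifted_isSymm hC p) φ).mp h2)⟩

/-- Choose the ends of a Demidenko permutation. Its interior is the initial completion, and the
permutation `χ` finally found may differ from it. -/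
theorem exists_tryPair {O : Oracle} (hO : O.Correct) (hn : 2 ≤ n)
    {C : Matrix (Fin n) (Fin n) ℝ} (hC : C.IsSymm) (h : IsPermutedDemidenko C) :
    ∃ p q, p ≠ q ∧ ∃ L, tryPair O C p q = some L := by
  obtain ⟨φ, hφ⟩ := h
  obtain ⟨m, rfl⟩ : ∃ m, n = m + 2 := ⟨n - 2, by omega⟩
  set p := φ 0 with hp
  set q := φ (Fin.last _) with hq
  have hpq : p ≠ q := by
    intro h
    have := φ.injective h
    simp [Fin.ext_iff] at this
  have hA := shifted_isSymm hC p
  set R := List.ofFn fun i : Fin m => φ i.castSucc.succ with hR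
  have hL : List.ofFn φ = [p] ++ (R ++ [q]) := by
    rw [List.ofFn_succ, List.ofFn_succ']
    simp [hR, hq, hp]
  have hcomp : Completes (shifted C p) [p] q R := by
    refine ⟨?_, ?_, ?_⟩ <;> rw [← hL]
    · exact List.nodup_ofFn.mpr φ.injective
    · intro x
      exact List.mem_ofFn.mpr ⟨φ.symm x, by simp⟩
    · exact (isDemidenkoList_ofFn_iff hA φ).mpr ((isDemidenkoPerm_shifted_iff hC p φ).mpr hφ)
  obtain ⟨L, hL1, hL2⟩ := checkCandidateDP_complete hO hA (p := p) (fun i j => shifted_col p i j)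
    _ [p] R rfl (by simp) hcomp
  obtain ⟨h3, h4⟩ := checkCandidateDP_sound _ [p] rfl (by simp) (by simpa using hpq.symm) L hL1
  obtain ⟨χ, rfl⟩ := exists_perm_of_nodup h3 h4
  exact ⟨p, q, hpq, _, tryPair_eq_some.mpr ⟨hL1, (passesTest_ofFn_iff hA χ).mpr
    ((isDemidenkoList_ofFn_iff hA χ).mp hL2)⟩⟩

theorem recognPD_correct {O : Oracle} (hO : O.Correct) (hn : 2 ≤ n)
    {C : Matrix (Fin n) (Fin n) ℝ} (hC : C.IsSymm) :
    (recognPD O C = none ↔ ¬ IsPermutedDemidenko C) ∧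
      ∀ L : List (Fin n), recognPD O C = some L →
        ∃ φ : Equiv.Perm (Fin n), L = List.ofFn φ ∧ IsDemidenkoPerm C φ := by
  refine ⟨⟨fun h hD => ?_, fun h => ?_⟩, fun L hL => ?_⟩
  · obtain ⟨p, q, hpq, L, hL⟩ := exists_tryPair hO hn hC hD
    rw [recognPD_eq_none_iff.mp h p q hpq] at hL
    cases hL
  · rw [recognPD_eq_none_iff]
    intro p q hpq
    by_contra hne
    obtain ⟨L, hL⟩ := Option.ne_none_iff_exists'.mp hne
    obtain ⟨φ, -, hφ⟩ := tryPair_sound hC hpq hL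
    exact h ⟨φ, hφ⟩
  · obtain ⟨p, q, hpq, h⟩ := recognPD_eq_some hL
    exact tryPair_sound hC hpq h

end Recognition

section Logic

/-! A program logic for the machine: total correctness with a bound on the running time. -/

/-- Started in `σ`, the program halts after at most `T` steps in a store with the property `Q`. -/
def Spec (O : Oracle) (s : Program) (σ : Store) (T : ℕ) (Q : Store → Prop) : Prop :=
  ∃ t τ, Exec O s σ t τ ∧ t ≤ T ∧ Q τ

def Program.natWrites : Program → List ℕ
  | .setNat x _ => [x]
  | .callAlg _ _ f _ => [f]
  | .seq s t => s.natWrites ++ t.natWrites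
  | .ite _ s t => s.natWrites ++ t.natWrites
  | .loop _ s => s.natWrites
  | _ => []

def Program.natArrWrites : Program → List ℕ
  | .setNatArr x _ _ => [x]
  | .callAlg _ _ _ y => [y]
  | .seq s t => s.natArrWrites ++ t.natArrWrites
  | .ite _ s t => s.natArrWrites ++ t.natArrWrites
  | .loop _ s => s.natArrWrites
  | _ => []

def Program.realWrites : Program → List ℕ
  | .setReal x _ => [x]
  | .seq s t => s.realWrites ++ t.realWrites
  | .ite _ s t => s.realWrites ++ t.realWrites
  | .loop _ s => s.realWrites
  | _ => []

def Program.realArrWrites : Program → List ℕ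
  | .setRealArr x _ _ _ => [x]
  | .seq s t => s.realArrWrites ++ t.realArrWrites
  | .ite _ s t => s.realArrWrites ++ t.realArrWrites
  | .loop _ s => s.realArrWrites
  | _ => []

/-- The stores agree in everything that `s` does not write. -/
structure Agree (s : Program) (σ τ : Store) : Prop where
  nat : ∀ x, x ∉ s.natWrites → τ.natVar x = σ.natVar x
  natArr : ∀ x, x ∉ s.natArrWrites → τ.natArr x = σ.natArr x
  real : ∀ x, x ∉ s.realWrites → τ.realVar x = σ.realVar x
  realArr : ∀ x, x ∉ s.realArrWrites → τ.realArr x = σ.realArr x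

theorem Agree.refl (s : Program) (σ : Store) : Agree s σ σ :=
  ⟨fun _ _ => rfl, fun _ _ => rfl, fun _ _ => rfl, fun _ _ => rfl⟩

theorem Agree.trans {s : Program} {σ τ υ : Store} (h : Agree s σ τ) (h' : Agree s τ υ) :
    Agree s σ υ :=
  ⟨fun x hx => (h'.nat x hx).trans (h.nat x hx),
    fun x hx => (h'.natArr x hx).trans (h.natArr x hx),
    fun x hx => (h'.real x hx).trans (h.real x hx),
    fun x hx => (h'.realArr x hx).trans (h.realArr x hx)⟩

theorem Agree.mono {s s' : Program} {σ τ : Store} (h : Agree s σ τ)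
    (h1 : s.natWrites ⊆ s'.natWrites) (h2 : s.natArrWrites ⊆ s'.natArrWrites)
    (h3 : s.realWrites ⊆ s'.realWrites) (h4 : s.realArrWrites ⊆ s'.realArrWrites) :
    Agree s' σ τ :=
  ⟨fun x hx => h.nat x fun h => hx (h1 h), fun x hx => h.natArr x fun h => hx (h2 h),
    fun x hx => h.real x fun h => hx (h3 h), fun x hx => h.realArr x fun h => hx (h4 h)⟩

@[simp] theorem writeNat_natVar (σ : Store) (x v y : ℕ) :
    (σ.writeNat x v).natVar y = if y = x then v else σ.natVar y := by
  simp [Store.writeNat, Function.update_apply]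
@[simp] theorem writeNat_natArr (σ : Store) (x v : ℕ) : (σ.writeNat x v).natArr = σ.natArr := rfl
@[simp] theorem writeNat_realVar (σ : Store) (x v : ℕ) :
    (σ.writeNat x v).realVar = σ.realVar := rfl
@[simp] theorem writeNat_realArr (σ : Store) (x v : ℕ) :
    (σ.writeNat x v).realArr = σ.realArr := rfl
@[simp] theorem writeNatArr_natVar (σ : Store) (x i v : ℕ) :
    (σ.writeNatArr x i v).natVar = σ.natVar := rfl
theorem writeNatArr_natArr (σ : Store) (x i v y : ℕ) :
    (σ.writeNatArr x i v).natArr y =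
      if y = x then Function.update (σ.natArr x) i v else σ.natArr y := by
  simp only [Store.writeNatArr, Function.update_apply]
@[simp] theorem writeNatArr_natArr_apply (σ : Store) (x i v y j : ℕ) :
    (σ.writeNatArr x i v).natArr y j = if y = x ∧ j = i then v else σ.natArr y j := by
  rw [writeNatArr_natArr]
  by_cases h : y = x
  · subst h; simp [Function.update_apply]
  · simp [h]
@[simp] theorem writeNatArr_realVar (σ : Store) (x i v : ℕ) :
    (σ.writeNatArr x i v).realVar = σ.realVar := rfl
@[simp] theorem writeNatArr_realArr (σ : Store) (x i v : ℕ) :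
    (σ.writeNatArr x i v).realArr = σ.realArr := rfl
@[simp] theorem writeReal_natVar (σ : Store) (x : ℕ) (v : ℝ) :
    (σ.writeReal x v).natVar = σ.natVar := rfl
@[simp] theorem writeReal_natArr (σ : Store) (x : ℕ) (v : ℝ) :
    (σ.writeReal x v).natArr = σ.natArr := rfl
@[simp] theorem writeReal_realVar (σ : Store) (x : ℕ) (v : ℝ) (y : ℕ) :
    (σ.writeReal x v).realVar y = if y = x then v else σ.realVar y := by
  simp [Store.writeReal, Function.update_apply]
@[simp] theorem writeReal_realArr (σ : Store) (x : ℕ) (v : ℝ) :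
    (σ.writeReal x v).realArr = σ.realArr := rfl
@[simp] theorem writeRealArr_natVar (σ : Store) (x i j : ℕ) (v : ℝ) :
    (σ.writeRealArr x i j v).natVar = σ.natVar := rfl
@[simp] theorem writeRealArr_natArr (σ : Store) (x i j : ℕ) (v : ℝ) :
    (σ.writeRealArr x i j v).natArr = σ.natArr := rfl
@[simp] theorem writeRealArr_realVar (σ : Store) (x i j : ℕ) (v : ℝ) :
    (σ.writeRealArr x i j v).realVar = σ.realVar := rfl
theorem writeRealArr_realArr_of_ne (σ : Store) {x y : ℕ} (i j : ℕ) (v : ℝ) (h : y ≠ x) :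
    (σ.writeRealArr x i j v).realArr y = σ.realArr y := by
  simp [Store.writeRealArr, h]
@[simp] theorem writeRealArr_realArr_apply (σ : Store) (x i j : ℕ) (v : ℝ) (y i' j' : ℕ) :
    (σ.writeRealArr x i j v).realArr y i' j' =
      if y = x ∧ i' = i ∧ j' = j then v else σ.realArr y i' j' := by
  by_cases h : y = x
  · subst h
    by_cases hi : i' = i
    · subst hi
      simp [Store.writeRealArr, Function.update_apply]
    · simp [Store.writeRealArr, hi]
  · simp [Store.writeRealArr, h]

variable {O : Oracle} {s s' : Program} {σ τ : Store} {T T' : ℕ} {Q Q' : Store → Prop}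

/-- The frame rule. The write lists are computable from the program text, so each later use is
discharged by `decide`. -/
theorem Exec.agree {t : ℕ} (h : Exec O s σ t τ) : Agree s σ τ := by
  induction h with
  | skip => exact Agree.refl _ _
  | setNat x e σ =>
    refine ⟨fun y hy => ?_, fun _ _ => rfl, fun _ _ => rfl, fun _ _ => rfl⟩
    have : y ≠ x := by simpa [Program.natWrites] using hy
    simp [this]
  | setNatArr x e f σ =>
    refine ⟨fun _ _ => rfl, fun y hy => ?_, fun _ _ => rfl, fun _ _ => rfl⟩
    have : y ≠ x := by simpa [Program.natArrWrites] using hy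
    rw [writeNatArr_natArr, if_neg this]
  | setReal x u σ =>
    refine ⟨fun _ _ => rfl, fun _ _ => rfl, fun y hy => ?_, fun _ _ => rfl⟩
    have : y ≠ x := by simpa [Program.realWrites] using hy
    simp [this]
  | setRealArr x e f u σ =>
    refine ⟨fun _ _ => rfl, fun _ _ => rfl, fun _ _ => rfl, fun y hy => ?_⟩
    have : y ≠ x := by simpa [Program.realArrWrites] using hy
    exact writeRealArr_realArr_of_ne _ _ _ _ this
  | seq _ _ ih1 ih2 =>
    exact (ih1.mono (List.subset_append_left _ _) (List.subset_append_left _ _)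
      (List.subset_append_left _ _) (List.subset_append_left _ _)).trans
      (ih2.mono (List.subset_append_right _ _) (List.subset_append_right _ _)
      (List.subset_append_right _ _) (List.subset_append_right _ _))
  | iteTrue _ _ ih =>
    exact ih.mono (List.subset_append_left _ _) (List.subset_append_left _ _)
      (List.subset_append_left _ _) (List.subset_append_left _ _)
  | iteFalse _ _ ih =>
    exact ih.mono (List.subset_append_right _ _) (List.subset_append_right _ _)
      (List.subset_append_right _ _) (List.subset_append_right _ _)
  | loopDone => exact Agree.refl _ _
  | loopStep _ _ _ ih1 ih2 =>
    exact Agree.trans (ih1.mono (s' := .loop _ _) (List.Subset.refl _) (List.Subset.refl _)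
      (List.Subset.refl _) (List.Subset.refl _)) ih2
  | callAlg x e f y σ =>
    cases O.answer (e.eval σ) (σ.corner x (e.eval σ)) with
    | none =>
      refine ⟨fun z hz => ?_, fun _ _ => rfl, fun _ _ => rfl, fun _ _ => rfl⟩
      have : z ≠ f := by simpa [Program.natWrites] using hz
      simp [Store.writeAnswer, this]
    | some ψ =>
      refine ⟨fun z hz => ?_, fun z hz => ?_, fun _ _ => rfl, fun _ _ => rfl⟩
      · have : z ≠ f := by simpa [Program.natWrites] using hz
        simp [Store.writeAnswer, this]
      · have : z ≠ y := by simpa [Program.natArrWrites] using hz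
        simp [Store.writeAnswer, this]

theorem Spec.agree (h : Spec O s σ T Q) : Spec O s σ T fun τ => Agree s σ τ ∧ Q τ := by
  obtain ⟨t, τ, h1, h2, h3⟩ := h
  exact ⟨t, τ, h1, h2, h1.agree, h3⟩

theorem Spec.le (h : Spec O s σ T Q) (hT : T ≤ T') : Spec O s σ T' Q := by
  obtain ⟨t, τ, h1, h2, h3⟩ := h
  exact ⟨t, τ, h1, h2.trans hT, h3⟩

theorem Spec.imp (h : Spec O s σ T Q) (hQ : ∀ τ, Agree s σ τ → Q τ → Q' τ) :
    Spec O s σ T Q' := by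
  obtain ⟨t, τ, h1, h2, h3⟩ := h
  exact ⟨t, τ, h1, h2, hQ τ h1.agree h3⟩

theorem Spec.skip (h : Q σ) : Spec O .skip σ 1 Q := ⟨_, _, Exec.skip σ, le_rfl, h⟩

theorem Spec.setNat {x : ℕ} {e : NExpr} (h : Q (σ.writeNat x (e.eval σ))) :
    Spec O (.setNat x e) σ (e.cost + 1) Q := ⟨_, _, Exec.setNat x e σ, le_rfl, h⟩

theorem Spec.setNatArr {x : ℕ} {e f : NExpr} (h : Q (σ.writeNatArr x (e.eval σ) (f.eval σ))) :
    Spec O (.setNatArr x e f) σ (e.cost + f.cost + 1) Q :=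
  ⟨_, _, Exec.setNatArr x e f σ, le_rfl, h⟩

theorem Spec.setReal {x : ℕ} {u : RExpr} (h : Q (σ.writeReal x (u.eval σ))) :
    Spec O (.setReal x u) σ (u.cost + 1) Q := ⟨_, _, Exec.setReal x u σ, le_rfl, h⟩

theorem Spec.setRealArr {x : ℕ} {e f : NExpr} {u : RExpr}
    (h : Q (σ.writeRealArr x (e.eval σ) (f.eval σ) (u.eval σ))) :
    Spec O (.setRealArr x e f u) σ (e.cost + f.cost + u.cost + 1) Q :=
  ⟨_, _, Exec.setRealArr x e f u σ, le_rfl, h⟩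

theorem Spec.seq (h : Spec O s σ T fun τ => Spec O s' τ T' Q) :
    Spec O (.seq s s') σ (T + T') Q := by
  obtain ⟨t, τ, h1, h2, t', υ, h3, h4, h5⟩ := h
  exact ⟨_, υ, Exec.seq h1 h3, by omega, h5⟩

/-- Both branches are charged; this avoids maxima and affects only the constants. -/
theorem Spec.ite {b : BExpr} (h : b.Holds σ → Spec O s σ T Q)
    (h' : ¬ b.Holds σ → Spec O s' σ T' Q) : Spec O (.ite b s s') σ (b.cost + (T + T') + 1) Q := by
  by_cases hb : b.Holds σ
  · obtain ⟨t, τ, h1, h2, h3⟩ := h hb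
    exact ⟨_, τ, Exec.iteTrue hb h1, by omega, h3⟩
  · obtain ⟨t, τ, h1, h2, h3⟩ := h' hb
    exact ⟨_, τ, Exec.iteFalse hb h1, by omega, h3⟩

/-- The size and the matrix are tied to the store by equations, so the answer is a permutation of
`Fin m` for the intended `m` and no casts arise. -/
theorem Spec.callAlg {x f y m : ℕ} {e : NExpr} {A : Matrix (Fin m) (Fin m) ℝ}
    (he : e.eval σ = m) (hA : ∀ i j : Fin m, σ.realArr x i j = A i j)
    (hT : e.cost + O.time m A + 1 ≤ T)
    (h : ∀ τ, (O.answer m A = none ∧ τ.natVar f = 0) ∨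
      (∃ ψ, O.answer m A = some ψ ∧ τ.natVar f = 1 ∧ ∀ i : Fin m, τ.natArr y i = (ψ i : ℕ)) →
      Agree (.callAlg x e f y) σ τ → Q τ) :
    Spec O (.callAlg x e f y) σ T Q := by
  subst he
  obtain rfl : σ.corner x (e.eval σ) = A := by
    ext i j
    exact hA i j
  have hE := Exec.callAlg (O := O) x e f y σ
  refine ⟨_, _, hE, hT, h _ ?_ hE.agree⟩
  cases O.answer (e.eval σ) (σ.corner x (e.eval σ)) with
  | none => exact Or.inl ⟨rfl, by simp [Store.writeAnswer]⟩
  | some ψ => exact Or.inr ⟨ψ, rfl, by simp [Store.writeAnswer], by simp [Store.writeAnswer]⟩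

/-- `for i = lo, …, hi - 1 do body`. -/
def forLoop (i : ℕ) (lo hi : NExpr) (body : Program) : Program :=
  .seq (.setNat i lo)
    (.loop (.natLt (.var i) hi) (.seq body (.setNat i (.add (.var i) (.lit 1)))))

/-- The invariant is required after the counter has been incremented. The number `m` need only bound
the number of iterations; `1 ≤ m` lets the constant overhead be absorbed into the product, even for
an empty loop. -/
theorem Spec.forLoop {i : ℕ} {lo hi : NExpr} {body : Program} (a N m B : ℕ)
    (Inv : ℕ → Store → Prop)
    (hlo : lo.eval σ = a) (haN : a ≤ N) (hib : i ∉ body.natWrites)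
    (hhi : ∀ τ, Agree (forLoop i lo hi body) σ τ → hi.eval τ = N)
    (h0 : Inv a (σ.writeNat i a))
    (hstep : ∀ k τ, a ≤ k → k < N → τ.natVar i = k → Agree (Demidenko.forLoop i lo hi body) σ τ →
      Inv k τ → Spec O body τ B fun υ => Inv (k + 1) (υ.writeNat i (k + 1)))
    (hend : ∀ τ, Agree (Demidenko.forLoop i lo hi body) σ τ → Inv N τ → Q τ)
    (hloc : lo.cost ≤ 3) (hhic : hi.cost ≤ 3) (hm : 1 ≤ m) (hNm : N ≤ a + m) :
    Spec O (forLoop i lo hi body) σ ((B + 24) * m) Q := by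
  have main : ∀ d k τ, k + d = N → a ≤ k → τ.natVar i = k →
      Agree (Demidenko.forLoop i lo hi body) σ τ →
      Inv k τ → Spec O (.loop (.natLt (.var i) hi) (.seq body (.setNat i (.add (.var i) (.lit 1)))))
        τ ((B + 12) * d + 6) fun υ => Agree (Demidenko.forLoop i lo hi body) σ υ ∧ Inv N υ := by
    intro d
    induction d with
    | zero =>
      intro k τ hk hak hik hA hI
      refine ⟨_, τ, Exec.loopDone ?_, ?_, hA, ?_⟩
      · simp only [BExpr.Holds, NExpr.eval, hhi τ hA, hik]; omega
      · simp only [BExpr.cost, NExpr.cost]; omega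
      · rwa [← hk]
    | succ d ih =>
      intro k τ hk hak hik hA hI
      obtain ⟨t1, τ1, h1, h2, h3⟩ := hstep k τ hak (by omega) hik hA hI
      have hik' : τ1.natVar i = k := (h1.agree.nat i hib).trans hik
      have hE := Exec.seq h1 (Exec.setNat i (.add (.var i) (.lit 1)) τ1)
      simp only [NExpr.eval, hik'] at hE
      have hA' : Agree (Demidenko.forLoop i lo hi body) σ (τ1.writeNat i (k + 1)) := by
        refine hA.trans (hE.agree.mono ?_ ?_ ?_ ?_) <;>
        exact List.subset_append_right _ _
      obtain ⟨t2, τ2, h4, h5, h6⟩ := ih (k + 1) _ (by omega) (by omega) (by simp) hA' h3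
      refine ⟨_, τ2, Exec.loopStep ?_ hE h4, ?_, h6⟩
      · simp only [BExpr.Holds, NExpr.eval, hhi τ hA, hik]; omega
      · simp only [BExpr.cost, NExpr.cost]
        have : (B + 12) * (d + 1) = (B + 12) * d + B + 12 := by ring
        omega
  have hE := Exec.setNat (O := O) i lo σ
  rw [hlo] at hE
  have hA : Agree (Demidenko.forLoop i lo hi body) σ (σ.writeNat i a) := by
    refine hE.agree.mono ?_ ?_ ?_ ?_ <;> exact List.subset_append_left _ _
  obtain ⟨t, τ, h1, h2, h3, h4⟩ := main (N - a) a _ (by omega) le_rfl (by simp) hA h0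
  refine ⟨_, τ, Exec.seq hE h1, ?_, hend τ h3 h4⟩
  have h5 : (B + 12) * (N - a) ≤ (B + 12) * m := Nat.mul_le_mul_left _ (by omega)
  have h6 : (B + 24) * m = (B + 12) * m + 12 * m := by ring
  have h7 : 12 ≤ 12 * m := by omega
  omega

end Logic

/-! ### Computing the shifted matrix. -/

section Subprograms

/-! Memory layout. Integer variables: `0` dimension `n`, `1` logical output, `2` and `3` the ends
`p` and `q`, `4` number of placed indices, `5` flag of the current call, `6` size of the set `K`,
`7`–`9` and `11` loop counters and temporaries, `10` size of the current block. Integer arrays: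
`0` permutation, `1` marks of the used indices, `2` enumeration of `K`, `3` answer of ALG,
`4` current block. Real arrays: `0` input, `1` shifted matrix, `2` scores (in row `0`), `3` argument
of ALG. Real variables: `0` the number `M`, `1` minimum of the scores, `2`–`4` temporaries. -/

variable {n : ℕ} {O : Oracle} {σ : Store}

/-- Computes the shifted matrix. -/
def shiftProg : Program :=
  forLoop 7 (.lit 0) (.var 0) <| forLoop 8 (.lit 0) (.var 0) <|
    .setRealArr 1 (.var 7) (.var 8) (.sub (.sub (.arr 0 (.var 7) (.var 8))
      (.arr 0 (.var 2) (.var 8))) (.arr 0 (.var 7) (.var 2)))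

theorem shiftProg_spec {C : Matrix (Fin n) (Fin n) ℝ} (p : Fin n) (h0 : σ.natVar 0 = n)
    (hp : σ.natVar 2 = p) (hC : ∀ i j : Fin n, σ.realArr 0 i j = C i j) :
    Spec O shiftProg σ (100 * n * n) fun τ =>
      ∀ i j : Fin n, τ.realArr 1 i j = shifted C p i j := by
  have hn : 1 ≤ n := p.pos
  refine Spec.le (Spec.forLoop 0 n n (60 * n)
    (fun k τ => ∀ i j : Fin n, (i : ℕ) < k → τ.realArr 1 i j = shifted C p i j)
    rfl (Nat.zero_le _) (by decide) ?_ ?_ ?_ ?_ (by decide) (by decide) hn (by omega)) ?_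
  · intro τ hA
    exact (hA.nat 0 (by decide)).trans h0
  · intro i j hi; omega
  · intro k τ _ hk h7 hA hI
    refine Spec.le (Spec.forLoop 0 n n 30
      (fun l τ => ∀ i j : Fin n, (i : ℕ) < k ∨ ((i : ℕ) = k ∧ (j : ℕ) < l) →
        τ.realArr 1 i j = shifted C p i j)
      rfl (Nat.zero_le _) (by decide) ?_ ?_ ?_ ?_ (by decide) (by decide) hn (by omega)) ?_
    · intro υ hB
      exact (hB.nat 0 (by decide)).trans ((hA.nat 0 (by decide)).trans h0)
    · intro i j hij
      exact hI i j (by omega)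
    · intro l υ _ hl h8 hB hJ
      refine Spec.le (Spec.setRealArr ?_) (by decide)
      have h7' : υ.natVar 7 = k := (hB.nat 7 (by decide)).trans h7
      have h2' : υ.natVar 2 = p :=
        (hB.nat 2 (by decide)).trans ((hA.nat 2 (by decide)).trans hp)
      have hC' : υ.realArr 0 = σ.realArr 0 :=
        (hB.realArr 0 (by decide)).trans (hA.realArr 0 (by decide))
      intro i j hij
      simp only [NExpr.eval, RExpr.eval, h7', h8, h2', hC', writeNat_realArr,
        writeRealArr_realArr_apply, true_and]
      split_ifs with h
      · rw [← h.1, ← h.2, hC, hC, hC, shifted]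
      · exact hJ i j (by omega)
    · intro υ hB hJ i j hi
      exact hJ i j (by omega)
    · nlinarith
  · intro τ hA hI i j
    exact hI i j i.isLt
  · nlinarith

end Subprograms

/-! ### Representation of a partial permutation in memory. -/

section State

variable {n : ℕ} {O : Oracle} {σ τ : Store} {A : Matrix (Fin n) (Fin n) ℝ} {q : Fin n}
  {P : List (Fin n)}

/-- Computes `M`. -/
def normProg : Program :=
  .seq (.setReal 2 .zero) <|
  .seq (forLoop 7 (.lit 0) (.var 0) <| forLoop 8 (.lit 0) (.var 0) <|
    .ite (.realLe .zero (.arr 1 (.var 7) (.var 8)))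
      (.setReal 2 (.add (.var 2) (.arr 1 (.var 7) (.var 8))))
      (.setReal 2 (.sub (.var 2) (.arr 1 (.var 7) (.var 8))))) <|
  .setReal 0 (.add (.var 2) (.var 2))

theorem normProg_spec (hn : 1 ≤ n) (h0 : σ.natVar 0 = n)
    (hA : ∀ i j : Fin n, σ.realArr 1 i j = A i j) :
    Spec O normProg σ (200 * n * n) fun τ => τ.realVar 0 = bigM A := by
  have hn' : 1 ≤ n * n := Nat.mul_pos hn hn
  set F : ℕ → ℝ := fun i => ∑ j ∈ Finset.range n, |σ.realArr 1 i j| with hF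
  have hM : bigM A = (∑ i ∈ Finset.range n, F i) + ∑ i ∈ Finset.range n, F i := by
    rw [bigM, ← two_mul, Finset.sum_range]
    simp only [hF, Finset.sum_range, hA]
  refine Spec.le (Spec.seq (Spec.setReal (Spec.seq (T' := 10) (Spec.forLoop 0 n n (90 * n)
    (fun k τ => τ.realVar 2 = ∑ i ∈ Finset.range k, F i)
    rfl (Nat.zero_le _) (by decide) (fun τ hB => (hB.nat 0 (by decide)).trans h0) ?_ ?_ ?_
    (by decide) (by decide) hn (by omega))))) ?_
  · simp [RExpr.eval]
  · intro k τ _ hk h7 hB hI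
    refine Spec.le (Spec.forLoop 0 n n 50
      (fun l τ => τ.realVar 2 = ∑ i ∈ Finset.range k, F i +
        ∑ j ∈ Finset.range l, |σ.realArr 1 k j|)
      rfl (Nat.zero_le _) (by decide) ?_ ?_ ?_ ?_ (by decide) (by decide) hn (by omega)) ?_
    · intro υ hD
      exact (hD.nat 0 (by decide)).trans ((hB.nat 0 (by decide)).trans h0)
    · simpa using hI
    · intro l υ _ hl h8 hD hJ
      have h7' : υ.natVar 7 = k := (hD.nat 7 (by decide)).trans h7
      have hC' : υ.realArr 1 = σ.realArr 1 :=
        (hD.realArr 1 (by decide)).trans (hB.realArr 1 (by decide))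
      refine Spec.le (Spec.ite (fun hb => Spec.setReal ?_) (fun hb => Spec.setReal ?_)) (by decide)
      all_goals
        simp only [BExpr.Holds, NExpr.eval, RExpr.eval, h7', h8, hC'] at hb
        simp only [NExpr.eval, RExpr.eval, h7', h8, hC', writeNat_realVar, writeReal_realVar,
          if_true, hJ, Finset.sum_range_succ _ l]
      · rw [abs_of_nonneg hb]; ring
      · rw [abs_of_neg (not_le.mp hb)]; ring
    · intro υ hD hJ
      simp only [writeNat_realVar, hJ, Finset.sum_range_succ _ k, hF]
    · nlinarith
  · intro τ hB hI
    refine Spec.le (Spec.setReal ?_) (by decide)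
    simp only [RExpr.eval, writeReal_realVar, if_true, hI, hM]
  · have : (90 * n + 24) * n ≤ 150 * (n * n) := by nlinarith
    simp only [RExpr.cost]
    nlinarith

/-- The data that do not change during a call of the procedure. -/
structure Ctx (A : Matrix (Fin n) (Fin n) ℝ) (q : Fin n) (σ : Store) : Prop where
  dim : σ.natVar 0 = n
  last : σ.natVar 3 = q
  mat : ∀ i j : Fin n, σ.realArr 1 i j = A i j
  norm : σ.realVar 0 = bigM A

theorem Ctx.congr (h : Ctx A q σ) (h0 : τ.natVar 0 = σ.natVar 0) (h1 : τ.natVar 3 = σ.natVar 3)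
    (h2 : τ.realArr 1 = σ.realArr 1) (h3 : τ.realVar 0 = σ.realVar 0) : Ctx A q τ :=
  ⟨h0.trans h.dim, h1.trans h.last, fun i j => by rw [h2, h.mat], h3.trans h.norm⟩

theorem Ctx.agree {s : Program} (h : Ctx A q σ) (hA : Agree s σ τ)
    (h0 : 0 ∉ s.natWrites ∧ 3 ∉ s.natWrites ∧ 1 ∉ s.realArrWrites ∧ 0 ∉ s.realWrites) :
    Ctx A q τ :=
  h.congr (hA.nat 0 h0.1) (hA.nat 3 h0.2.1) (hA.realArr 1 h0.2.2.1) (hA.real 0 h0.2.2.2)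

/-- The store represents the partial permutation `(P, q)`. -/
structure Rep (A : Matrix (Fin n) (Fin n) ℝ) (q : Fin n) (P : List (Fin n)) (σ : Store) :
    Prop where
  len : σ.natVar 4 = P.length
  perm : ∀ (i : ℕ) (h : i < P.length), σ.natArr 0 i = (P[i] : ℕ)
  used : ∀ i : Fin n, σ.natArr 1 i = if i ∈ remaining P q then 0 else 1
  score : ∀ i : Fin n, σ.realArr 2 0 i = score A P q i

theorem Rep.congr (h : Rep A q P σ) (h0 : τ.natVar 4 = σ.natVar 4)
    (h1 : τ.natArr 0 = σ.natArr 0) (h2 : τ.natArr 1 = σ.natArr 1)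
    (h3 : τ.realArr 2 = σ.realArr 2) : Rep A q P τ :=
  ⟨h0.trans h.len, fun i hi => by rw [h1, h.perm], fun i => by rw [h2, h.used],
    fun i => by rw [h3, h.score]⟩

theorem Rep.agree {s : Program} (h : Rep A q P σ) (hA : Agree s σ τ)
    (h0 : 4 ∉ s.natWrites ∧ 0 ∉ s.natArrWrites ∧ 1 ∉ s.natArrWrites ∧ 2 ∉ s.realArrWrites) :
    Rep A q P τ :=
  h.congr (hA.nat 4 h0.1) (hA.natArr 0 h0.2.1) (hA.natArr 1 h0.2.2.1) (hA.realArr 2 h0.2.2.2)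

/-- The update that replaces recomputation: it takes constant time per index and avoids the product
with `r`, which the machine cannot form in one step. -/
theorem score_append_singleton (A : Matrix (Fin n) (Fin n) ℝ) (P : List (Fin n))
    (q x i : Fin n) : score A (P ++ [x]) q i = score A P q i + A i x - A i q := by
  simp only [score_eq_sum, List.map_append, List.sum_append, List.map_cons, List.map_nil,
    List.sum_cons, List.sum_nil]
  ring

theorem mem_remaining_append_singleton {x i : Fin n} :
    i ∈ remaining (P ++ [x]) q ↔ i ∈ remaining P q ∧ i ≠ x := by
  simp only [mem_remaining, List.mem_append, List.mem_singleton]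
  tauto

theorem getElem_append_singleton_eq {L : List (Fin n)} {x : Fin n} {f : ℕ → ℕ}
    (hL : ∀ (i : ℕ) (h : i < L.length), f i = (L[i] : ℕ)) (hx : f L.length = x)
    (i : ℕ) (h : i < (L ++ [x]).length) : f i = ((L ++ [x])[i] : ℕ) := by
  rw [List.getElem_append]
  split_ifs with h1
  · exact hL i h1
  · have : i = L.length := by simp at h; omega
    subst this
    simpa using hx

/-- Appends the index in variable `11` to the partial permutation. -/
def pushProg : Program :=
  .seq (.setNatArr 0 (.var 4) (.var 11)) <|
  .seq (.setNatArr 1 (.var 11) (.lit 1)) <|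
  .seq (forLoop 7 (.lit 0) (.var 0) <|
    .setRealArr 2 (.lit 0) (.var 7) (.sub (.add (.arr 2 (.lit 0) (.var 7))
      (.arr 1 (.var 7) (.var 11))) (.arr 1 (.var 7) (.var 3)))) <|
  .setNat 4 (.add (.var 4) (.lit 1))

theorem pushProg_spec (hctx : Ctx A q σ) (hrep : Rep A q P σ) {x : Fin n}
    (hx : σ.natVar 11 = x) :
    Spec O pushProg σ (100 * n) (Rep A q (P ++ [x])) := by
  have hn : 1 ≤ n := x.pos
  refine Spec.le (Spec.seq (Spec.setNatArr (Spec.seq (Spec.setNatArr (Spec.seq (T' := 10)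
    (Spec.forLoop 0 n n 30
    (fun k τ => ∀ i : Fin n, τ.realArr 2 0 i =
      if (i : ℕ) < k then score A (P ++ [x]) q i else score A P q i)
    rfl (Nat.zero_le _) (by decide) (fun τ hB => (hB.nat 0 (by decide)).trans hctx.dim) ?_ ?_ ?_
    (by decide) (by decide) hn (by omega))))))) ?_
  · intro i
    simpa using hrep.score i
  · intro k τ _ hk h7 hB hI
    refine Spec.le (Spec.setRealArr ?_) (by decide)
    have h11 : τ.natVar 11 = x := (hB.nat 11 (by decide)).trans hx
    have h3 : τ.natVar 3 = q := (hB.nat 3 (by decide)).trans hctx.last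
    have hmat : ∀ i j : Fin n, τ.realArr 1 i j = A i j := by
      intro i j; rw [hB.realArr 1 (by decide)]; exact hctx.mat i j
    intro i
    simp only [NExpr.eval, RExpr.eval, h7, h11, h3, writeNat_realArr, writeRealArr_realArr_apply,
      true_and]
    by_cases hik : (i : ℕ) = k
    · subst hik
      rw [if_pos rfl, if_pos (by omega), hmat, hmat, hI i, if_neg (by omega),
        score_append_singleton]
    · rw [if_neg hik, hI i]
      simp only [show (i : ℕ) < k + 1 ↔ (i : ℕ) < k by omega]
  · intro τ hB hI
    refine Spec.le (Spec.setNat ?_) (by decide)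
    have h4 : τ.natVar 4 = P.length := (hB.nat 4 (by decide)).trans hrep.len
    have ha0 := hB.natArr 0 (by decide)
    have ha1 := hB.natArr 1 (by decide)
    refine ⟨by simp [NExpr.eval, h4], ?_, ?_, ?_⟩
    · apply getElem_append_singleton_eq
      · intro i hi
        simp only [writeNat_natArr, ha0, writeNatArr_natArr_apply, NExpr.eval, hrep.len,
          writeNatArr_natVar]
        simp [hi.ne, hrep.perm i hi]
      · simp only [writeNat_natArr, ha0, writeNatArr_natArr_apply, NExpr.eval, hrep.len,
          writeNatArr_natVar, hx]
        simp
    · intro i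
      simp only [writeNat_natArr, ha1, writeNatArr_natArr_apply, NExpr.eval, writeNatArr_natVar,
        hx, true_and, hrep.used, mem_remaining_append_singleton]
      by_cases hix : i = x
      · simp [hix]
      · have : (i : ℕ) ≠ x := fun h => hix (Fin.ext h)
        simp [hix, this]
    · intro i
      simp [hI]
  · simp only [NExpr.cost]
    nlinarith

/-- Sets up the partial permutation whose only entry is variable `2`. -/
def initProg : Program :=
  .seq (forLoop 7 (.lit 0) (.var 0) <|
    .seq (.setNatArr 1 (.var 7) (.lit 0)) (.setRealArr 2 (.lit 0) (.var 7) .zero)) <|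
  .seq (.setNatArr 1 (.var 3) (.lit 1)) <|
  .seq (.setNat 4 (.lit 0)) <|
  .seq (.setNat 11 (.var 2)) pushProg

theorem initProg_spec (hctx : Ctx A q σ) {p : Fin n} (hp : σ.natVar 2 = p) :
    Spec O initProg σ (200 * n) (Rep A q [p]) := by
  have hn : 1 ≤ n := p.pos
  refine Spec.le (Spec.seq (T' := 120 * n) (Spec.forLoop 0 n n 30
    (fun k τ => ∀ i : Fin n, (i : ℕ) < k → τ.natArr 1 i = 0 ∧ τ.realArr 2 0 i = 0)
    rfl (Nat.zero_le _) (by decide) (fun τ hB => (hB.nat 0 (by decide)).trans hctx.dim) ?_ ?_ ?_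
    (by decide) (by decide) hn (by omega))) ?_
  · intro i hi; omega
  · intro k τ _ hk h7 hB hI
    refine Spec.le (Spec.seq (Spec.setNatArr (Spec.setRealArr ?_))) (by decide)
    intro i hi
    simp only [NExpr.eval, RExpr.eval, h7, writeNat_realArr, writeRealArr_realArr_apply,
      true_and, writeNat_natArr, writeRealArr_natArr, writeNatArr_natArr_apply,
      writeNatArr_natVar, writeNatArr_realArr]
    split_ifs with h
    · simp
    · exact hI i (by omega)
  · intro τ hB hI
    have hτ := hctx.agree hB (by decide)
    refine Spec.le (Spec.seq (Spec.setNatArr (Spec.seq (Spec.setNat (Spec.seq (Spec.setNat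
      (pushProg_spec (P := []) (hτ.congr ?_ ?_ ?_ ?_) ⟨?_, ?_, ?_, ?_⟩ ?_))))))) ?_
    · simp
    · simp
    · simp
    · simp
    · simp [NExpr.eval]
    · simp
    · intro i
      have := (hI i i.isLt).1
      simp only [writeNat_natArr, writeNatArr_natArr_apply, NExpr.eval, hτ.last, mem_remaining,
        this, true_and]
      by_cases hiq : i = q
      · simp [hiq]
      · have : (i : ℕ) ≠ q := fun h => hiq (Fin.ext h)
        simp [hiq, this]
    · intro i
      simp [score, (hI i i.isLt).2]
    · simp [NExpr.eval, hB.nat 2 (by decide), hp]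
    · simp only [NExpr.cost]
      omega
  · omega

end State

/-! ### Finding the minimizers and building the argument of ALG. -/

section Selection

variable {n : ℕ} {O : Oracle} {σ τ : Store} {A : Matrix (Fin n) (Fin n) ℝ} {q : Fin n}
  {P : List (Fin n)}

/-- Computes the minimum of the scores of the remaining indices. -/
def minProg : Program :=
  .seq (.setNat 9 (.lit 0)) <|
  forLoop 7 (.lit 0) (.var 0) <|
    .ite (.and (.natEq (.arr 1 (.var 7)) (.lit 0))
        (.not (.and (.natEq (.var 9) (.lit 1)) (.realLe (.var 1) (.arr 2 (.lit 0) (.var 7))))))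
      (.seq (.setReal 1 (.arr 2 (.lit 0) (.var 7))) (.setNat 9 (.lit 1)))
      .skip

/-- The number `v` separates `minSet` from the other remaining indices. -/
def Threshold (A : Matrix (Fin n) (Fin n) ℝ) (P : List (Fin n)) (q : Fin n) (v : ℝ) : Prop :=
  ∀ i, i ∈ minSet A P q ↔ i ∈ remaining P q ∧ score A P q i ≤ v

theorem Rep.used_eq_zero_iff (h : Rep A q P σ) (i : Fin n) :
    σ.natArr 1 i = 0 ↔ i ∈ remaining P q := by
  rw [h.used]
  split_ifs with hi <;> simp [hi]

theorem minProg_spec (hctx : Ctx A q σ) (hrep : Rep A q P σ) (hne : remaining P q ≠ ∅) :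
    Spec O minProg σ (100 * n) fun τ => Threshold A P q (τ.realVar 1) := by
  have hn : 1 ≤ n := q.pos
  refine Spec.le (Spec.seq (Spec.setNat (Spec.forLoop 0 n n 50
    -- Variable `9` records whether a remaining index has been met; until then the current minimum
    -- carries no meaning, which replaces an initial value of infinity.
    (fun k τ => (τ.natVar 9 = 0 ∧ ∀ j ∈ remaining P q, ¬ (j : ℕ) < k) ∨
      (τ.natVar 9 = 1 ∧ (∃ i ∈ remaining P q, τ.realVar 1 = score A P q i) ∧
        ∀ j ∈ remaining P q, (j : ℕ) < k → τ.realVar 1 ≤ score A P q j))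
    rfl (Nat.zero_le _) (by decide) (fun τ hB => (hB.nat 0 (by decide)).trans hctx.dim) ?_ ?_ ?_
    (by decide) (by decide) hn (by omega)))) ?_
  · left
    simp [NExpr.eval]
  · intro k τ _ hk h7 hB hI
    have hrep' : Rep A q P τ := (hrep.congr (τ := σ.writeNat 9 0) (by simp) rfl rfl rfl).agree hB
      (by decide)
    have hu := hrep'.used_eq_zero_iff ⟨k, hk⟩
    have hs := hrep'.score ⟨k, hk⟩
    simp only at hu hs
    refine Spec.le (Spec.ite (fun hb => Spec.seq (Spec.setReal (Spec.setNat ?_)))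
      (fun hb => Spec.skip ?_)) (by decide)
    · simp only [BExpr.Holds, NExpr.eval, RExpr.eval, h7, hu, hs, not_and] at hb
      obtain ⟨hkr, hb⟩ := hb
      simp only [writeNat_natVar, writeReal_natVar, NExpr.eval, RExpr.eval, h7, hs,
        writeNat_realVar, writeReal_realVar]
      refine Or.inr ⟨by simp, ⟨_, hkr, by simp⟩, ?_⟩
      intro j hj hjk
      rw [if_pos trivial]
      by_cases hjk' : (j : ℕ) < k
      · rcases hI with ⟨-, hI⟩ | ⟨h1, -, hI⟩
        · exact absurd hjk' (hI j hj)
        · exact (not_le.mp (hb h1)).le.trans (hI j hj hjk')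
      · have : j = ⟨k, hk⟩ := Fin.ext (by simp only; omega)
        rw [this]
    · simp only [BExpr.Holds, NExpr.eval, RExpr.eval, h7, hu, hs] at hb
      replace hb : ⟨k, hk⟩ ∈ remaining P q →
          τ.natVar 9 = 1 ∧ τ.realVar 1 ≤ score A P q ⟨k, hk⟩ := by tauto
      simp only [writeNat_natVar, writeNat_realVar]
      rcases hI with ⟨h0, hI⟩ | ⟨h1, h2, hI⟩
      · left
        refine ⟨by simpa using h0, fun j hj hjk => ?_⟩
        have : j = ⟨k, hk⟩ := Fin.ext (by have := hI j hj; simp only; omega)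
        have := (hb (this ▸ hj)).1
        omega
      · right
        refine ⟨by simpa using h1, h2, fun j hj hjk => ?_⟩
        by_cases hjk' : (j : ℕ) < k
        · exact hI j hj hjk'
        · have : j = ⟨k, hk⟩ := Fin.ext (by simp only; omega)
          rw [this]
          exact (hb (this ▸ hj)).2
  · intro τ hB hI
    rcases hI with ⟨-, hI⟩ | ⟨-, ⟨i, hi, hv⟩, hI⟩
    · exact absurd (Finset.eq_empty_of_forall_notMem fun j hj => hI j hj j.isLt) hne
    · intro j
      rw [mem_minSet]
      constructor
      · rintro ⟨h1, h2⟩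
        exact ⟨h1, hv ▸ h2 i hi⟩
      · rintro ⟨h1, h2⟩
        exact ⟨h1, fun l hl => h2.trans (hI l hl l.isLt)⟩
  · simp only [NExpr.cost]
    omega

/-- The array `a` shows the list `L` of length `k`. -/
structure Lists (a : ℕ → ℕ) (k : ℕ) (L : List (Fin n)) : Prop where
  len : k = L.length
  entry : ∀ (i : ℕ) (h : i < L.length), a i = (L[i] : ℕ)

theorem Lists.append {a a' : ℕ → ℕ} {k k' : ℕ} {L : List (Fin n)} {x : Fin n}
    (h : Lists a k L) (hk : k' = k + 1) (ha : ∀ i < k, a' i = a i) (hx : a' k = x) :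
    Lists a' k' (L ++ [x]) := by
  obtain ⟨rfl, h2⟩ := h
  exact ⟨by simp [hk], getElem_append_singleton_eq (fun i hi => (ha i hi).trans (h2 i hi)) hx⟩

theorem take_finRange_succ {m k : ℕ} (hk : k < m) :
    (List.finRange m).take (k + 1) = (List.finRange m).take k ++ [⟨k, hk⟩] := by
  rw [List.take_succ_eq_append_getElem (by simpa using hk), List.getElem_finRange]
  rfl

theorem sort_eq_filter_finRange (K : Finset (Fin n)) :
    K.sort (· ≤ ·) = (List.finRange n).filter fun i => decide (i ∈ K) := by
  refine (Finset.sortedLT_sort K).eq_of_mem_iff ?_ (by simp)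
  exact ((List.pairwise_lt_finRange n).filter _).sortedLT

/-- The set `K` and its increasing enumeration are stored. -/
structure Sel (K : Finset (Fin n)) (σ : Store) : Prop where
  card : σ.natVar 6 = K.card
  entry : ∀ j : Fin K.card, σ.natArr 2 j = enum K j

theorem Sel.congr {K : Finset (Fin n)} (h : Sel K σ) (h0 : τ.natVar 6 = σ.natVar 6)
    (h1 : τ.natArr 2 = σ.natArr 2) : Sel K τ :=
  ⟨h0.trans h.card, fun j => by rw [h1, h.entry]⟩

theorem Sel.agree {K : Finset (Fin n)} {s : Program} (h : Sel K σ) (hA : Agree s σ τ)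
    (h0 : 6 ∉ s.natWrites ∧ 2 ∉ s.natArrWrites) : Sel K τ :=
  h.congr (hA.nat 6 h0.1) (hA.natArr 2 h0.2)

theorem Lists.sel {K : Finset (Fin n)}
    (h : Lists (σ.natArr 2) (σ.natVar 6) (K.sort (· ≤ ·))) : Sel K σ := by
  refine ⟨by simpa using h.len, fun j => ?_⟩
  rw [h.entry j (by simp), enum, Finset.orderEmbOfFin_apply]
  rfl

/-- Enumerates the set `K`. -/
def collectProg : Program :=
  .seq (.setNat 6 (.lit 0)) <|
  forLoop 7 (.lit 0) (.var 0) <|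
    .ite (.and (.natEq (.arr 1 (.var 7)) (.lit 0)) (.realLe (.arr 2 (.lit 0) (.var 7)) (.var 1)))
      (.seq (.setNatArr 2 (.var 6) (.var 7)) (.setNat 6 (.add (.var 6) (.lit 1))))
      .skip

theorem collectProg_spec (hctx : Ctx A q σ) (hrep : Rep A q P σ)
    (hth : Threshold A P q (σ.realVar 1)) :
    Spec O collectProg σ (100 * n) (Sel (minSet A P q)) := by
  have hn : 1 ≤ n := q.pos
  refine Spec.le (Spec.seq (Spec.setNat (Spec.forLoop 0 n n 50
    (fun k τ => Lists (τ.natArr 2) (τ.natVar 6)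
      (((List.finRange n).take k).filter fun i => decide (i ∈ minSet A P q)))
    rfl (Nat.zero_le _) (by decide) (fun τ hB => (hB.nat 0 (by decide)).trans hctx.dim) ?_ ?_ ?_
    (by decide) (by decide) hn (by omega)))) ?_
  · exact ⟨by simp [NExpr.eval], by simp⟩
  · intro k τ _ hk h7 hB hI
    have hrep' : Rep A q P τ := (hrep.congr (τ := σ.writeNat 6 0) (by simp) rfl rfl rfl).agree hB
      (by decide)
    have hv : τ.realVar 1 = σ.realVar 1 := hB.real 1 (by decide)
    have hu := hrep'.used_eq_zero_iff ⟨k, hk⟩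
    have hs := hrep'.score ⟨k, hk⟩
    have ht := hth ⟨k, hk⟩
    simp only at hu hs
    refine Spec.le (Spec.ite (fun hb => Spec.seq (Spec.setNatArr (Spec.setNat ?_)))
      (fun hb => Spec.skip ?_)) (by decide)
    · simp only [BExpr.Holds, NExpr.eval, RExpr.eval, h7, hu, hs, hv, ← ht] at hb
      rw [take_finRange_succ hk, List.filter_append]
      simp only [hb, List.filter_cons, decide_true, if_true, List.filter_nil]
      refine hI.append (by simp [NExpr.eval]) ?_ ?_
      · intro i hi
        simp [NExpr.eval, hi.ne]
      · simp [NExpr.eval, h7]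
    · simp only [BExpr.Holds, NExpr.eval, RExpr.eval, h7, hu, hs, hv, ← ht] at hb
      rw [take_finRange_succ hk, List.filter_append]
      simpa [hb] using hI
  · intro τ hB hI
    apply Lists.sel
    rw [sort_eq_filter_finRange]
    simpa [List.take_of_length_le] using hI
  · simp only [NExpr.cost]
    omega

/-- Copies the principal submatrix of `K` to the argument of ALG. -/
def copyProg : Program :=
  forLoop 7 (.lit 0) (.var 6) <| forLoop 8 (.lit 0) (.var 6) <|
    .setRealArr 3 (.var 7) (.var 8) (.arr 1 (.arr 2 (.var 7)) (.arr 2 (.var 8)))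

theorem copyProg_spec {K : Finset (Fin n)} (hctx : Ctx A q σ) (hsel : Sel K σ) (hK : 1 ≤ K.card) :
    Spec O copyProg σ (100 * K.card * K.card) fun τ =>
      ∀ i j : Fin K.card, τ.realArr 3 i j = A (enum K i) (enum K j) := by
  refine Spec.le (Spec.forLoop 0 K.card K.card (60 * K.card)
    (fun k τ => ∀ i j : Fin K.card, (i : ℕ) < k → τ.realArr 3 i j = A (enum K i) (enum K j))
    rfl (Nat.zero_le _) (by decide) (fun τ hB => (hB.nat 6 (by decide)).trans hsel.card) ?_ ?_ ?_
    (by decide) (by decide) hK (by omega)) ?_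
  · intro i j hi; omega
  · intro k τ _ hk h7 hB hI
    refine Spec.le (Spec.forLoop 0 K.card K.card 30
      (fun l τ => ∀ i j : Fin K.card, (i : ℕ) < k ∨ ((i : ℕ) = k ∧ (j : ℕ) < l) →
        τ.realArr 3 i j = A (enum K i) (enum K j))
      rfl (Nat.zero_le _) (by decide) ?_ ?_ ?_ ?_ (by decide) (by decide) hK (by omega)) ?_
    · intro υ hD
      exact (hD.nat 6 (by decide)).trans ((hB.nat 6 (by decide)).trans hsel.card)
    · intro i j hij
      exact hI i j (by omega)
    · intro l υ _ hl h8 hD hJ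
      refine Spec.le (Spec.setRealArr ?_) (by decide)
      have h7' : υ.natVar 7 = k := (hD.nat 7 (by decide)).trans h7
      have hctx' := (hctx.agree hB (by decide)).agree hD (by decide)
      have hsel' := (hsel.agree hB (by decide)).agree hD (by decide)
      intro i j hij
      simp only [NExpr.eval, RExpr.eval, h7', h8, writeNat_realArr,
        writeRealArr_realArr_apply, true_and]
      split_ifs with h
      · rw [← h.1, ← h.2, hsel'.entry, hsel'.entry, hctx'.mat]
      · exact hJ i j (by omega)
    · intro υ hD hJ i j hi
      exact hJ i j (by omega)
    · nlinarith
  · intro τ hB hI i j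
    exact hI i j i.isLt
  · nlinarith

/-- Appends the border of the matrix `D`. -/
def borderProg : Program :=
  .seq (forLoop 7 (.lit 0) (.var 6) <|
    .seq (.setReal 2 (.var 0)) <|
    .seq (forLoop 8 (.lit 0) (.var 0) <|
      .ite (.and (.natEq (.arr 1 (.var 8)) (.lit 0))
          (.not (.realLe (.arr 2 (.lit 0) (.var 8)) (.var 1))))
        (.setReal 2 (.add (.var 2) (.arr 1 (.arr 2 (.var 7)) (.var 8))))
        .skip) <|
    .seq (.setRealArr 3 (.var 7) (.var 6) (.var 2)) (.setRealArr 3 (.var 6) (.var 7) (.var 2))) <|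
  .setRealArr 3 (.var 6) (.var 6) (.var 0)

theorem borderProg_spec (hctx : Ctx A q σ) (hrep : Rep A q P σ)
    (hth : Threshold A P q (σ.realVar 1)) (hsel : Sel (minSet A P q) σ)
    (hK : 1 ≤ (minSet A P q).card)
    (hcopy : ∀ i j : Fin (minSet A P q).card, σ.realArr 3 i j = A (enum _ i) (enum _ j)) :
    Spec O borderProg σ (200 * n * (minSet A P q).card) fun τ =>
      ∀ i j, τ.realArr 3 (i : Fin _) (j : Fin _) =
        matrixD A (remaining P q) (minSet A P q) i j := by
  have hn : 1 ≤ n := q.pos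
  set K := minSet A P q with hKdef
  -- The summand as the program sees it: an unused index whose score exceeds the threshold is
  -- exactly an element of `I' \ K`, and all others contribute zero.
  set f : ℕ → ℕ → ℝ := fun i l => if σ.natArr 1 l = 0 ∧ ¬ σ.realArr 2 0 l ≤ σ.realVar 1
    then σ.realArr 1 (σ.natArr 2 i) l else 0 with hf
  have hsum : ∀ i : Fin K.card, ∑ l ∈ Finset.range n, f i l =
      ∑ l ∈ remaining P q \ K, A (enum K i) l := by
    intro i
    rw [Finset.sum_range]
    have h1 : ∀ l : Fin n, f i l = if l ∈ remaining P q \ K then A (enum K i) l else 0 := by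
      intro l
      simp only [hf, hrep.used_eq_zero_iff, hrep.score, hsel.entry, hctx.mat, Finset.mem_sdiff,
        hKdef, hth l, not_and]
      by_cases hl : l ∈ remaining P q <;> simp [hl]
    simp only [h1]
    rw [← Finset.sum_filter]
    congr 1
    ext l
    simp
  refine Spec.le (Spec.seq (T' := 10) (Spec.forLoop 0 K.card K.card (120 * n)
    (fun k τ => (∀ i j : Fin K.card, τ.realArr 3 i j = A (enum K i) (enum K j)) ∧
      ∀ i : Fin K.card, (i : ℕ) < k →
        τ.realArr 3 i K.card = bigM A + ∑ l ∈ Finset.range n, f i l ∧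
        τ.realArr 3 K.card i = bigM A + ∑ l ∈ Finset.range n, f i l)
    rfl (Nat.zero_le _) (by decide) (fun τ hB => (hB.nat 6 (by decide)).trans hsel.card) ?_ ?_ ?_
    (by decide) (by decide) hK (by omega))) ?_
  · exact ⟨hcopy, fun i hi => by omega⟩
  · intro k τ _ hk h7 hB hI
    have hM : τ.realVar 0 = bigM A := (hB.real 0 (by decide)).trans hctx.norm
    refine Spec.le (Spec.seq (Spec.setReal (Spec.seq (T' := 20) (Spec.forLoop 0 n n 50
      (fun m υ => υ.realVar 2 = bigM A + ∑ l ∈ Finset.range m, f k l)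
      rfl (Nat.zero_le _) (by decide) ?_ ?_ ?_ ?_ (by decide) (by decide) hn (by omega))))) ?_
    · intro υ hD
      exact (hD.nat 0 (by decide)).trans ((hB.nat 0 (by decide)).trans hctx.dim)
    · simp [RExpr.eval, hM]
    · intro l υ _ hl h8 hD hJ
      have h7' : υ.natVar 7 = k := (hD.nat 7 (by decide)).trans h7
      have e1 : υ.natArr 1 = σ.natArr 1 := (hD.natArr 1 (by decide)).trans (hB.natArr 1 (by decide))
      have e2 : υ.natArr 2 = σ.natArr 2 := (hD.natArr 2 (by decide)).trans (hB.natArr 2 (by decide))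
      have e3 : υ.realArr 1 = σ.realArr 1 :=
        (hD.realArr 1 (by decide)).trans (hB.realArr 1 (by decide))
      have e4 : υ.realArr 2 = σ.realArr 2 :=
        (hD.realArr 2 (by decide)).trans (hB.realArr 2 (by decide))
      have e5 : υ.realVar 1 = σ.realVar 1 := (hD.real 1 (by decide)).trans (hB.real 1 (by decide))
      refine Spec.le (Spec.ite (fun hb => Spec.setReal ?_) (fun hb => Spec.skip ?_)) (by decide)
      all_goals
        simp only [BExpr.Holds, NExpr.eval, RExpr.eval, h8, e1, e4, e5] at hb
        rw [Finset.sum_range_succ _ l]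
      · simp only [NExpr.eval, RExpr.eval, h7', h8, e2, e3, writeNat_realVar, writeReal_realVar,
          if_true, hJ, hf]
        rw [if_pos hb, add_assoc]
      · simp only [writeNat_realVar, hJ, hf]
        rw [if_neg hb, add_zero]
    · intro υ hD hJ
      have h7' : υ.natVar 7 = k := (hD.nat 7 (by decide)).trans h7
      have h6' : υ.natVar 6 = K.card :=
        (hD.nat 6 (by decide)).trans ((hB.nat 6 (by decide)).trans hsel.card)
      have e3 : υ.realArr 3 = τ.realArr 3 := hD.realArr 3 (by decide)
      refine Spec.le (Spec.seq (Spec.setRealArr (Spec.setRealArr ?_))) (by decide)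
      simp only [NExpr.eval, RExpr.eval, writeNat_realArr, writeRealArr_realArr_apply, true_and,
        writeRealArr_natVar, writeRealArr_realVar, h6', h7', hJ, e3]
      refine ⟨fun i j => ?_, fun i hi => ?_⟩
      · have := i.isLt
        have := j.isLt
        rw [if_neg (by omega), if_neg (by omega), hI.1]
      · by_cases hik : (i : ℕ) = k
        · subst hik
          have := i.isLt
          simp
        · have := hI.2 i (by omega)
          have := i.isLt
          simp [hik, this.ne, hI.2 i (by omega)]
    · simp only [RExpr.cost]
      omega
  · intro τ hB hI
    refine Spec.le (Spec.setRealArr ?_) (by decide)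
    have h6' : τ.natVar 6 = K.card := (hB.nat 6 (by decide)).trans hsel.card
    have hM : τ.realVar 0 = bigM A := (hB.real 0 (by decide)).trans hctx.norm
    intro i j
    simp only [NExpr.eval, RExpr.eval, writeRealArr_realArr_apply, true_and, h6', hM]
    induction i using Fin.lastCases with
    | last =>
      induction j using Fin.lastCases with
      | last => simp [matrixD]
      | cast j =>
        have := j.isLt
        rw [if_neg (by simp; omega)]
        simpa [matrixD, hsum] using (hI.2 j j.isLt).2
    | cast i =>
      have := i.isLt
      rw [if_neg (by simp; omega)]
      induction j using Fin.lastCases with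
      | last => simpa [matrixD, hsum] using (hI.2 i i.isLt).1
      | cast j => simpa [matrixD] using hI.1 i j
  · have : n ≤ n * K.card := Nat.le_mul_of_pos_right n hK
    nlinarith

end Selection

/-! ### Computing the next block in the three cases. -/

section Block

variable {n : ℕ} {O : Oracle} {σ τ : Store} {A : Matrix (Fin n) (Fin n) ℝ} {q : Fin n}
  {P : List (Fin n)}

/-- The store shows the outcome `o` of `nextBlock`. -/
def BlockOut (o : Option (List (Fin n))) (σ : Store) : Prop :=
  (o = none ∧ σ.natVar 5 = 0) ∨
    ∃ B, o = some B ∧ σ.natVar 5 = 1 ∧ Lists (σ.natArr 4) (σ.natVar 10) B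

/-- The block that consists of the only element of `K`. -/
def singleProg : Program :=
  .seq (.setNatArr 4 (.lit 0) (.arr 2 (.lit 0))) <|
  .seq (.setNat 10 (.lit 1)) (.setNat 5 (.lit 1))

theorem singleProg_spec {K : Finset (Fin n)} (hsel : Sel K σ) (hK : K.card = 1) :
    Spec O singleProg σ 20 (BlockOut (some (K.sort (· ≤ ·)))) := by
  refine Spec.le (Spec.seq (Spec.setNatArr (Spec.seq (Spec.setNat (Spec.setNat ?_)))))
    (by decide)
  refine Or.inr ⟨_, rfl, by simp [NExpr.eval], by simp [NExpr.eval, hK], ?_⟩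
  intro i hi
  have hi0 : i = 0 := by
    rw [Finset.length_sort, hK] at hi
    omega
  subst hi0
  have := hsel.entry ⟨0, by omega⟩
  rw [enum, Finset.orderEmbOfFin_apply] at this
  simpa [NExpr.eval] using this

/-- The block in the case that `K` contains all remaining indices. -/
def finalProg : Program :=
  .seq copyProg <|
  .seq (.callAlg 3 (.var 6) 5 3) <|
  .ite (.natEq (.var 5) (.lit 1))
    (.seq (.setNat 10 (.var 6)) <|
      forLoop 7 (.lit 0) (.var 6) (.setNatArr 4 (.var 7) (.arr 2 (.arr 3 (.var 7)))))
    .skip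

theorem finalProg_spec {K : Finset (Fin n)} {a : ℕ} (hO : O.QuadraticTime a) (hA : A.IsSymm)
    (hctx : Ctx A q σ) (hsel : Sel K σ) (hK : 1 ≤ K.card) :
    Spec O finalProg σ ((300 + a) * K.card * K.card)
      (BlockOut ((O.answer K.card (A.submatrix (enum K) (enum K))).map
        fun ψ => List.ofFn fun i => enum K (ψ i))) := by
  have htime := hO K.card (A.submatrix (enum K) (enum K)) (hA.submatrix _)
  refine Spec.le (Spec.seq (T' := a * K.card ^ 2 + 10 + 100 * K.card)
    ((copyProg_spec hctx hsel hK).imp ?_)) ?_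
  · intro τ hB hcopy
    have hsel' := hsel.agree hB (by decide)
    refine Spec.seq (T := a * K.card ^ 2 + 3) (T' := 7 + 100 * K.card)
      (Spec.callAlg (A := A.submatrix (enum K) (enum K)) ?_ hcopy ?_ ?_) |>.le (by omega)
    · exact hsel'.card
    · simp only [NExpr.cost]; omega
    · intro υ hans hD
      have hsel'' := hsel'.agree hD (by decide)
      refine Spec.le (Spec.ite (T := 2 + (30 + 24) * K.card) (fun hb => ?_)
          (fun hb => Spec.skip ?_)) ?_
      · simp only [BExpr.Holds, NExpr.eval] at hb
        rcases hans with ⟨-, h0⟩ | ⟨ψ, hψ, -, hψ'⟩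
        · omega
        refine Spec.le (Spec.seq (Spec.setNat (Spec.forLoop 0 K.card K.card 30
          (fun k τ => ∀ i : Fin K.card, (i : ℕ) < k → τ.natArr 4 i = enum K (ψ i))
          rfl (Nat.zero_le _) (by decide) ?_ ?_ ?_ ?_ (by decide) (by decide) hK (by omega))))
          (by simp only [NExpr.cost]; omega)
        · intro ω hE
          exact (hE.nat 6 (by decide)).trans hsel''.card
        · intro i hi; omega
        · intro k ω _ hk h7 hE hI
          refine Spec.le (Spec.setNatArr ?_) (by decide)
          have e2 : ω.natArr 2 = υ.natArr 2 := hE.natArr 2 (by decide)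
          have e3 : ω.natArr 3 = υ.natArr 3 := hE.natArr 3 (by decide)
          intro i hi
          simp only [NExpr.eval, writeNat_natArr, writeNatArr_natArr_apply, true_and, h7, e2, e3]
          split_ifs with h
          · rw [← h, hψ', hsel''.entry]
          · exact hI i (by omega)
        · intro ω hE hI
          have e6 : ω.natVar 10 = K.card := by
            rw [hE.nat 10 (by decide)]
            simpa [NExpr.eval] using hsel''.card
          have e5 : ω.natVar 5 = 1 := by
            rw [hE.nat 5 (by decide)]
            simpa using hb
          refine Or.inr ⟨_, by rw [hψ]; rfl, e5, by simp [e6], ?_⟩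
          intro i hi
          simpa using hI ⟨i, by simpa using hi⟩ (by simpa using hi)
      · simp only [BExpr.Holds, NExpr.eval] at hb
        rcases hans with ⟨h, h0⟩ | ⟨ψ, -, h1, -⟩
        · exact Or.inl ⟨by rw [h]; rfl, h0⟩
        · exact absurd h1 hb
      · simp only [BExpr.cost, NExpr.cost]
        omega
  · nlinarith

/-- The block in the case that an index outside `K` remains. -/
def borderedProg : Program :=
  .seq copyProg <|
  .seq borderProg <|
  .seq (.callAlg 3 (.add (.var 6) (.lit 1)) 5 3) <|
  .ite (.natEq (.var 5) (.lit 1))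
    (.seq (.setNat 10 (.lit 0)) <|
      forLoop 7 (.lit 0) (.add (.var 6) (.lit 1)) <|
        .seq (.ite (.natEq (.arr 3 (.var 6)) (.var 6))
          (.setNat 11 (.arr 3 (.var 7)))
          (.setNat 11 (.arr 3 (.sub (.var 6) (.var 7))))) <|
        .ite (.natLt (.var 11) (.var 6))
          (.seq (.setNatArr 4 (.var 10) (.arr 2 (.var 11)))
            (.setNat 10 (.add (.var 10) (.lit 1))))
          .skip)
    .skip

/-- Lets the program read the oriented permutation from the answer array without storing a reversed
copy. -/
theorem orient_val {k : ℕ} (ψ : Equiv.Perm (Fin (k + 1))) {f : ℕ → ℕ}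
    (hf : ∀ i : Fin (k + 1), f i = (ψ i : ℕ)) (i : Fin (k + 1)) :
    (orient ψ i : ℕ) = if f k = k then f i else f (k - i) := by
  have h1 := hf (Fin.last k)
  rw [Fin.val_last] at h1
  have h2 : ψ (Fin.last k) = Fin.last k ↔ f k = k := by
    rw [h1, Fin.ext_iff, Fin.val_last]
  unfold orient
  simp only [h2]
  split_ifs with h
  · exact (hf i).symm
  · have h3 := hf i.rev
    rw [Fin.val_rev] at h3
    simp only [Equiv.trans_apply, Fin.revPerm_apply, ← h3]
    congr 1
    omega

theorem borderedProg_spec {a : ℕ} (hO : O.QuadraticTime a) (hA : A.IsSymm)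
    (hctx : Ctx A q σ) (hrep : Rep A q P σ) (hth : Threshold A P q (σ.realVar 1))
    (hsel : Sel (minSet A P q) σ) (hK : 1 ≤ (minSet A P q).card) :
    Spec O borderedProg σ ((900 + 4 * a) * n * (minSet A P q).card)
      (BlockOut ((O.answer ((minSet A P q).card + 1)
        (matrixD A (remaining P q) (minSet A P q))).map (blockOf (minSet A P q)))) := by
  set K := minSet A P q with hKdef
  have hn : 1 ≤ n := q.pos
  have hKn : K.card ≤ n := by simpa using Finset.card_le_univ K
  have htime := hO (K.card + 1) (matrixD A (remaining P q) K) (matrixD_symm hA _ _)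
  refine Spec.le (Spec.seq (T' := 200 * n * K.card + (a * (K.card + 1) ^ 2 + 30 + 200 * K.card))
    ((copyProg_spec hctx hsel hK).imp ?_)) ?_
  · intro τ hB hcopy
    have hsel1 := hsel.agree hB (by decide)
    have hth1 : Threshold A P q (τ.realVar 1) := by rw [hB.real 1 (by decide)]; exact hth
    refine Spec.seq ((borderProg_spec (hctx.agree hB (by decide)) (hrep.agree hB (by decide))
      hth1 hsel1 hK hcopy).imp ?_)
    intro υ hD hmat
    have hsel2 := hsel1.agree hD (by decide)
    refine Spec.seq (T := a * (K.card + 1) ^ 2 + 10) (T' := 20 + 200 * K.card)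
      (Spec.callAlg (A := matrixD A (remaining P q) K) ?_ hmat ?_ ?_) |>.le (by omega)
    · simp only [NExpr.eval, hsel2.card, hKdef]
    · simp only [NExpr.cost]; omega
    · intro ω hans hE
      have hsel3 : Sel K ω := hsel2.agree hE (by decide)
      refine Spec.le (Spec.ite (T := 2 + (60 + 24) * (K.card + 1)) (fun hb => ?_)
          (fun hb => Spec.skip ?_)) ?_
      · simp only [BExpr.Holds, NExpr.eval] at hb
        rcases hans with ⟨-, h0⟩ | ⟨ψ, hψ, -, hψ'⟩
        · omega
        have hor := orient_val ψ hψ'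
        refine Spec.le (Spec.seq (Spec.setNat (Spec.forLoop 0 (K.card + 1) (K.card + 1) 60
          (fun k τ => Lists (τ.natArr 4) (τ.natVar 10)
            (((List.finRange (K.card + 1)).take k).filterMap fun i =>
              Fin.lastCases (motive := fun _ => Option (Fin n)) none
                (fun j => some (enum K j)) (orient ψ i)))
          rfl (Nat.zero_le _) (by decide) ?_ ?_ ?_ ?_ (by decide) (by decide) (by omega)
          (by omega)))) (by simp only [NExpr.cost]; omega)
        · intro η hF
          simp only [NExpr.eval]
          rw [hF.nat 6 (by decide)]
          simp [hsel3.card]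
        · exact ⟨by simp [NExpr.eval], by simp⟩
        · intro k η _ hk h7 hF hI
          have e2 : η.natArr 2 = ω.natArr 2 := hF.natArr 2 (by decide)
          have e3 : η.natArr 3 = ω.natArr 3 := hF.natArr 3 (by decide)
          have e6 : η.natVar 6 = K.card := by
            rw [hF.nat 6 (by decide)]
            simpa using hsel3.card
          have hork := hor ⟨k, hk⟩
          simp only at hork
          -- Both orientations continue with the same code, so the append step is verified once, for
          -- any store whose variable `11` holds the oriented value. The appended index is
          -- recognized by its value `K.card` and skipped.
          have hstep : ∀ ρ : Store, ρ.natVar 11 = (orient ψ ⟨k, hk⟩ : ℕ) →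
              ρ.natVar 6 = K.card → ρ.natVar 10 = η.natVar 10 → ρ.natArr = η.natArr →
              Spec O (.ite (.natLt (.var 11) (.var 6))
                (.seq (.setNatArr 4 (.var 10) (.arr 2 (.var 11)))
                  (.setNat 10 (.add (.var 10) (.lit 1)))) .skip) ρ 20 fun τ =>
                Lists ((τ.writeNat 7 (k + 1)).natArr 4) ((τ.writeNat 7 (k + 1)).natVar 10)
                  (((List.finRange (K.card + 1)).take (k + 1)).filterMap fun i =>
                    Fin.lastCases (motive := fun _ => Option (Fin n)) none
                      (fun j => some (enum K j)) (orient ψ i)) := by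
            intro ρ g11 g6 g10 g4
            rw [take_finRange_succ hk, List.filterMap_append]
            refine Spec.le (Spec.ite (fun hc => Spec.seq (Spec.setNatArr (Spec.setNat ?_)))
              (fun hc => Spec.skip ?_)) (by decide)
            · simp only [BExpr.Holds, NExpr.eval, g11, g6] at hc
              induction hlast : orient ψ ⟨k, hk⟩ using Fin.lastCases with
              | last => rw [hlast, Fin.val_last] at hc; omega
              | cast j =>
                simp only [List.filterMap_cons, hlast, Fin.lastCases_castSucc,
                  List.filterMap_nil]
                have g11' : ρ.natVar 11 = j := by rw [g11, hlast]; rfl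
                refine hI.append (by simp [NExpr.eval, g10]) ?_ ?_
                · intro i hi
                  simp [NExpr.eval, g10, g4, hi.ne]
                · simp [NExpr.eval, g10, g4, g11', e2, hsel3.entry]
            · simp only [BExpr.Holds, NExpr.eval, g11, g6] at hc
              induction hlast : orient ψ ⟨k, hk⟩ using Fin.lastCases with
              | last => simpa [hlast, g10, g4] using hI
              | cast j =>
                have := j.isLt
                rw [hlast, Fin.val_castSucc] at hc
                omega
          refine Spec.le (Spec.seq (T' := 20) (Spec.ite (fun hc => Spec.setNat ?_)
            (fun hc => Spec.setNat ?_))) (by decide)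
          all_goals
            simp only [BExpr.Holds, NExpr.eval, e3, e6] at hc
            refine hstep _ ?_ (by simp [e6]) (by simp) (by simp)
          · simp [NExpr.eval, e3, h7, hork, hc]
          · simp [NExpr.eval, e3, e6, h7, hork, hc]
        · intro η hF hI
          have e5 : η.natVar 5 = 1 := by
            rw [hF.nat 5 (by decide)]
            simpa using hb
          refine Or.inr ⟨_, by rw [hψ]; rfl, e5, ?_⟩
          simpa only [blockOf, List.take_of_length_le (List.length_finRange).le] using hI
      · simp only [BExpr.Holds, NExpr.eval] at hb
        rcases hans with ⟨h, h0⟩ | ⟨ψ, -, h1, -⟩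
        · exact Or.inl ⟨by rw [h]; rfl, h0⟩
        · exact absurd h1 hb
      · simp only [BExpr.cost, NExpr.cost]
        omega
  · have h1 : K.card * K.card ≤ n * K.card := Nat.mul_le_mul_right _ hKn
    have h2 : K.card ≤ n * K.card := Nat.le_mul_of_pos_left _ hn
    -- This is the source of the factor `4` in front of `a`; it uses `1 ≤ K.card ≤ n`.
    have h3 : (K.card + 1) ^ 2 ≤ 4 * (n * K.card) := by nlinarith
    have h4 : a * (K.card + 1) ^ 2 ≤ a * (4 * (n * K.card)) := Nat.mul_le_mul_left _ h3
    nlinarith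

/-- The block of one round. -/
def blockProg : Program :=
  .ite (.natEq (.var 6) (.lit 1)) singleProg <|
  .ite (.natEq (.add (.add (.var 6) (.var 4)) (.lit 1)) (.var 0)) finalProg borderedProg

theorem blockProg_spec {a : ℕ} (hO : O.QuadraticTime a) (hA : A.IsSymm)
    (hctx : Ctx A q σ) (hrep : Rep A q P σ) (hth : Threshold A P q (σ.realVar 1))
    (hsel : Sel (minSet A P q) σ) (hK : 1 ≤ (minSet A P q).card) :
    Spec O blockProg σ ((1300 + 5 * a) * n * (minSet A P q).card)
      (BlockOut (nextBlock O A q P)) := by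
  have hn : 1 ≤ n := q.pos
  have hKn : (minSet A P q).card ≤ n := by simpa using Finset.card_le_univ (minSet A P q)
  unfold nextBlock
  dsimp only
  refine Spec.le (Spec.ite (fun h1 => ?_) (T := 20) (fun h1 => Spec.ite (fun h2 => ?_)
    (T := (300 + a) * (minSet A P q).card * (minSet A P q).card)
    (T' := (900 + 4 * a) * n * (minSet A P q).card) (fun h2 => ?_))) ?_
  · simp only [BExpr.Holds, NExpr.eval, hsel.card] at h1
    rw [if_pos h1]
    exact singleProg_spec hsel h1
  · simp only [BExpr.Holds, NExpr.eval, hsel.card, hrep.len, hctx.dim] at h1 h2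
    rw [if_neg h1, if_pos h2]
    exact finalProg_spec hO hA hctx hsel hK
  · simp only [BExpr.Holds, NExpr.eval, hsel.card, hrep.len, hctx.dim] at h1 h2
    rw [if_neg h1, if_neg h2]
    exact borderedProg_spec hO hA hctx hrep hth hsel hK
  · simp only [BExpr.cost, NExpr.cost]
    have h1 : (minSet A P q).card * (minSet A P q).card ≤ n * (minSet A P q).card :=
      Nat.mul_le_mul_right _ hKn
    have h2 : 1 ≤ n * (minSet A P q).card := Nat.mul_pos hn hK
    have h3 : a * ((minSet A P q).card * (minSet A P q).card) ≤ a * (n * (minSet A P q).card) :=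
      Nat.mul_le_mul_left _ h1
    nlinarith

end Block

/-! ### The rounds of the procedure and the test of the adjacent condition. -/

section Check

variable {n : ℕ} {O : Oracle} {σ τ : Store} {A : Matrix (Fin n) (Fin n) ℝ} {q : Fin n}
  {P : List (Fin n)}

/-- Appends the current block to the partial permutation. -/
def appendProg : Program :=
  forLoop 8 (.lit 0) (.var 10) (.seq (.setNat 11 (.arr 4 (.var 8))) pushProg)

theorem appendProg_spec (hctx : Ctx A q σ) (hrep : Rep A q P σ) {B : List (Fin n)}
    (hB : Lists (σ.natArr 4) (σ.natVar 10) B) (hlen : 1 ≤ B.length) :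
    Spec O appendProg σ (200 * n * B.length) (Rep A q (P ++ B)) := by
  have hn : 1 ≤ n := q.pos
  refine Spec.le (Spec.forLoop 0 B.length B.length (100 * n + 10)
    (fun k τ => Rep A q (P ++ B.take k) τ)
    rfl (Nat.zero_le _) (by decide) (fun τ hD => (hD.nat 10 (by decide)).trans hB.len) ?_ ?_ ?_
    (by decide) (by decide) hlen (by omega)) ?_
  · rw [List.take_zero, List.append_nil]
    exact hrep.congr (by simp) rfl rfl rfl
  · intro k τ _ hk h8 hD hI
    have hctx' := hctx.agree hD (by decide)
    refine Spec.le (Spec.seq (Spec.setNat ((pushProg_spec (A := A) (q := q) (x := B[k]) (P := P ++ B.take k)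
      ?_ ?_ ?_).imp ?_))) ?_
    · exact hctx'.congr (by simp) (by simp) rfl rfl
    · exact hI.congr (by simp) rfl rfl rfl
    · simp only [writeNat_natVar, if_true, NExpr.eval, h8]
      rw [hD.natArr 4 (by decide)]
      exact hB.entry k hk
    · intro υ hE hR
      rw [List.append_assoc, ← List.take_succ_eq_append_getElem hk] at hR
      exact hR.congr (by simp) rfl rfl rfl
    · simp only [NExpr.cost]; omega
  · intro τ hD hI
    simpa using hI
  · nlinarith

/-- One round of the procedure. -/
def roundProg : Program :=
  .seq minProg <| .seq collectProg <| .seq blockProg <|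
  .ite (.natEq (.var 5) (.lit 1)) appendProg .skip

/-- The linear scans for the minimum and for `K` are also charged to `n * K.card`, which is possible
because `K` is non-empty. -/
theorem roundProg_spec {a : ℕ} (hO : O.QuadraticTime a) (hA : A.IsSymm)
    (hctx : Ctx A q σ) (hrep : Rep A q P σ) (hne : remaining P q ≠ ∅) :
    Spec O roundProg σ ((1800 + 5 * a) * n * (minSet A P q).card) fun τ =>
      (nextBlock O A q P = none ∧ τ.natVar 5 = 0) ∨
        ∃ B, nextBlock O A q P = some B ∧ τ.natVar 5 = 1 ∧ Rep A q (P ++ B) τ := by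
  have hn : 1 ≤ n := q.pos
  have hK : 1 ≤ (minSet A P q).card := (minSet_nonempty A P q hne).card_pos
  have hnK : n ≤ n * (minSet A P q).card := Nat.le_mul_of_pos_right n hK
  refine Spec.le (Spec.seq (T' := 100 * n + ((1300 + 5 * a) * n * (minSet A P q).card +
    (200 * n * (minSet A P q).card + 10))) ((minProg_spec hctx hrep hne).imp ?_)) ?_
  · intro τ hB hth
    have hctx1 := hctx.agree hB (by decide)
    have hrep1 := hrep.agree hB (by decide)
    refine Spec.seq ((collectProg_spec hctx1 hrep1 hth).imp ?_)
    intro υ hD hsel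
    have hctx2 := hctx1.agree hD (by decide)
    have hrep2 := hrep1.agree hD (by decide)
    have hth2 : Threshold A P q (υ.realVar 1) := by rw [hD.real 1 (by decide)]; exact hth
    refine Spec.seq ((blockProg_spec hO hA hctx2 hrep2 hth2 hsel hK).imp ?_)
    intro ω hE hout
    have hctx3 := hctx2.agree hE (by decide)
    have hrep3 := hrep2.agree hE (by decide)
    refine Spec.le (Spec.ite (T := 200 * n * (minSet A P q).card) (fun hb => ?_)
      (fun hb => Spec.skip ?_)) (by simp only [BExpr.cost, NExpr.cost]; omega)
    · simp only [BExpr.Holds, NExpr.eval] at hb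
      rcases hout with ⟨-, h0⟩ | ⟨B, hB', -, hL⟩
      · omega
      have hlen := length_nextBlock hB'
      rw [← hlen]
      refine (appendProg_spec hctx3 hrep3 hL (by omega)).imp ?_
      intro η hF hR
      exact Or.inr ⟨B, hB', (hF.nat 5 (by decide)).trans hb, hR⟩
    · simp only [BExpr.Holds, NExpr.eval] at hb
      rcases hout with ⟨h, h0⟩ | ⟨B, -, h1, -⟩
      · exact Or.inl ⟨h, h0⟩
      · exact absurd h1 hb
  · nlinarith

theorem Spec.loopDone {b : BExpr} {s : Program} {Q : Store → Prop} (hb : ¬ b.Holds σ) (h : Q σ) :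
    Spec O (.loop b s) σ (b.cost + 1) Q := ⟨_, _, Exec.loopDone hb, le_rfl, h⟩

theorem Spec.loopStep {b : BExpr} {s : Program} {T T' : ℕ} {Q : Store → Prop}
    (hb : b.Holds σ) (h : Spec O s σ T fun τ => Spec O (.loop b s) τ T' Q) :
    Spec O (.loop b s) σ (b.cost + T + T' + 1) Q := by
  obtain ⟨t, τ, h1, h2, t', υ, h3, h4, h5⟩ := h
  exact ⟨_, υ, Exec.loopStep hb h1 h3, by omega, h5⟩

/-- The rounds of the procedure. -/
def roundsProg : Program :=
  .loop (.and (.natLt (.add (.var 4) (.lit 1)) (.var 0)) (.natEq (.var 5) (.lit 1))) roundProg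

/-- Amortization: a round whose cost is proportional to `n * K.card` removes `K.card` of the `d`
remaining indices, so the total is linear in `n * d`, however the indices are distributed over the
rounds. -/
theorem roundsProg_spec {a : ℕ} (hO : O.QuadraticTime a) (hA : A.IsSymm) :
    ∀ (d : ℕ) (P : List (Fin n)) (σ : Store), (remaining P q).card = d → P.Nodup → q ∉ P →
      Ctx A q σ → Rep A q P σ → σ.natVar 5 = 1 →
      Spec O roundsProg σ ((2000 + 5 * a) * n * d + 20) fun τ =>
        (checkCandidateDP O A q P = none ∧ τ.natVar 5 = 0) ∨
          ∃ P', checkCandidateDP O A q P = some (P' ++ [q]) ∧ τ.natVar 5 = 1 ∧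
            P'.length + 1 = n ∧ Rep A q P' τ := by
  have hn : 1 ≤ n := q.pos
  intro d
  induction d using Nat.strong_induction_on with
  | _ d ih =>
    intro P σ hd hP hq hctx hrep h5
    have hlen := length_append_remaining hP hq
    by_cases hne : remaining P q = ∅
    · rw [hne, Finset.card_empty] at hlen
      refine Spec.le (Spec.loopDone ?_ ?_) (by simp only [BExpr.cost, NExpr.cost]; omega)
      · simp only [BExpr.Holds, NExpr.eval, hrep.len, hctx.dim]
        omega
      · exact Or.inr ⟨P, checkCandidateDP_of_empty hne, h5, by omega, hrep⟩
    · have hpos := Finset.card_pos.mpr (Finset.nonempty_iff_ne_empty.mpr hne)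
      have hK : 1 ≤ (minSet A P q).card := (minSet_nonempty A P q hne).card_pos
      have hKd : (minSet A P q).card ≤ d := hd ▸ Finset.card_le_card (minSet_subset A P q)
      refine Spec.le (Spec.loopStep (T' := (2000 + 5 * a) * n * (d - (minSet A P q).card) + 20)
        ?_ ((roundProg_spec hO hA hctx hrep hne).imp ?_)) ?_
      · simp only [BExpr.Holds, NExpr.eval, hrep.len, hctx.dim, h5, and_true]
        omega
      · intro τ hB hout
        rw [checkCandidateDP_step hP hq hne]
        rcases hout with ⟨h1, h2⟩ | ⟨B, h1, h2, h3⟩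
        · refine Spec.le (Spec.loopDone ?_ ?_) (by simp only [BExpr.cost, NExpr.cost]; omega)
          · simp [BExpr.Holds, NExpr.eval, h2]
          · left
            rw [h1]
            exact ⟨rfl, h2⟩
        · obtain ⟨h4, h5'⟩ := nodup_append_nextBlock hP hq h1
          have h6 := length_append_remaining h4 h5'
          rw [List.length_append, length_nextBlock h1] at h6
          rw [h1, Option.bind_some]
          exact ih _ (by omega) _ τ (by omega) h4 h5' (hctx.agree hB (by decide)) h3 h2
      · simp only [BExpr.cost, NExpr.cost]
        obtain ⟨e, rfl⟩ := Nat.exists_eq_add_of_le hKd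
        rw [Nat.add_sub_cancel_left]
        have : 1 ≤ n * (minSet A P q).card := Nat.mul_pos hn hK
        nlinarith

/-- The procedure CheckCandidateDP, started with the entry in variable `2`. -/
def checkProg : Program :=
  .seq (.setNat 5 (.lit 1)) <| .seq initProg <| .seq roundsProg <|
  .ite (.natEq (.var 5) (.lit 1)) (.setNatArr 0 (.sub (.var 0) (.lit 1)) (.var 3)) .skip

theorem checkProg_spec {a : ℕ} (hO : O.QuadraticTime a) (hA : A.IsSymm)
    (hctx : Ctx A q σ) {p : Fin n} (hp : σ.natVar 2 = p) (hpq : p ≠ q) :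
    Spec O checkProg σ ((2400 + 5 * a) * n * n) fun τ =>
      (checkCandidateDP O A q [p] = none ∧ τ.natVar 5 = 0) ∨
        ∃ L, checkCandidateDP O A q [p] = some L ∧ τ.natVar 5 = 1 ∧ L.length = n ∧
          ∀ (i : ℕ) (h : i < L.length), τ.natArr 0 i = (L[i] : ℕ) := by
  have hn : 1 ≤ n := q.pos
  have hcard : (remaining [p] q).card ≤ n := by simpa using Finset.card_le_univ (remaining [p] q)
  have hctx0 : Ctx A q (σ.writeNat 5 1) := hctx.congr (by simp) (by simp) rfl rfl
  refine Spec.le (Spec.seq (Spec.setNat (Spec.seq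
    (T' := (2000 + 5 * a) * n * (remaining [p] q).card + 20 + 20)
    ((initProg_spec hctx0 (p := p) (by simpa using hp)).imp ?_)))) ?_
  · intro τ hB hrep
    have h5 : τ.natVar 5 = 1 := by
      rw [hB.nat 5 (by decide)]
      simp
    refine Spec.seq ((roundsProg_spec hO hA _ [p] τ rfl (by simp) (by simpa using hpq.symm)
      (hctx0.agree hB (by decide)) hrep h5).imp ?_)
    intro υ hD hout
    have hctx' := (hctx0.agree hB (by decide)).agree hD (by decide)
    refine Spec.le (Spec.ite (fun hb => Spec.setNatArr ?_) (fun hb => Spec.skip ?_)) (by decide)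
    · simp only [BExpr.Holds, NExpr.eval] at hb
      rcases hout with ⟨-, h0⟩ | ⟨P', h1, h2, h3, h4⟩
      · omega
      refine Or.inr ⟨_, h1, by simpa using hb, by simpa using h3, ?_⟩
      simp only [NExpr.eval, hctx'.dim, hctx'.last]
      apply getElem_append_singleton_eq
      · intro i hi
        have : i ≠ n - 1 := by omega
        simp [this, h4.perm i hi]
      · have : P'.length = n - 1 := by omega
        simp [this]
    · simp only [BExpr.Holds, NExpr.eval] at hb
      rcases hout with ⟨h, h0⟩ | ⟨P', -, h1, -⟩
      · exact Or.inl ⟨h, h0⟩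
      · exact absurd h1 hb
  · simp only [NExpr.cost]
    have h1 : n * (remaining [p] q).card ≤ n * n := Nat.mul_le_mul_left _ hcard
    have h2 : n ≤ n * n := Nat.le_mul_of_pos_left _ hn
    have h3 : a * (n * (remaining [p] q).card) ≤ a * (n * n) := Nat.mul_le_mul_left _ h1
    nlinarith

/-- The difference of the entries in column `e` of two consecutive rows of the permuted matrix. -/
def rowDiff (e : NExpr) : RExpr :=
  .sub (.arr 1 (.arr 0 (.add (.var 7) (.lit 1))) (.arr 0 e))
    (.arr 1 (.arr 0 (.add (.var 7) (.lit 2))) (.arr 0 e))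

/-- The test of the adjacent condition. -/
def testProg : Program :=
  .seq (.setNat 1 (.lit 1)) <|
  forLoop 7 (.lit 0) (.sub (.var 0) (.lit 3)) <|
    .seq (.setReal 3 (rowDiff (.lit 0))) <|
    .seq (forLoop 8 (.lit 0) (.add (.var 7) (.lit 1)) <|
      .ite (.realLe (rowDiff (.var 8)) (.var 3)) .skip (.setReal 3 (rowDiff (.var 8)))) <|
    .seq (.setReal 4 (rowDiff (.sub (.var 0) (.lit 1)))) <|
    .seq (forLoop 8 (.add (.var 7) (.lit 3)) (.var 0) <|
      .ite (.realLe (.var 4) (rowDiff (.var 8))) .skip (.setReal 4 (rowDiff (.var 8)))) <|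
    .ite (.realLe (.var 3) (.var 4)) .skip (.setNat 1 (.lit 0))

/-- The difference of rows `j + 1` and `j + 2` of the permuted matrix in the store. -/
def storeDiff (σ : Store) (j e : ℕ) : ℝ :=
  σ.realArr 1 (σ.natArr 0 (j + 1)) (σ.natArr 0 e) - σ.realArr 1 (σ.natArr 0 (j + 2)) (σ.natArr 0 e)

theorem rowDiff_eval {j : ℕ} (e : NExpr) (h1 : τ.realArr 1 = σ.realArr 1)
    (h2 : τ.natArr 0 = σ.natArr 0) (h7 : τ.natVar 7 = j) :
    (rowDiff e).eval τ = storeDiff σ j (e.eval τ) := by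
  simp only [rowDiff, RExpr.eval, NExpr.eval, h1, h2, h7, storeDiff]

/-- One maximum and one minimum for each pair of consecutive rows keep the test quadratic. The
counter `j` stands for rows `j + 1` and `j + 2`, so that `i ≤ j` and `j + 3 ≤ l`; both ranges are
non-empty exactly for `j < n - 3`. -/
theorem testProg_spec (hn : 1 ≤ n) (h0 : σ.natVar 0 = n) :
    Spec O testProg σ (500 * n * n) fun τ =>
      (τ.natVar 1 = 1 ∧ ∀ j i l, i ≤ j → j + 3 ≤ l → l < n →
        storeDiff σ j i ≤ storeDiff σ j l) ∨
      (τ.natVar 1 = 0 ∧ ∃ j i l, i ≤ j ∧ j + 3 ≤ l ∧ l < n ∧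
        ¬ storeDiff σ j i ≤ storeDiff σ j l) := by
  refine Spec.le (Spec.seq (Spec.setNat (Spec.forLoop 0 (n - 3) n (300 * n)
    (fun k τ => (τ.natVar 1 = 1 ∧ ∀ j i l, j < k → i ≤ j → j + 3 ≤ l → l < n →
        storeDiff σ j i ≤ storeDiff σ j l) ∨
      (τ.natVar 1 = 0 ∧ ∃ j i l, i ≤ j ∧ j + 3 ≤ l ∧ l < n ∧
        ¬ storeDiff σ j i ≤ storeDiff σ j l))
    rfl (Nat.zero_le _) (by decide) ?_ ?_ ?_ ?_ (by decide) (by decide) hn (by omega)))) ?_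
  · intro τ hB
    simp only [NExpr.eval]
    rw [hB.nat 0 (by decide)]
    simp [h0]
  · left
    exact ⟨by simp [NExpr.eval], fun j i l hj => by omega⟩
  · intro k τ _ hk h7 hB hI
    have e0 : τ.natVar 0 = n := by
      rw [hB.nat 0 (by decide)]
      simp [h0]
    have ea : τ.natArr 0 = σ.natArr 0 := hB.natArr 0 (by decide)
    have er : τ.realArr 1 = σ.realArr 1 := hB.realArr 1 (by decide)
    refine Spec.le (Spec.seq (Spec.setReal (Spec.seq (T' := 130 * n) (Spec.forLoop 0 (k + 1) n 60
      (fun m υ => (∃ i ≤ k, υ.realVar 3 = storeDiff σ k i) ∧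
        ∀ i < m, storeDiff σ k i ≤ υ.realVar 3)
      rfl (Nat.zero_le _) (by decide) ?_ ?_ ?_ ?_ (by decide) (by decide) hn (by omega))))) ?_
    · intro υ hD
      simp only [NExpr.eval]
      rw [hD.nat 7 (by decide)]
      simp [h7]
    · refine ⟨⟨0, Nat.zero_le _, ?_⟩, fun i hi => by omega⟩
      simp [rowDiff_eval _ er ea h7, NExpr.eval]
    · intro m υ _ hm h8 hD hJ
      have h7' : υ.natVar 7 = k := (hD.nat 7 (by decide)).trans h7
      have ea' : υ.natArr 0 = σ.natArr 0 := (hD.natArr 0 (by decide)).trans ea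
      have er' : υ.realArr 1 = σ.realArr 1 := (hD.realArr 1 (by decide)).trans er
      refine Spec.le (Spec.ite (fun hb => Spec.skip ?_) (fun hb => Spec.setReal ?_)) (by decide)
      all_goals
        simp only [BExpr.Holds, RExpr.eval, rowDiff_eval _ er' ea' h7', NExpr.eval, h8] at hb
      · refine ⟨by simpa using hJ.1, fun i hi => ?_⟩
        simp only [writeNat_realVar]
        by_cases him : i = m
        · exact him ▸ hb
        · exact hJ.2 i (by omega)
      · simp only [rowDiff_eval _ er' ea' h7', NExpr.eval, h8, writeNat_realVar,
          writeReal_realVar, if_true]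
        refine ⟨⟨m, by omega, rfl⟩, fun i hi => ?_⟩
        by_cases him : i = m
        · rw [him]
        · exact (hJ.2 i (by omega)).trans (not_le.mp hb).le
    · intro υ hD hJ
      have h7' : υ.natVar 7 = k := (hD.nat 7 (by decide)).trans h7
      have e0' : υ.natVar 0 = n := (hD.nat 0 (by decide)).trans e0
      have ea' : υ.natArr 0 = σ.natArr 0 := (hD.natArr 0 (by decide)).trans ea
      have er' : υ.realArr 1 = σ.realArr 1 := (hD.realArr 1 (by decide)).trans er
      have e1' : υ.natVar 1 = τ.natVar 1 := hD.nat 1 (by decide)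
      refine Spec.le (Spec.seq (Spec.setReal (Spec.seq (T' := 20)
        (Spec.forLoop (k + 3) n n 60
        (fun m ω => (∃ l, k + 3 ≤ l ∧ l < n ∧ ω.realVar 4 = storeDiff σ k l) ∧
          ∀ l, k + 3 ≤ l → l < m → ω.realVar 4 ≤ storeDiff σ k l)
        ?_ (by omega) (by decide) ?_ ?_ ?_ ?_ (by decide) (by decide) hn (by omega))))) ?_
      · simp [NExpr.eval, h7']
      · intro ω hE
        exact (hE.nat 0 (by decide)).trans e0'
      -- The last column is a legitimate initial value for the minimum, because `k < n - 3`.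
      · refine ⟨⟨n - 1, by omega, by omega, ?_⟩, fun l h1 h2 => by omega⟩
        simp [rowDiff_eval _ er' ea' h7', NExpr.eval, e0']
      · intro m ω hkm hm h8 hE hM
        have h7'' : ω.natVar 7 = k := (hE.nat 7 (by decide)).trans h7'
        have ea'' : ω.natArr 0 = σ.natArr 0 := (hE.natArr 0 (by decide)).trans ea'
        have er'' : ω.realArr 1 = σ.realArr 1 := (hE.realArr 1 (by decide)).trans er'
        refine Spec.le (Spec.ite (fun hb => Spec.skip ?_) (fun hb => Spec.setReal ?_)) (by decide)
        all_goals
          simp only [BExpr.Holds, RExpr.eval, rowDiff_eval _ er'' ea'' h7'', NExpr.eval, h8] at hb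
        · refine ⟨by simpa using hM.1, fun l h1 h2 => ?_⟩
          simp only [writeNat_realVar]
          by_cases hlm : l = m
          · exact hlm ▸ hb
          · exact hM.2 l h1 (by omega)
        · simp only [rowDiff_eval _ er'' ea'' h7'', NExpr.eval, h8, writeNat_realVar,
            writeReal_realVar, if_true]
          refine ⟨⟨m, hkm, hm, rfl⟩, fun l h1 h2 => ?_⟩
          by_cases hlm : l = m
          · rw [hlm]
          · exact (not_le.mp hb).le.trans (hM.2 l h1 (by omega))
      · intro ω hE hM
        have e3 : ω.realVar 3 = υ.realVar 3 := hE.real 3 (by decide)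
        have e1 : ω.natVar 1 = τ.natVar 1 := (hE.nat 1 (by decide)).trans e1'
        obtain ⟨i₀, hi₀, hv⟩ := hJ.1
        obtain ⟨l₀, hl₀, hl₀', hw⟩ := hM.1
        refine Spec.le (Spec.ite (fun hb => Spec.skip ?_) (fun hb => Spec.setNat ?_)) (by decide)
        all_goals simp only [BExpr.Holds, RExpr.eval, e3] at hb
        · rcases hI with ⟨h1, h2⟩ | ⟨h1, h2⟩
          · left
            refine ⟨by simp [e1, h1], fun j i l hj hi hl hln => ?_⟩
            by_cases hjk : j = k
            · subst hjk
              exact ((hJ.2 i (by omega)).trans hb).trans (hM.2 l hl hln)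
            · exact h2 j i l (by omega) hi hl hln
          · exact Or.inr ⟨by simp [e1, h1], h2⟩
        · right
          refine ⟨by simp [NExpr.eval], k, i₀, l₀, hi₀, hl₀, hl₀', ?_⟩
          rwa [← hv, ← hw]
      · simp only [RExpr.cost, NExpr.cost, rowDiff]
        omega
    · simp only [RExpr.cost, NExpr.cost, rowDiff]
      omega
  · intro τ hB hI
    rcases hI with ⟨h1, h2⟩ | h
    · exact Or.inl ⟨h1, fun j i l hi hl hln => h2 j i l (by omega) hi hl hln⟩
    · exact Or.inr h
  · simp only [NExpr.cost]
    nlinarith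

theorem passesTest_iff_storeDiff (hA : ∀ i j : Fin n, σ.realArr 1 i j = A i j)
    {L : List (Fin n)} (hlen : L.length = n)
    (hL : ∀ (i : ℕ) (h : i < L.length), σ.natArr 0 i = (L[i] : ℕ)) :
    PassesTest A L ↔ ∀ j i l, i ≤ j → j + 3 ≤ l → l < n → storeDiff σ j i ≤ storeDiff σ j l := by
  have key : ∀ (i j : ℕ) (hi : i < n) (hj : j < n),
      σ.realArr 1 (σ.natArr 0 i) (σ.natArr 0 j) =
        A (L.get (Fin.cast hlen.symm ⟨i, hi⟩)) (L.get (Fin.cast hlen.symm ⟨j, hj⟩)) := by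
    intro i j hi hj
    rw [hL i (by omega), hL j (by omega), hA]
    rfl
  constructor
  · rintro ⟨_, h⟩ j i l hij hjl hl
    have := h ⟨i, by omega⟩ ⟨j + 1, by omega⟩ ⟨j + 2, by omega⟩ ⟨l, hl⟩
      (Fin.mk_lt_mk.mpr (by omega)) rfl (Fin.mk_lt_mk.mpr (by omega))
    simp only [storeDiff]
    rw [key _ _ (by omega) (by omega), key _ _ (by omega) (by omega),
      key _ _ (by omega) (by omega), key _ _ (by omega) (by omega)]
    exact this
  · intro h
    refine ⟨hlen, fun i j k l hij hjk hkl => ?_⟩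
    rw [Fin.lt_def] at hij hkl
    obtain ⟨j', hj'⟩ : ∃ j', (j : ℕ) = j' + 1 := ⟨j - 1, by omega⟩
    have := h j' i l (by omega) (by omega) l.isLt
    have hj2 : j' + 2 = k := by omega
    simp only [storeDiff, ← hj', hj2] at this
    rw [key _ _ j.isLt i.isLt, key _ _ k.isLt i.isLt, key _ _ j.isLt l.isLt,
      key _ _ k.isLt l.isLt] at this
    exact this

end Check

/-! ### The double loop and the total running time. -/

section Implementation

variable {n : ℕ} {O : Oracle} {σ : Store}

/-- The body of the double loop. -/
def pairProg : Program :=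
  .ite (.and (.natEq (.var 1) (.lit 0)) (.not (.natEq (.var 2) (.var 3))))
    (.seq shiftProg <| .seq normProg <| .seq checkProg <|
      .ite (.natEq (.var 5) (.lit 1)) testProg .skip)
    .skip

/-- The algorithm RecognPD. -/
def recognProg : Program :=
  forLoop 2 (.lit 0) (.var 0) <| forLoop 3 (.lit 0) (.var 0) pairProg

theorem findSome_finRange_eq_some {α : Type*} {f : Fin n → Option α} (k : Fin n) {x : α}
    (h : ∀ i < k, f i = none) (hk : f k = some x) : (List.finRange n).findSome? f = some x := by
  rw [List.findSome?_eq_some_iff]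
  refine ⟨(List.finRange n).take k, k, (List.finRange n).drop (k + 1), ?_, hk, ?_⟩
  · have := take_finRange_succ k.isLt
    rw [← List.singleton_append, ← List.append_assoc, ← this, List.take_append_drop]
  · intro i hi
    obtain ⟨j, hj, rfl⟩ := List.mem_take_iff_getElem.mp hi
    apply h
    rw [Fin.lt_def]
    simp only [List.getElem_finRange, Fin.val_cast]
    omega

theorem recognPD_eq_some_of_first {C : Matrix (Fin n) (Fin n) ℝ} {p q : Fin n} (hpq : p ≠ q)
    {L : List (Fin n)} (h : tryPair O C p q = some L)
    (hlt : ∀ p' q', p' ≠ q' → p' < p ∨ (p' = p ∧ q' < q) → tryPair O C p' q' = none) :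
    recognPD O C = some L := by
  refine findSome_finRange_eq_some p (fun p' hp' => ?_) (findSome_finRange_eq_some q
    (fun q' hq' => ?_) (by rw [if_neg hpq, h]))
  · rw [List.findSome?_eq_none_iff]
    intro q' _
    split_ifs with h'
    · rfl
    · exact hlt p' q' h' (Or.inl hp')
  · split_ifs with h'
    · rfl
    · exact hlt p q' h' (Or.inr ⟨rfl, hq'⟩)

/-- The state of the double loop when the pairs in `S` have been tried. -/
def Tried (O : Oracle) (C : Matrix (Fin n) (Fin n) ℝ) (S : Fin n → Fin n → Prop) (σ : Store) :
    Prop :=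
  (σ.natVar 1 = 0 ∧ ∀ p q, p ≠ q → S p q → tryPair O C p q = none) ∨
    (σ.natVar 1 = 1 ∧ ∃ L, recognPD O C = some L ∧
      ∀ (i : ℕ) (h : i < L.length), σ.natArr 0 i = (L[i] : ℕ))

/-- Variable `1` doubles as the result of the test and as the stop flag. Once it is set, later pairs
are skipped at constant cost and the stored permutation survives until the end. -/
theorem pairProg_spec {a : ℕ} (hO : O.QuadraticTime a) {C : Matrix (Fin n) (Fin n) ℝ}
    (hC : C.IsSymm) {p q : Fin n} (h0 : σ.natVar 0 = n) (hp : σ.natVar 2 = p)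
    (hq : σ.natVar 3 = q) (hmat : ∀ i j : Fin n, σ.realArr 0 i j = C i j)
    (hI : Tried O C (fun p' q' => p' < p ∨ (p' = p ∧ q' < q)) σ) :
    Spec O pairProg σ ((3500 + 5 * a) * n * n)
      (Tried O C fun p' q' => p' < p ∨ (p' = p ∧ q' ≤ q)) := by
  have hn : 1 ≤ n := q.pos
  have hnn : 1 ≤ n * n := Nat.mul_pos hn hn
  have hpq' : σ.natVar 2 = σ.natVar 3 ↔ p = q := by rw [hp, hq, Fin.ext_iff]
  -- A failed pair and a skipped diagonal pair extend the tried set in the same way.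
  have hnone : tryPair O C p q = none ∨ p = q →
      (∀ p' q', p' ≠ q' → p' < p ∨ (p' = p ∧ q' < q) → tryPair O C p' q' = none) →
      ∀ p' q', p' ≠ q' → p' < p ∨ (p' = p ∧ q' ≤ q) → tryPair O C p' q' = none := by
    intro h1 h2 p' q' hne hlt
    by_cases h : p' = p ∧ q' = q
    · obtain ⟨rfl, rfl⟩ := h
      exact h1.resolve_right hne
    · refine h2 p' q' hne (hlt.imp_right fun h3 => ⟨h3.1, lt_of_le_of_ne h3.2 fun h4 => ?_⟩)
      exact h ⟨h3.1, h4⟩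
  refine Spec.le (Spec.ite (fun hb => Spec.seq (T' := 200 * n * n + ((2400 + 5 * a) * n * n +
    (500 * n * n + 10))) ((shiftProg_spec p h0 hp hmat).imp ?_)) (fun hb => Spec.skip ?_)) ?_
  · simp only [BExpr.Holds, NExpr.eval, hpq'] at hb
    obtain ⟨hb1, hpq⟩ := hb
    have hprev : ∀ p' q', p' ≠ q' → p' < p ∨ (p' = p ∧ q' < q) → tryPair O C p' q' = none := by
      rcases hI with ⟨-, h⟩ | ⟨h, -⟩
      · exact h
      · omega
    intro τ hB hA
    refine Spec.seq ((normProg_spec hn ((hB.nat 0 (by decide)).trans h0) hA).imp ?_)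
    intro υ hD hM
    have hctx : Ctx (shifted C p) q υ := by
      refine ⟨?_, ?_, fun i j => ?_, hM⟩
      · rw [hD.nat 0 (by decide), hB.nat 0 (by decide), h0]
      · rw [hD.nat 3 (by decide), hB.nat 3 (by decide), hq]
      · rw [hD.realArr 1 (by decide), hA]
    refine Spec.seq ((checkProg_spec hO (shifted_isSymm hC p) hctx (p := p) ?_ hpq).imp ?_)
    · rw [hD.nat 2 (by decide), hB.nat 2 (by decide), hp]
    intro ω hE hout
    have hctx' := hctx.agree hE (by decide)
    have h1 : ω.natVar 1 = 0 := by
      rw [hE.nat 1 (by decide), hD.nat 1 (by decide), hB.nat 1 (by decide), hb1]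
    refine Spec.le (Spec.ite (T := 500 * n * n) (fun hc => ?_) (fun hc => Spec.skip ?_))
      (by simp only [BExpr.cost, NExpr.cost]; omega)
    · simp only [BExpr.Holds, NExpr.eval] at hc
      rcases hout with ⟨-, h⟩ | ⟨L, hL, -, hlen, hshow⟩
      · omega
      have htest := passesTest_iff_storeDiff hctx'.mat hlen hshow
      refine (testProg_spec hn hctx'.dim).imp ?_
      intro η hF hres
      rcases hres with ⟨h2, h3⟩ | ⟨h2, h3⟩
      · refine Or.inr ⟨h2, L, recognPD_eq_some_of_first hpq
          (tryPair_eq_some.mpr ⟨hL, htest.mpr h3⟩) hprev, ?_⟩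
        rw [hF.natArr 0 (by decide)]
        exact hshow
      · refine Or.inl ⟨h2, hnone (Or.inl ?_) hprev⟩
        by_contra hne
        obtain ⟨L', hL'⟩ := Option.ne_none_iff_exists'.mp hne
        obtain ⟨h4, h5⟩ := tryPair_eq_some.mp hL'
        rw [hL] at h4
        obtain rfl := Option.some.inj h4
        obtain ⟨j, i, l, hi, hl, hln, hlt⟩ := h3
        exact hlt (htest.mp h5 j i l hi hl hln)
    · simp only [BExpr.Holds, NExpr.eval] at hc
      rcases hout with ⟨h, -⟩ | ⟨L, -, h, -⟩
      · refine Or.inl ⟨h1, hnone (Or.inl ?_) hprev⟩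
        by_contra hne
        obtain ⟨L', hL'⟩ := Option.ne_none_iff_exists'.mp hne
        rw [(tryPair_eq_some.mp hL').1] at h
        cases h
      · exact absurd h hc
  · simp only [BExpr.Holds, NExpr.eval, hpq', not_and, not_not] at hb
    rcases hI with ⟨h1, h2⟩ | h
    · exact Or.inl ⟨h1, hnone (Or.inr (hb h1)) h2⟩
    · exact Or.inr h
  · simp only [BExpr.cost, NExpr.cost]
    nlinarith

theorem Tried.mono {C : Matrix (Fin n) (Fin n) ℝ} {S S' : Fin n → Fin n → Prop} {τ : Store}
    (h : Tried O C S σ) (hS : ∀ p q, S' p q → S p q) (h1 : τ.natVar 1 = σ.natVar 1)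
    (h2 : τ.natArr 0 = σ.natArr 0) : Tried O C S' τ := by
  rcases h with ⟨h3, h4⟩ | ⟨h3, h4⟩
  · exact Or.inl ⟨h1.trans h3, fun p q hpq hs => h4 p q hpq (hS p q hs)⟩
  · refine Or.inr ⟨h1.trans h3, ?_⟩
    rwa [h2]

theorem recognProg_spec {a : ℕ} (hO : O.QuadraticTime a) (hn : 1 ≤ n)
    {C : Matrix (Fin n) (Fin n) ℝ} (hC : C.IsSymm) :
    Spec O recognProg (inputStore C) ((3600 + 5 * a) * n ^ 4) fun τ =>
      ShowsOutput τ (recognPD O C) := by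
  have h0 : (inputStore C).natVar 0 = n := by simp [inputStore]
  have hmat : ∀ i j : Fin n, (inputStore C).realArr 0 i j = C i j := by
    intro i j
    simp [inputStore]
  have hn2 : n ≤ n * n := Nat.le_mul_of_pos_left _ hn
  have hn3 : n * n ≤ n * n * n := Nat.le_mul_of_pos_right _ hn
  have hn4 : n * n * n ≤ n * n * n * n := Nat.le_mul_of_pos_right _ hn
  refine Spec.le (Spec.forLoop 0 n n ((3550 + 5 * a) * n * n * n)
    (fun k τ => Tried O C (fun p _ => (p : ℕ) < k) τ)
    rfl (Nat.zero_le _) (by decide) (fun τ hB => (hB.nat 0 (by decide)).trans h0) ?_ ?_ ?_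
    (by decide) (by decide) hn (by omega)) ?_
  · exact Or.inl ⟨by simp [inputStore], fun p q _ h => by omega⟩
  · intro k τ _ hk h2 hB hI
    refine Spec.le (Spec.forLoop 0 n n ((3500 + 5 * a) * n * n)
      (fun l υ => Tried O C (fun p q => (p : ℕ) < k ∨ ((p : ℕ) = k ∧ (q : ℕ) < l)) υ)
      rfl (Nat.zero_le _) (by decide) ?_ ?_ ?_ ?_ (by decide) (by decide) hn (by omega)) ?_
    · intro υ hD
      exact (hD.nat 0 (by decide)).trans ((hB.nat 0 (by decide)).trans h0)
    · exact hI.mono (fun p q h => by omega) (by simp) rfl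
    · intro l υ _ hl h3 hD hJ
      refine (pairProg_spec hO hC (p := ⟨k, hk⟩) (q := ⟨l, hl⟩) ?_ ?_ h3 ?_ ?_).imp ?_
      · rw [hD.nat 0 (by decide), hB.nat 0 (by decide), h0]
      · exact (hD.nat 2 (by decide)).trans h2
      · intro i j
        rw [hD.realArr 0 (by decide), hB.realArr 0 (by decide), hmat]
      · refine hJ.mono (fun p q h => ?_) rfl rfl
        simpa [Fin.lt_def, Fin.ext_iff] using h
      · intro ω hE hR
        refine hR.mono (fun p q h => ?_) (by simp) rfl
        simp only [Fin.lt_def, Fin.le_def, Fin.ext_iff]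
        omega
    · intro υ hD hJ
      exact hJ.mono (fun p q h => by have := q.isLt; omega) (by simp) rfl
    · nlinarith
  · intro τ hB hI
    rcases hI with ⟨h1, h2⟩ | ⟨h1, L, hL, h2⟩
    · rw [recognPD_eq_none_iff.mpr fun p q hpq => h2 p q hpq p.isLt]
      exact h1
    · rw [hL]
      exact ⟨h1, h2⟩
  · have : n ^ 4 = n * n * n * n := by ring
    rw [this]
    nlinarith

end Implementation

end

end Demidenko

theorem theorem4p1 :
    -- correctness
    (∀ O : Demidenko.Oracle, O.Correct →
      ∀ n : ℕ, 2 ≤ n → ∀ C : Matrix (Fin n) (Fin n) ℝ, C.IsSymm →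
        (Demidenko.recognPD O C = none ↔ ¬ Demidenko.IsPermutedDemidenko C) ∧
        ∀ L : List (Fin n), Demidenko.recognPD O C = some L →
          ∃ φ : Equiv.Perm (Fin n), L = List.ofFn φ ∧ Demidenko.IsDemidenkoPerm C φ) ∧
    -- implementation and running time
    (∃ S : Demidenko.Program, ∀ a : ℕ, ∃ c : ℕ,
      ∀ O : Demidenko.Oracle, O.Correct → O.QuadraticTime a →
        ∀ n : ℕ, 2 ≤ n → ∀ C : Matrix (Fin n) (Fin n) ℝ, C.IsSymm →
          ∃ (t : ℕ) (τ : Demidenko.Store),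
            Demidenko.Exec O S (Demidenko.inputStore C) t τ ∧
            Demidenko.ShowsOutput τ (Demidenko.recognPD O C) ∧ t ≤ c * n ^ 4) := by
  refine ⟨fun O hO n hn C hC => Demidenko.recognPD_correct hO hn hC,
    Demidenko.recognProg, fun a => ⟨3600 + 5 * a, fun O _ hO n hn C hC => ?_⟩⟩
  obtain ⟨t, τ, h1, h2, h3⟩ := Demidenko.recognProg_spec hO (by omega) hC
  exact ⟨t, τ, h1, h3, h2⟩
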